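/- Let $N\ge 1$, $m\ge 2$ be integers, $\sigma\in\{1,-1\}$, $|d|>0$, and $\epsilon(k)=\sigma|d|k^m$ for $k\in\mathbb R$. Let $|u\rangle\in\mathbb C^N$ be a unit vector and let $\boldsymbol K^R$ be a complex $N\times N$ matrix whose anti-Hermitian part $i\boldsymbol B$, $\boldsymbol B=(\boldsymbol K^R-\boldsymbol K^{R\dagger})/2i$, satisfies $\boldsymbol B\le 0$ (Hermitian or dissipative emitters). Let $V:\mathbb R\to\mathbb C$ be measurable and locally square-integrable, continuous at $0$ with $V(0)\ne0$, and with $|V(k)|^2=o(|k|^{m-\gamma})$ as $k\to\pm\infty$ for some $\gamma>1$. Assume also that $|V|^2$ is locally Hölder continuous with at most polynomially growing constant: $\bigl||V(k)|^2-|V(k')|^2\bigr|\le C(1+|k|+|k'|)^p|k-k'|^\alpha$ for all $k,k'$, with some $C$, $p\in\mathbb N$, $\alpha>0$. Put $|v_k\rangle=V(k)|u\rangle$ and consider on $L^2(\mathbb R)\oplus\mathbb C^N$ the Hamiltonian $$H(\psi,e)=\Bigl(\epsilon\psi+V^*\langle u|e\rangle,\ \Bigl(\int V\psi\,dk\Bigr)|u\rangle+\boldsymbol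 K^Re\Bigr).$$ Let $\mathcal R_c=\epsilon(\mathbb R)\setminus\{0\}$ be the continuum spectrum, and put $$\boldsymbol K(\omega)=\int\frac{|v_k\rangle\langle v_k|}{\omega-\epsilon(k)}dk,\quad \boldsymbol G(\omega)=(\omega-\boldsymbol K^R-\boldsymbol K(\omega))^{-1},\quad T(\omega,k,k')=\langle v_{k'}|\boldsymbol G(\omega)|v_k\rangle .$$ For $E\in\mathcal R_c$ let $k_\alpha(E)$ run over the solutions of $\epsilon(k)=E$ and let $$S_{\alpha\beta}(E)=\delta_{\alpha\beta}-2\pi i\,\frac{T(E+i0^+,k_\alpha(E),k_\beta(E))}{\sqrt{|\epsilon'(k_\alpha(E))\,\epsilon'(k_\beta(E))|}} .$$ Assume that 1. there is no bound state in the continuum: for no $E\in\mathcal R_c$ does $E-\boldsymbol K^R-\boldsymbol K(E+i0^+)$ have the eigenvalue $0$; 2. there is no bright zero-energy eigenstate: $H$ has no zero-energy eigenstate with photon wave function $c\,\delta(k)+\psi(k)$, $c\in\mathbb C$, $\psi\in L^2(\mathbb R)$, in which both the photon part and the emitter part are nonzero; 3. $\det\boldsymbol S(E)\neq0$ for all $E\in\mathcal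 R_c$. Then the boundary values $T(E+i0^+,k,k')$ exist for all $E\in\mathcal R_c$ and all $k,k'$. The number $N_B$ of bound states, i.e. the total algebraic multiplicity of the eigenvalues $E\in\mathbb C\setminus\mathcal R_c$ of $H$, is finite. The winding phase $\Delta\delta$ of $\det\boldsymbol S(E)$ over $\mathcal R_c$ exists and $$\Delta\delta=\pi(N-N_B)+\pi\,\frac{m-1}{m}.$$ Here $\Delta\delta$ is the increment, from the lower to the upper end of $\mathcal R_c$, of a continuous phase $\delta$ with $\det\boldsymbol S=|\det\boldsymbol S|e^{2i\delta}$; for odd $m$ it is the sum of the increments over $(-\infty,0)$ and $(0,\infty)$. If $\det\boldsymbol S$ is differentiable on $\mathcal R_c$ with locally integrable derivative, then also $$2\Delta\delta=-i\int_{\mathcal R_c}\frac{\partial_E\det\boldsymbol S(E)}{\det\boldsymbol S(E)}\,dE$$ as a convergent improper integral. -/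

import Mathlib

open MeasureTheory Filter Topology Asymptotics Matrix

noncomputable section

/-- The data of a one-dimensional single-excitation emitter scattering model with `N` emitters:
dispersion relation `ε(k) = σ |d| k ^ m` (the field `d` is the positive number `|d|`), coupling
`|v_k⟩ = V(k) |u⟩` with a unit vector `u`, and the emitter matrix `K^R`. -/
structure EmitterModel (N : ℕ) where
  /-- exponent of the dispersion relation -/
  m : ℕ
  two_le_m : 2 ≤ m
  /-- sign of the dispersion relation -/
  σ : ℝ
  σ_eq : σ = 1 ∨ σ = -1
  /-- strength of the dispersion relation -/
  d : ℝ
  d_pos : 0 < d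
  /-- momentum dependence of the photon-emitter coupling -/
  V : ℝ → ℂ
  /-- emitter direction of the photon-emitter coupling -/
  u : Fin N → ℂ
  u_unit : star u ⬝ᵥ u = 1
  /-- coherent and incoherent interactions of the emitters -/
  KR : Matrix (Fin N) (Fin N) ℂ

namespace EmitterModel

variable {N : ℕ} (M : EmitterModel N)

/-- Dispersion relation. -/
def ε (k : ℝ) : ℝ := M.σ * M.d * k ^ M.m

/-- Coupling vector `|v_k⟩`. -/
def v (k : ℝ) : Fin N → ℂ := M.V k • M.u

/-- Continuum spectrum; the threshold energy `0` does not belong to it. -/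
def continuum : Set ℝ := {E | E ≠ 0 ∧ ∃ k, M.ε k = E}

/-! ### The Hamiltonian and its eigenstates -/

/-- Normalizable single-excitation states: a square-integrable momentum-space photon wave
function together with the emitter amplitudes. -/
abbrev State (N : ℕ) : Type := (Lp ℂ 2 (volume : Measure ℝ)) × (Fin N → ℂ)

/-- The graph of the single-excitation Hamiltonian: `H (ψ, e) = (φ, f)` with
`φ(k) = ε(k) ψ(k) + V(k)^* ⟨u|e⟩` and `f = (∫ V(k) ψ(k) dk) u + K^R e`. -/
def hamiltonian : Submodule ℂ (State N × State N) where
  carrier := {p |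
    (∀ᵐ k : ℝ, p.2.1 k = (M.ε k : ℂ) * p.1.1 k + star (M.V k) * (star M.u ⬝ᵥ p.1.2)) ∧
    Integrable (fun k : ℝ => M.V k * p.1.1 k) ∧
    p.2.2 = (∫ k : ℝ, M.V k * p.1.1 k) • M.u + M.KR *ᵥ p.1.2}
  add_mem' := by
    rintro ⟨⟨ψ, e⟩, ⟨φ, f⟩⟩ ⟨⟨ψ', e'⟩, ⟨φ', f'⟩⟩ ⟨h1, h2, h3⟩ ⟨h1', h2', h3'⟩
    have hψ := Lp.coeFn_add ψ ψ'
    have hφ := Lp.coeFn_add φ φ'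
    have hV : (fun k : ℝ => M.V k * (ψ + ψ') k) =ᵐ[volume]
        fun k => M.V k * ψ k + M.V k * ψ' k := by
      filter_upwards [hψ] with k hk
      rw [hk, Pi.add_apply, mul_add]
    refine ⟨?_, (h2.add h2').congr hV.symm, ?_⟩
    · filter_upwards [hψ, hφ, h1, h1'] with k a b c c'
      simp only [Prod.mk_add_mk, dotProduct_add] at c c' ⊢
      rw [a, b, Pi.add_apply, Pi.add_apply, c, c']
      ring
    · simp only [Prod.mk_add_mk] at h2 h2' h3 h3' ⊢
      rw [integral_congr_ae hV, integral_add h2 h2', h3, h3', mulVec_add, add_smul]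
      abel
  zero_mem' := by
    have h0 := Lp.coeFn_zero ℂ 2 (volume : Measure ℝ)
    have hV : (fun k : ℝ => M.V k * (0 : Lp ℂ 2 (volume : Measure ℝ)) k) =ᵐ[volume]
        fun _ => 0 := by
      filter_upwards [h0] with k hk
      rw [hk, Pi.zero_apply, mul_zero]
    refine ⟨?_, (integrable_zero ℝ ℂ volume).congr hV.symm, ?_⟩
    · filter_upwards [h0] with k hk
      simp
    · simp only [Prod.fst_zero, Prod.snd_zero]
      rw [integral_congr_ae hV]
      simp
  smul_mem' := by
    rintro c ⟨⟨ψ, e⟩, ⟨φ, f⟩⟩ ⟨h1, h2, h3⟩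
    have hψ := Lp.coeFn_smul c ψ
    have hφ := Lp.coeFn_smul c φ
    have hV : (fun k : ℝ => M.V k * (c • ψ) k) =ᵐ[volume] fun k => c * (M.V k * ψ k) := by
      filter_upwards [hψ] with k hk
      rw [hk, Pi.smul_apply, smul_eq_mul]
      ring
    refine ⟨?_, (h2.const_mul c).congr hV.symm, ?_⟩
    · filter_upwards [hψ, hφ, h1] with k a b h
      simp only [Prod.smul_mk, dotProduct_smul, smul_eq_mul] at h ⊢
      rw [a, b, Pi.smul_apply, Pi.smul_apply, h]
      simp only [smul_eq_mul]
      ring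
    · simp only [Prod.smul_mk] at h2 h3 ⊢
      rw [integral_congr_ae hV, integral_const_mul, h3, mulVec_smul, smul_add, smul_smul]

/-- Kernel of `(H - E) ^ n`: the states `Ψ` with `H Ψ = E Ψ + Φ` where `Φ` lies in the kernel of
`(H - E) ^ (n - 1)`. -/
def genEigenspace (E : ℂ) : ℕ → Submodule ℂ (State N)
  | 0 => ⊥
  | n + 1 =>
    { carrier := {Ψ | ∃ Φ ∈ genEigenspace E n, (Ψ, E • Ψ + Φ) ∈ M.hamiltonian}
      add_mem' := by
        rintro Ψ Ψ' ⟨Φ, hΦ, h⟩ ⟨Φ', hΦ', h'⟩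
        refine ⟨Φ + Φ', Submodule.add_mem _ hΦ hΦ', ?_⟩
        have := M.hamiltonian.add_mem h h'
        rw [Prod.mk_add_mk] at this
        rwa [smul_add, add_add_add_comm]
      zero_mem' := by
        refine ⟨0, Submodule.zero_mem _, ?_⟩
        rw [smul_zero, add_zero]
        exact M.hamiltonian.zero_mem
      smul_mem' := by
        rintro c Ψ ⟨Φ, hΦ, h⟩
        refine ⟨c • Φ, Submodule.smul_mem _ c hΦ, ?_⟩
        have := M.hamiltonian.smul_mem c h
        rw [Prod.smul_mk, smul_add] at this
        rwa [smul_comm E c Ψ] }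

/-- The space of normalizable (generalized) eigenstates of the Hamiltonian at energy `E`. -/
def boundSpace (E : ℂ) : Submodule ℂ (State N) := ⨆ n, M.genEigenspace E n

/-- Complex energies outside the continuum spectrum. -/
def offContinuum : Set ℂ := {E | ∀ x ∈ M.continuum, E ≠ (x : ℂ)}

/-- Number `N_B` of bound states: the total algebraic multiplicity of the eigenvalues of the
Hamiltonian outside the continuum spectrum. -/
def numBoundStates : ℕ :=
  ∑ᶠ (E : ℂ) (_ : E ∈ M.offContinuum), Module.finrank ℂ (M.boundSpace E)

/-- `(c, ψ, e)` is a zero-energy eigenstate of the Hamiltonian with momentum-space photon wave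
function `c δ(k) + ψ(k)` and emitter amplitude `e`. In position space, `c δ(k)` is a constant
photon wave function; since `ε(0) = 0`, the Hamiltonian annihilates `ε(k) δ(k)`, and
`∫ V(k) δ(k) dk = V(0)`. -/
def IsZeroEnergyEigenstate (c : ℂ) (ψ : Lp ℂ 2 (volume : Measure ℝ)) (e : Fin N → ℂ) : Prop :=
  (∀ᵐ k : ℝ, (M.ε k : ℂ) * ψ k + star (M.V k) * (star M.u ⬝ᵥ e) = 0) ∧
  Integrable (fun k : ℝ => M.V k * ψ k) ∧
  (c * M.V 0 + ∫ k : ℝ, M.V k * ψ k) • M.u + M.KR *ᵥ e = 0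

/-- There is a bright zero-energy eigenstate: one whose photon and emitter parts are both
nonzero. -/
def HasBrightZeroEnergyEigenstate : Prop :=
  ∃ (c : ℂ) (ψ : Lp ℂ 2 (volume : Measure ℝ)) (e : Fin N → ℂ),
    M.IsZeroEnergyEigenstate c ψ e ∧ ¬ (c = 0 ∧ ψ = 0) ∧ e ≠ 0

/-! ### The scattering matrix -/

/-- The matrix `K(ω) = ∫ |v_k⟩⟨v_k| / (ω - ε(k)) dk`. -/
def K (ω : ℂ) : Matrix (Fin N) (Fin N) ℂ :=
  Matrix.of fun i j => ∫ k : ℝ, M.v k i * star (M.v k j) / (ω - (M.ε k : ℂ))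

/-- The inverse emitter propagator `ω - K^R - K(ω)`. -/
def invG (ω : ℂ) : Matrix (Fin N) (Fin N) ℂ :=
  ω • (1 : Matrix (Fin N) (Fin N) ℂ) - M.KR - M.K ω

/-- The emitter propagator. -/
def G (ω : ℂ) : Matrix (Fin N) (Fin N) ℂ := (M.invG ω)⁻¹

/-- `E` in the continuum spectrum is the energy of a bound state in the continuum:
`E - K^R - K(E + i0⁺)` has the eigenvalue zero. -/
def IsBoundStateInContinuum (E : ℝ) : Prop :=
  E ∈ M.continuum ∧ ∃ e : Fin N → ℂ, e ≠ 0 ∧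
    Tendsto (fun η : ℝ => M.invG (E + η * Complex.I) *ᵥ e) (𝓝[>] 0) (𝓝 0)

/-- The single-particle `T`-matrix `T(ω, k, k') = ⟨v_{k'}| G(ω) |v_k⟩`. -/
def T (ω : ℂ) (k k' : ℝ) : ℂ := star (M.v k') ⬝ᵥ (M.G ω *ᵥ M.v k)

/-- The boundary value `T(E + i0⁺, k, k')`. -/
def TPlus (E k k' : ℝ) : ℂ :=
  limUnder (𝓝[>] (0 : ℝ)) fun η : ℝ => M.T (E + η * Complex.I) k k'

theorem finite_momenta (E : ℝ) : {k : ℝ | M.ε k = E}.Finite := by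
  have hm : 0 < M.m := lt_of_lt_of_le two_pos M.two_le_m
  have hσ : M.σ ≠ 0 := by
    rcases M.σ_eq with h | h <;> rw [h] <;> norm_num
  have hc : M.σ * M.d ≠ 0 := mul_ne_zero hσ M.d_pos.ne'
  refine Set.Finite.subset (Polynomial.nthRoots M.m (E / (M.σ * M.d))).toFinset.finite_toSet ?_
  intro k hk
  have hk' : M.σ * M.d * k ^ M.m = E := hk
  simp only [Finset.mem_coe, Multiset.mem_toFinset, Polynomial.mem_nthRoots hm]
  rw [eq_div_iff hc, ← hk', mul_comm]

/-- The degenerate momenta `k_α(E)` at energy `E`. -/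
def momenta (E : ℝ) : Finset ℝ := (M.finite_momenta E).toFinset

/-- The on-shell scattering matrix, indexed by the degenerate momenta at energy `E`. -/
def S (E : ℝ) : Matrix (M.momenta E) (M.momenta E) ℂ :=
  Matrix.of fun α β => (if α = β then 1 else 0) -
    2 * Real.pi * Complex.I * M.TPlus E α β /
      (Real.sqrt |deriv M.ε α * deriv M.ε β| : ℂ)

/-- The determinant of the scattering matrix. -/
def detS (E : ℝ) : ℂ := (M.S E).det

/-! ### The winding phase -/

/-- `w` is the winding phase of `det S` over the continuum spectrum: there is a scattering phase
`δ`, continuous on the continuum spectrum, with `det S = |det S| exp(2 i δ)`, and `w` is the sum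
of the increments of `δ`, from the lower to the upper end, over those of the two intervals
`(-∞, 0)` and `(0, ∞)` that belong to the continuum spectrum. -/
def HasWindingPhase (w : ℝ) : Prop :=
  ∃ δ : ℝ → ℝ, ContinuousOn δ M.continuum ∧
    (∀ E ∈ M.continuum, M.detS E = (‖M.detS E‖ : ℂ) * Complex.exp (2 * Complex.I * δ E)) ∧
    ∃ wneg wpos : ℝ, w = wneg + wpos ∧
      (Set.Iio 0 ⊆ M.continuum →
        ∃ a b, Tendsto δ atBot (𝓝 a) ∧ Tendsto δ (𝓝[<] 0) (𝓝 b) ∧ wneg = b - a) ∧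
      (¬ Set.Iio 0 ⊆ M.continuum → wneg = 0) ∧
      (Set.Ioi 0 ⊆ M.continuum →
        ∃ a b, Tendsto δ (𝓝[>] 0) (𝓝 a) ∧ Tendsto δ atTop (𝓝 b) ∧ wpos = b - a) ∧
      (¬ Set.Ioi 0 ⊆ M.continuum → wpos = 0)

/-- The improper integral of `f` between two ends, each given by the filter along which the
corresponding integration limit tends to it. -/
def HasImproperIntegral (f : ℝ → ℂ) (lower upper : Filter ℝ) (c : ℂ) : Prop :=
  Tendsto (fun p : ℝ × ℝ => ∫ E in p.1..p.2, f E) (lower ×ˢ upper) (𝓝 c)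

/-- `2 w = -i ∫ (det S)' / det S dE`, where the improper integral is over the continuum
spectrum. -/
def HasWindingIntegral (w : ℝ) : Prop :=
  ∃ Ineg Ipos : ℂ, 2 * (w : ℂ) = -Complex.I * (Ineg + Ipos) ∧
    (Set.Iio 0 ⊆ M.continuum →
      HasImproperIntegral (fun E => deriv M.detS E / M.detS E) atBot (𝓝[<] 0) Ineg) ∧
    (¬ Set.Iio 0 ⊆ M.continuum → Ineg = 0) ∧
    (Set.Ioi 0 ⊆ M.continuum →
      HasImproperIntegral (fun E => deriv M.detS E / M.detS E) (𝓝[>] 0) atTop Ipos) ∧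
    (¬ Set.Ioi 0 ⊆ M.continuum → Ipos = 0)

end EmitterModel

end

/-! The coupling has rank one, K(ω) = κ(ω)|u⟩⟨u| with κ(ω) = ∫ |V|²/(ω - ε), so D(ω) = det(ω - K^R -
K(ω)) equals A + κB, where A is a monic polynomial of degree N and B a polynomial of degree less
than N (`charFun_eq`). The scattering matrix is the identity plus a rank-one matrix. With the
Plemelj formula for Im κ (`sum_momenta`) this gives det S(E) = D(E - i0)/D(E + i0) (`detS_eq`). The
theorem is therefore an argument principle for D on the plane cut along the closed continuum.

In each closed half plane D has continuous boundary values. Uniformly in the angle, D ~ ω^N at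
infinity, and at threshold D is asymptotic to a nonzero multiple of ω^(j + 1/m - 1), where j is the
dimension of the space of dark states. Dividing D by the polynomial Q of its n zeros leaves a
function without zeros, which has a continuous phase on each half plane
(`exists_continuousOn_phase`). From the positive to the negative axis this phase turns by ±π(N - n)
along large half circles and by ±π(j + 1/m - 1) along small ones (`tendsto_phase`), with opposite
signs in the two half planes. The scattering phase is half the difference of the lower and the upper
phase, so its total increment is π(N - n) - π(j + 1/m - 1). A half axis outside the continuum
contributes nothing, because there the two phases differ by a constant.

It remains to see that N_B = n + j. Off the closed continuum, Jordan chains of H are finite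
sequences of emitter vectors obeying a linear recursion. They form the kernel of the polynomial
matrix E + X - K^R - κ_n(X)|u⟩⟨u|, where κ_n is a Taylor polynomial of κ at E and X acts as the
backward shift. Such a kernel has as dimension the order of vanishing of the determinant
(`finrank_ker_matrixAeval`), hence the order of the zero of D (`finrank_boundSpace`). At zero energy
V(0) ≠ 0 forbids a normalizable photon part, and dissipativity forbids Jordan chains, so the bound
states are the dark states (`finrank_boundSpace_zero`). The same kernel formula for a bordered
matrix, together with the absence of bright zero-energy states, shows that B vanishes at 0 to order
exactly j (`rootMultiplicity_polyB`). Since A vanishes to order at least j, the divergent term κB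
governs D at threshold.

The analytic input is the substitution k = sq. It turns κ into an explicit power of s times a Cauchy
integral that is jointly continuous up to the cut and up to s = 0 (`continuousOn_cauchyHalf`). At s
= 0 only a constant weight is left. Its Cauchy integral solves a linear differential equation in the
angle, which is where the exponent 1/m - 1 comes from (`cauchyOne_eq_exp`). -/

/-! ### Kernels of polynomial matrices on locally nilpotent modules -/

open Polynomial in
/-- A locally nilpotent operator: polynomials with nonzero constant term act injectively. -/
theorem aeval_injective_of_locallyNilpotent {K U : Type*} [Field K] [AddCommGroup U] [Module K U]
    {s : Module.End K U} (hs : ∀ x, ∃ n : ℕ, (s ^ n) x = 0) {p : K[X]} (hp : p.coeff 0 ≠ 0) :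
    Function.Injective (aeval s p) := by
  rw [injective_iff_map_eq_zero]
  have key : ∀ n : ℕ, ∀ x, (s ^ n) x = 0 → aeval s p x = 0 → x = 0 := by
    intro n
    induction n with
    | zero => intro x h _; simpa using h
    | succ n ih =>
      intro x h hx
      -- `s` commutes with the polynomial and lowers the nilpotency order, so `s x = 0` by
      -- induction. The polynomial then acts on `x` as its constant term.
      have hsx : s x = 0 := by
        apply ih
        · rw [pow_succ] at h; exact h
        · have : aeval s p (s x) = aeval s (p * X) x := by simp [Module.End.mul_apply]
          rw [this, mul_comm, map_mul, Module.End.mul_apply, hx, map_zero]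
      have h2 : aeval s p x = p.coeff 0 • x := by
        conv_lhs => rw [← divX_mul_X_add p]
        simp [Module.End.mul_apply, hsx, Module.algebraMap_end_apply]
      rw [h2] at hx
      exact (smul_eq_zero.mp hx).resolve_left hp
  intro x hx
  obtain ⟨n, hn⟩ := hs x
  exact key n x hn hx

/-- Rank-nullity for the restriction of `f` to the preimage, which contains all of `ker f`. It makes
kernel dimensions additive along a factorization of a polynomial matrix. -/
theorem Submodule.finrank_comap_of_surjective {K V W : Type*} [Field K] [AddCommGroup V]
    [Module K V] [AddCommGroup W] [Module K W] (f : V →ₗ[K] W) (hf : Function.Surjective f)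
    (S : Submodule K W) [Module.Finite K S] [Module.Finite K (LinearMap.ker f)] :
    Module.Finite K (S.comap f) ∧
      Module.finrank K (S.comap f) = Module.finrank K S + Module.finrank K (LinearMap.ker f) := by
  let g : S.comap f →ₗ[K] S := f.restrict (fun x hx => hx)
  have hg : Function.Surjective g := by
    rintro ⟨y, hy⟩
    obtain ⟨x, rfl⟩ := hf y
    exact ⟨⟨x, hy⟩, rfl⟩
  have hle : LinearMap.ker f ≤ S.comap f := by
    intro x hx
    rw [LinearMap.mem_ker] at hx
    rw [Submodule.mem_comap, hx]
    exact S.zero_mem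
  let e : LinearMap.ker g ≃ₗ[K] LinearMap.ker f :=
    { toFun := fun x => ⟨x.1.1, by
        have := x.2
        rw [LinearMap.mem_ker] at this
        exact congrArg Subtype.val this⟩
      map_add' := fun _ _ => rfl
      map_smul' := fun _ _ => rfl
      invFun := fun x => ⟨⟨x.1, hle x.2⟩, by
        rw [LinearMap.mem_ker]
        exact Subtype.ext x.2⟩
      left_inv := fun _ => rfl
      right_inv := fun _ => rfl }
  have hk : Module.Finite K (LinearMap.ker g) := Module.Finite.equiv e.symm
  have hr : Module.Finite K (LinearMap.range g) := inferInstance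
  have hfin : Module.Finite K (S.comap f) := by
    have hT : (⊤ : Submodule K (S.comap f)).FG := by
      apply Submodule.fg_of_fg_map_of_fg_inf_ker g
      · exact IsNoetherian.noetherian _
      · rw [top_inf_eq]
        exact Module.Finite.iff_fg.mp hk
    exact ⟨hT⟩
  refine ⟨hfin, ?_⟩
  rw [← g.finrank_range_add_finrank_ker, LinearMap.range_eq_top.mpr hg, finrank_top,
    e.finrank_eq]

section ChainAction

open Polynomial

variable {K U ι : Type*} [Field K] [AddCommGroup U] [Module K U] [Fintype ι]

/-- The action of a polynomial matrix on vectors with entries in a module over which the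
polynomial variable acts as `s`. -/
noncomputable def matrixAeval (s : Module.End K U) (P : Matrix ι ι K[X]) : (ι → U) →ₗ[K] (ι → U) :=
  LinearMap.pi fun i => ∑ j, (aeval s (P i j)) ∘ₗ LinearMap.proj j

theorem matrixAeval_apply (s : Module.End K U) (P : Matrix ι ι K[X]) (x : ι → U) (i : ι) :
    matrixAeval s P x i = ∑ j, aeval s (P i j) (x j) := by
  simp [matrixAeval]

theorem matrixAeval_mul (s : Module.End K U) (P Q : Matrix ι ι K[X]) :
    matrixAeval s (P * Q) = matrixAeval s P ∘ₗ matrixAeval s Q := by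
  ext1 x
  funext i
  simp only [matrixAeval_apply, LinearMap.comp_apply, Matrix.mul_apply, map_sum, map_mul,
    LinearMap.sum_apply, Module.End.mul_apply]
  rw [Finset.sum_comm]

variable [DecidableEq ι]

theorem matrixAeval_diagonal (s : Module.End K U) (d : ι → K[X]) (x : ι → U) (i : ι) :
    matrixAeval s (Matrix.diagonal d) x i = aeval s (d i) (x i) := by
  rw [matrixAeval_apply, Finset.sum_eq_single i]
  · simp
  · intro j _ hj
    simp [Matrix.diagonal_apply_ne' _ hj]
  · simp

theorem matrixAeval_one (s : Module.End K U) (x : ι → U) :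
    matrixAeval s (1 : Matrix ι ι K[X]) x = x := by
  funext i
  rw [← Matrix.diagonal_one, matrixAeval_diagonal]
  simp

/-- Cramer's rule: multiplication by the adjugate decouples the components. -/
theorem aeval_det_of_mem_ker {s : Module.End K U} {P : Matrix ι ι K[X]} {x : ι → U}
    (hx : matrixAeval s P x = 0) (i : ι) : aeval s P.det (x i) = 0 := by
  have h : matrixAeval s (P.adjugate * P) x = 0 := by
    rw [matrixAeval_mul, LinearMap.comp_apply, hx, map_zero]
  rw [Matrix.adjugate_mul, Matrix.smul_one_eq_diagonal] at h
  simpa [matrixAeval_diagonal] using congrFun h i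

/-- The determinant is a power of X times a factor that is nonzero at 0, and this factor acts
injectively on a locally nilpotent module. The order of vanishing thus bounds the length of the
chains in the kernel. -/
theorem pow_apply_of_mem_ker_matrixAeval {s : Module.End K U}
    (hs : ∀ x, ∃ n : ℕ, (s ^ n) x = 0) {P : Matrix ι ι K[X]} (hP : P.det ≠ 0) {x : ι → U}
    (hx : matrixAeval s P x = 0) (i : ι) : (s ^ P.det.rootMultiplicity 0) (x i) = 0 := by
  obtain ⟨q, hq⟩ := pow_rootMultiplicity_dvd P.det 0
  have hq0 : q.coeff 0 ≠ 0 := by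
    intro h0
    rw [coeff_zero_eq_eval_zero] at h0
    obtain ⟨r, rfl⟩ := dvd_iff_isRoot.mpr h0
    have : (X - C 0 : K[X]) ^ (P.det.rootMultiplicity 0 + 1) ∣ P.det := ⟨r, by
      conv_lhs => rw [hq]
      ring⟩
    have := (le_rootMultiplicity_iff hP).mpr this
    omega
  apply aeval_injective_of_locallyNilpotent hs hq0
  have := aeval_det_of_mem_ker hx i
  rw [map_zero]
  rw [hq, mul_comm, map_mul] at this
  simpa [Module.End.mul_apply] using this

/-- The kernel of a polynomial matrix on a divisible locally nilpotent module with
one-dimensional socle has the dimension given by the order of vanishing of the determinant. -/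
theorem finrank_ker_matrixAeval {s : Module.End K U}
    (hs : ∀ x, ∃ n : ℕ, (s ^ n) x = 0) (hsurj : Function.Surjective s)
    (hker : Module.finrank K (LinearMap.ker s) = 1) (P : Matrix ι ι K[X]) (hP : P.det ≠ 0) :
    Module.Finite K (LinearMap.ker (matrixAeval s P)) ∧
      Module.finrank K (LinearMap.ker (matrixAeval s P)) = P.det.rootMultiplicity 0 := by
  obtain ⟨d, hd⟩ : ∃ d, P.det.rootMultiplicity 0 = d := ⟨_, rfl⟩
  induction d generalizing P with
  | zero =>
    have hbot : LinearMap.ker (matrixAeval s P) = ⊥ := by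
      rw [eq_bot_iff]
      intro x hx
      rw [LinearMap.mem_ker] at hx
      rw [Submodule.mem_bot]
      funext i
      simpa [hd] using pow_apply_of_mem_ker_matrixAeval hs hP hx i
    rw [hbot, hd]
    exact ⟨inferInstance, finrank_bot _ _⟩
  | succ d ih =>
    have hroot : P.det.eval 0 = 0 := by
      have : 0 < P.det.rootMultiplicity 0 := by omega
      exact ((rootMultiplicity_pos hP).mp this)
    have hdet0 : (P.map (eval 0)).det = 0 := by
      have := (RingHom.map_det (evalRingHom (0 : K)) P).symm
      rw [coe_evalRingHom, hroot] at this
      exact this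
    -- A null vector `w` of `P(0)` with `w i ≠ 0` gives an invertible constant column operation `Q`
    -- after which column `i` of `P * Q` is divisible by X. Pulling this X out as a diagonal factor
    -- `Δ` lowers the order of vanishing by one, and `Δ` accounts for one dimension of the kernel,
    -- that of `ker s`.
    obtain ⟨w, hw, hPw⟩ := Matrix.exists_mulVec_eq_zero_iff.mpr hdet0
    obtain ⟨i, hi⟩ := Function.ne_iff.mp hw
    simp only [Pi.zero_apply] at hi
    let Q : Matrix ι ι K[X] := Matrix.updateCol 1 i (fun r => C (w r))
    have hQdet : Q.det = C (w i) := by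
      have : Q.det = Matrix.cramer 1 (fun r => C (w r)) i := (Matrix.cramer_apply _ _ _).symm
      rw [this, Matrix.cramer_one]; rfl
    have hQu : IsUnit Q.det := by
      rw [hQdet]
      exact (isUnit_iff_ne_zero.mpr hi).map C
    have hcol : ∀ r, (P * Q) r i = ((P * Q) r i).divX * X := by
      intro r
      have h0 : ((P * Q) r i).coeff 0 = 0 := by
        have := congrFun hPw r
        simp only [Matrix.mulVec, dotProduct, Matrix.map_apply, Pi.zero_apply] at this
        rw [coeff_zero_eq_eval_zero, Matrix.mul_apply, eval_finsetSum]
        refine Eq.trans ?_ this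
        refine Finset.sum_congr rfl fun j _ => ?_
        simp [Q]
      conv_lhs => rw [← divX_mul_X_add ((P * Q) r i), h0, C_0, add_zero]
    let P' : Matrix ι ι K[X] := (P * Q).updateCol i (fun r => ((P * Q) r i).divX)
    let Δ : Matrix ι ι K[X] := Matrix.diagonal (Function.update 1 i X)
    have hfac : P * Q = P' * Δ := by
      ext1 r c
      rw [Matrix.mul_diagonal]
      by_cases hc : c = i
      · subst hc
        rw [hcol r]
        simp [P']
      · simp [P', hc]
    have hΔdet : Δ.det = X := by
      rw [Matrix.det_diagonal, Finset.prod_eq_single i]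
      · simp
      · intro j _ hj
        simp [hj]
      · simp
    have hdets : P.det * C (w i) = P'.det * X := by
      rw [← hQdet, ← Matrix.det_mul, hfac, Matrix.det_mul, hΔdet]
    have hP' : P'.det ≠ 0 := by
      intro h
      rw [h, zero_mul] at hdets
      exact mul_ne_zero hP (C_ne_zero.mpr hi) hdets
    have hmult : P'.det.rootMultiplicity 0 = d := by
      have h1 := congrArg (rootMultiplicity 0) hdets
      rw [rootMultiplicity_mul (mul_ne_zero hP (C_ne_zero.mpr hi)), rootMultiplicity_C, hd,
        rootMultiplicity_mul (mul_ne_zero hP' X_ne_zero)] at h1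
      have : rootMultiplicity (0 : K) X = 1 := by
        have := rootMultiplicity_X_sub_C_self (x := (0 : K))
        rwa [C_0, sub_zero] at this
      omega
    obtain ⟨hf', hr'⟩ := ih P' hP' hmult
    -- the elementary factor
    have hΔapp : ∀ x j, matrixAeval s Δ x j = if j = i then s (x j) else x j := by
      intro x j
      rw [matrixAeval_diagonal]
      by_cases hj : j = i
      · subst hj; simp
      · simp [hj]
    have hΔsurj : Function.Surjective (matrixAeval s Δ) := by
      intro y
      obtain ⟨z, hz⟩ := hsurj (y i)
      refine ⟨Function.update y i z, ?_⟩
      funext j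
      rw [hΔapp]
      by_cases hj : j = i
      · subst hj; simp [hz]
      · simp [hj]
    let e : LinearMap.ker (matrixAeval s Δ) ≃ₗ[K] LinearMap.ker s :=
      { toFun := fun x => ⟨x.1 i, by
          have h := congrFun (LinearMap.mem_ker.mp x.2) i
          rw [hΔapp] at h
          simpa using h⟩
        map_add' := fun _ _ => rfl
        map_smul' := fun _ _ => rfl
        invFun := fun z => ⟨Pi.single i z.1, by
          rw [LinearMap.mem_ker]
          funext j
          rw [hΔapp]
          by_cases hj : j = i
          · subst hj; simp
          · simp [hj]⟩
        left_inv := by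
          rintro ⟨x, hx⟩
          ext j
          have h := congrFun (LinearMap.mem_ker.mp hx) j
          rw [hΔapp] at h
          by_cases hj : j = i
          · subst hj; simp
          · simp only [hj, if_false, Pi.zero_apply] at h
            simp [hj, h]
        right_inv := by
          rintro ⟨x, hx⟩
          simp }
    have hkf : Module.Finite K (LinearMap.ker s) := Module.finite_of_finrank_pos (by omega)
    have hkf' : Module.Finite K (LinearMap.ker (matrixAeval s Δ)) := Module.Finite.equiv e.symm
    obtain ⟨hA, hB⟩ := Submodule.finrank_comap_of_surjective (matrixAeval s Δ) hΔsurj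
      (LinearMap.ker (matrixAeval s P'))
    rw [hr', e.finrank_eq, hker] at hB
    -- the constant factor
    have hQQ : ∀ x, matrixAeval s Q (matrixAeval s Q⁻¹ x) = x := by
      intro x
      rw [← LinearMap.comp_apply, ← matrixAeval_mul, Matrix.mul_nonsing_inv Q hQu,
        matrixAeval_one]
    have hQQ' : ∀ x, matrixAeval s Q⁻¹ (matrixAeval s Q x) = x := by
      intro x
      rw [← LinearMap.comp_apply, ← matrixAeval_mul, Matrix.nonsing_inv_mul Q hQu,
        matrixAeval_one]
    have hcomp : ∀ x, matrixAeval s P (matrixAeval s Q x)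
        = matrixAeval s P' (matrixAeval s Δ x) := by
      intro x
      rw [← LinearMap.comp_apply, ← matrixAeval_mul, hfac, matrixAeval_mul, LinearMap.comp_apply]
    let g : ((LinearMap.ker (matrixAeval s P')).comap (matrixAeval s Δ)) ≃ₗ[K]
        LinearMap.ker (matrixAeval s P) :=
      { toFun := fun x => ⟨matrixAeval s Q x.1, by
          rw [LinearMap.mem_ker, hcomp]
          exact x.2⟩
        map_add' := fun x y => Subtype.ext (map_add _ _ _)
        map_smul' := fun c x => Subtype.ext (map_smul _ _ _)
        invFun := fun y => ⟨matrixAeval s Q⁻¹ y.1, by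
          rw [Submodule.mem_comap, LinearMap.mem_ker, ← hcomp, hQQ]
          exact y.2⟩
        left_inv := fun x => Subtype.ext (hQQ' _)
        right_inv := fun x => Subtype.ext (hQQ _) }
    refine ⟨Module.Finite.equiv g, ?_⟩
    rw [← g.finrank_eq, hB, hmult, hd]

end ChainAction

/-! ### The backward shift on polynomials as a model for finite chains -/

section DivX

open Polynomial

/-- The backward shift on polynomials, as a linear map. -/
noncomputable def divXLinear : Module.End ℂ ℂ[X] where
  toFun := divX
  map_add' _ _ := divX_add
  map_smul' c p := by
    ext n
    simp [coeff_divX]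

theorem divXLinear_apply (p : ℂ[X]) : divXLinear p = divX p := rfl

theorem coeff_divXLinear_pow (n : ℕ) (p : ℂ[X]) (k : ℕ) :
    ((divXLinear ^ n) p).coeff k = p.coeff (k + n) := by
  induction n generalizing p with
  | zero => simp
  | succ n ih =>
    rw [pow_succ, Module.End.mul_apply, ih, divXLinear_apply, coeff_divX]
    ring_nf

theorem divXLinear_locallyNilpotent (p : ℂ[X]) : ∃ n : ℕ, (divXLinear ^ n) p = 0 := by
  refine ⟨p.natDegree + 1, ?_⟩
  ext k
  rw [coeff_divXLinear_pow, coeff_zero]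
  exact coeff_eq_zero_of_natDegree_lt (by omega)

theorem divXLinear_surjective : Function.Surjective divXLinear := by
  intro p
  refine ⟨p * X, ?_⟩
  ext k
  rw [divXLinear_apply, coeff_divX, coeff_mul_X]

theorem finrank_ker_divXLinear : Module.finrank ℂ (LinearMap.ker divXLinear) = 1 := by
  let e : LinearMap.ker divXLinear ≃ₗ[ℂ] ℂ :=
    { toFun := fun p => p.1.coeff 0
      map_add' := fun _ _ => by simp
      map_smul' := fun _ _ => by simp
      invFun := fun c => ⟨C c, by simp [divXLinear_apply]⟩
      left_inv := by
        rintro ⟨p, hp⟩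
        rw [LinearMap.mem_ker, divXLinear_apply, divX_eq_zero_iff] at hp
        exact Subtype.ext hp.symm
      right_inv := fun c => by simp }
  rw [e.finrank_eq, Module.finrank_self]

end DivX

/-! ### Cauchy integrals over a half line, up to the cut and up to scale zero -/

/-- Continuous nonnegative weights on the half line with a growth bound and a scale-invariant
Hölder bound. -/
structure HalfLineWeight (m : ℕ) (w : ℝ → ℝ) (A e α : ℝ) : Prop where
  two_le : 2 ≤ m
  A_nonneg : 0 ≤ A
  e_nonneg : 0 ≤ e
  e_lt : e < (m : ℝ) - 1
  α_pos : 0 < α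
  nonneg : ∀ k, 0 ≤ k → 0 ≤ w k
  cont : ContinuousOn w (Set.Ici 0)
  bound : ∀ k, 0 ≤ k → w k ≤ A * (1 + k) ^ e
  holder : ∀ s q, 0 ≤ s → 0 ≤ q → q ≤ 2 →
    |w (s * q) - w s| ≤ A * (1 + s) ^ e * |q - 1| ^ α

noncomputable section

/-- The subtraction profile `q ^ (m - 1)` on `q ^ m ≤ 2`. -/
def cutoffPow (m : ℕ) (q : ℝ) : ℝ := if q ^ m ≤ 2 then q ^ (m - 1) else 0

/-- The integrand of the subtracted Cauchy integral. -/
def subtractedKernel (m : ℕ) (w : ℝ → ℝ) (s : ℝ) (z : ℂ) (q : ℝ) : ℂ :=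
  ((w (s * q) - w s * cutoffPow m q : ℝ) : ℂ) / (z - ((q ^ m : ℝ) : ℂ))

/-- Scaled Cauchy integral `∫₀^∞ w (s q) / (e^{iφ} - q ^ m) dq`, continued to `φ = 0` from
above. -/
def cauchyHalf (m : ℕ) (w : ℝ → ℝ) (s φ : ℝ) : ℂ :=
  (∫ q in Set.Ioi (0 : ℝ), subtractedKernel m w s (Complex.exp (φ * Complex.I)) q) +
    (w s / m : ℝ) * ((φ - Real.pi : ℝ) * Complex.I - Complex.log (2 - Complex.exp (φ * Complex.I)))

/-- An integrable majorant of the subtracted kernel, up to growth in the scale. -/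
def kernelMajorant (m : ℕ) (A e α : ℝ) (q : ℝ) : ℝ :=
  if q ≤ 2 then A * |q - 1| ^ (α - 1) + A else A * 2 * ((1 + q) ^ e * q ^ (-(m : ℝ)))

theorem abs_one_sub_pow_ge {m : ℕ} (hm : 1 ≤ m) {q : ℝ} (hq : 0 ≤ q) : |1 - q| ≤ |1 - q ^ m| := by
  rcases le_total q 1 with h | h
  · have h1 : q ^ m ≤ q ^ 1 := pow_le_pow_of_le_one hq h hm
    rw [pow_one] at h1
    rw [abs_of_nonneg (by linarith), abs_of_nonneg (by linarith)]
    linarith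
  · have h1 : q ^ 1 ≤ q ^ m := pow_le_pow_right₀ h hm
    rw [pow_one] at h1
    rw [abs_of_nonpos (by linarith), abs_of_nonpos (by linarith)]
    linarith

theorem abs_one_sub_le_norm {z : ℂ} (hz : ‖z‖ = 1) {x : ℝ} (hx : 0 ≤ x) :
    |1 - x| ≤ ‖z - (x : ℂ)‖ := by
  have := abs_norm_sub_norm_le z (x : ℂ)
  rwa [hz, Complex.norm_real, Real.norm_of_nonneg hx] at this

/-- The profile equals 1 at the singular point q = 1 and leaves this value no faster than the
denominator leaves 0, so replacing it by 1 costs only a bounded term. -/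
theorem abs_one_sub_cutoffPow_le {m : ℕ} {q : ℝ} (hm : 1 ≤ m) (hq : 0 ≤ q) :
    |1 - cutoffPow m q| ≤ |1 - q ^ m| := by
  unfold cutoffPow
  split_ifs with h
  · obtain ⟨n, rfl⟩ : ∃ n, m = n + 1 := ⟨m - 1, by omega⟩
    rw [Nat.add_sub_cancel]
    rcases le_total q 1 with h1 | h1
    · have h2 : q ^ n ≤ 1 := pow_le_one₀ hq h1
      have h3 : q ^ (n + 1) ≤ q ^ n := pow_le_pow_of_le_one hq h1 (by omega)
      rw [abs_of_nonneg (by linarith), abs_of_nonneg (by linarith)]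
      linarith
    · have h2 : 1 ≤ q ^ n := one_le_pow₀ h1
      have h3 : q ^ n ≤ q ^ (n + 1) := pow_le_pow_right₀ h1 (by omega)
      rw [abs_of_nonpos (by linarith), abs_of_nonpos (by linarith)]
      linarith
  · push Not at h
    rw [sub_zero, abs_one, abs_of_nonpos (by linarith)]
    linarith

theorem measurable_cutoffPow (m : ℕ) : Measurable (cutoffPow m) := by
  unfold cutoffPow
  exact Measurable.ite (measurableSet_le (by fun_prop) measurable_const) (by fun_prop)
    measurable_const

namespace HalfLineWeight

variable {m : ℕ} {w : ℝ → ℝ} {A e α : ℝ}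

/-- Near q = 1 the Hölder bound softens the pole to |q - 1|^(α - 1). For q > 2 the growth bound
applies, and 1 + sq ≤ (1 + s)(1 + q) separates the scale. Only |z| = 1 is used, so the bound is
uniform in the angle, the cut included. -/
theorem norm_subtractedKernel_le (h : HalfLineWeight m w A e α) {s : ℝ} (hs : 0 ≤ s) {z : ℂ}
    (hz : ‖z‖ = 1) {q : ℝ} (hq : 0 < q) :
    ‖subtractedKernel m w s z q‖ ≤ (1 + s) ^ e * kernelMajorant m A e α q := by
  have hm1 : 1 ≤ m := le_trans one_le_two h.two_le
  have hse : 0 ≤ (1 + s) ^ e := Real.rpow_nonneg (by linarith) _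
  have hden : |1 - q ^ m| ≤ ‖z - ((q ^ m : ℝ) : ℂ)‖ := abs_one_sub_le_norm hz (by positivity)
  have hA := h.A_nonneg
  unfold subtractedKernel kernelMajorant
  rw [norm_div, Complex.norm_real, Real.norm_eq_abs]
  split_ifs with hq2
  -- At q = 1 the numerator vanishes, so the kernel is 0 there even when the denominator is 0 as
  -- well.
  · by_cases hq1 : q = 1
    · subst hq1
      have : cutoffPow m 1 = 1 := by simp [cutoffPow]
      rw [this]
      simp only [mul_one, sub_self, abs_zero, zero_div]
      have : 0 ≤ (0 : ℝ) ^ (α - 1) := Real.rpow_nonneg le_rfl _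
      positivity
    · have hq1' : 0 < |q - 1| := abs_pos.mpr (sub_ne_zero.mpr hq1)
      have hq1'' : |1 - q| = |q - 1| := abs_sub_comm _ _
      have hd1 : |q - 1| ≤ |1 - q ^ m| := hq1'' ▸ abs_one_sub_pow_ge hm1 hq.le
      have hdpos : 0 < |1 - q ^ m| := lt_of_lt_of_le hq1' hd1
      have hd2 : 0 < ‖z - ((q ^ m : ℝ) : ℂ)‖ := lt_of_lt_of_le hdpos hden
      have hnum : |w (s * q) - w s * cutoffPow m q| ≤
          (1 + s) ^ e * (A * |q - 1| ^ (α - 1) * |q - 1| + A * |1 - q ^ m|) := by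
        have e1 : w (s * q) - w s * cutoffPow m q =
            (w (s * q) - w s) + w s * (1 - cutoffPow m q) := by ring
        rw [e1]
        refine (abs_add_le _ _).trans ?_
        have e2 : |q - 1| ^ (α - 1) * |q - 1| = |q - 1| ^ α := by
          rw [← Real.rpow_add_one hq1'.ne', sub_add_cancel]
        rw [mul_assoc A (|q - 1| ^ (α - 1)), e2, mul_add]
        refine add_le_add ?_ ?_
        · refine (h.holder s q hs hq.le hq2).trans (le_of_eq (by ring))
        · rw [abs_mul, abs_of_nonneg (h.nonneg s hs)]
          calc w s * |1 - cutoffPow m q| ≤ (A * (1 + s) ^ e) * |1 - q ^ m| :=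
                mul_le_mul (h.bound s hs) (abs_one_sub_cutoffPow_le hm1 hq.le) (abs_nonneg _)
                  (by positivity)
            _ = _ := by ring
      rw [div_le_iff₀ hd2]
      refine hnum.trans ?_
      rw [mul_assoc ((1 + s) ^ e)]
      refine mul_le_mul_of_nonneg_left ?_ hse
      rw [add_mul]
      have hr : 0 ≤ |q - 1| ^ (α - 1) := Real.rpow_nonneg (abs_nonneg _) _
      refine add_le_add ?_ ?_
      · exact mul_le_mul_of_nonneg_left (hd1.trans hden) (by positivity)
      · exact mul_le_mul_of_nonneg_left hden hA
  · push Not at hq2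
    have hqm : (2 : ℝ) < q ^ m := by
      calc (2 : ℝ) < q ^ 1 := by simpa using hq2
        _ ≤ q ^ m := pow_le_pow_right₀ (by linarith) hm1
    have hc : cutoffPow m q = 0 := by simp [cutoffPow, not_le.mpr hqm]
    rw [hc, mul_zero, sub_zero, abs_of_nonneg (h.nonneg _ (by positivity))]
    have hd1 : q ^ m / 2 ≤ ‖z - ((q ^ m : ℝ) : ℂ)‖ := by
      refine le_trans ?_ hden
      rw [abs_of_nonpos (by linarith)]
      linarith
    have hqpos : 0 < q ^ m := by positivity
    rw [div_le_iff₀ (lt_of_lt_of_le (by positivity) hd1)]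
    have hb : w (s * q) ≤ A * ((1 + s) ^ e * (1 + q) ^ e) := by
      refine (h.bound _ (by positivity)).trans ?_
      refine mul_le_mul_of_nonneg_left ?_ hA
      rw [← Real.mul_rpow (by positivity) (by positivity)]
      exact Real.rpow_le_rpow (by positivity) (by nlinarith) h.e_nonneg
    refine hb.trans ?_
    have e3 : A * ((1 + s) ^ e * (1 + q) ^ e) =
        (1 + s) ^ e * (A * 2 * ((1 + q) ^ e * q ^ (-(m : ℝ)))) * (q ^ m / 2) := by
      rw [Real.rpow_neg hq.le, Real.rpow_natCast]
      field_simp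
    rw [e3]
    refine mul_le_mul_of_nonneg_left hd1 ?_
    have : 0 ≤ (1 + q) ^ e := Real.rpow_nonneg (by linarith) _
    have : 0 ≤ q ^ (-(m : ℝ)) := Real.rpow_nonneg hq.le _
    positivity

theorem integrableOn_kernelMajorant (h : HalfLineWeight m w A e α) :
    IntegrableOn (kernelMajorant m A e α) (Set.Ioi 0) := by
  rw [← Set.Ioc_union_Ioi_eq_Ioi (zero_le_two (α := ℝ))]
  refine IntegrableOn.union ?_ ?_
  · have h1 : IntegrableOn (fun q : ℝ => A * |q - 1| ^ (α - 1) + A) (Set.Ioc 0 2) := by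
      have h2 : IntervalIntegrable (fun q : ℝ => |q| ^ (α - 1)) volume (-1) 1 := by
        have h3 : IntervalIntegrable (fun q : ℝ => |q| ^ (α - 1)) volume 0 1 := by
          refine (intervalIntegral.intervalIntegrable_rpow' (a := 0) (b := 1)
            (r := α - 1) (by linarith [h.α_pos])).congr ?_
          intro x hx
          rw [Set.uIoc_of_le zero_le_one] at hx
          simp only [abs_of_pos hx.1]
        have h4 := (h3.comp_sub_left 0).symm
        simp only [zero_sub, abs_neg, sub_zero] at h4
        exact h4.trans h3
      have h5 := (h2.comp_sub_right 1)
      norm_num at h5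
      have h6 := (h5.const_mul A).add (intervalIntegrable_const (c := A))
      exact (intervalIntegrable_iff_integrableOn_Ioc_of_le zero_le_two).mp h6
    refine h1.congr_fun ?_ measurableSet_Ioc
    intro q hq
    simp [kernelMajorant, hq.2]
  · have h1 : IntegrableOn (fun q : ℝ => A * 2 * (2 ^ e * q ^ (e - m))) (Set.Ioi 2) :=
      ((integrableOn_Ioi_rpow_of_lt (by linarith [h.e_lt]) zero_lt_two).const_mul _).const_mul _
    refine Integrable.mono' h1 ?_ ?_
    · refine ContinuousOn.aestronglyMeasurable ?_ measurableSet_Ioi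
      have : ContinuousOn (fun q : ℝ => A * 2 * ((1 + q) ^ e * q ^ (-(m : ℝ)))) (Set.Ioi 2) := by
        intro q hq
        have hq' : (2 : ℝ) < q := hq
        refine ContinuousAt.continuousWithinAt ?_
        refine continuousAt_const.mul (ContinuousAt.mul ?_ ?_)
        · exact (continuousAt_const.add continuousAt_id).rpow_const (Or.inl (by simp; linarith))
        · exact continuousAt_id.rpow_const (Or.inl (by simp; linarith))
      refine this.congr ?_
      intro q hq
      simp [kernelMajorant, not_le.mpr (Set.mem_Ioi.mp hq)]
    · refine (ae_restrict_iff' measurableSet_Ioi).mpr (Eventually.of_forall ?_)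
      intro q hq
      have hq' : (2 : ℝ) < q := hq
      have hA := h.A_nonneg
      have a1 : 0 ≤ (1 + q) ^ e := Real.rpow_nonneg (by linarith) _
      have a2 : 0 ≤ q ^ (-(m : ℝ)) := Real.rpow_nonneg (by linarith) _
      have e1 : kernelMajorant m A e α q = A * 2 * ((1 + q) ^ e * q ^ (-(m : ℝ))) := by
        simp [kernelMajorant, not_le.mpr hq']
      rw [e1, Real.norm_of_nonneg (by positivity)]
      refine mul_le_mul_of_nonneg_left ?_ (by positivity)
      rw [sub_eq_add_neg, Real.rpow_add (by linarith), ← mul_assoc,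
        ← Real.mul_rpow (by norm_num) (by linarith)]
      refine mul_le_mul_of_nonneg_right ?_ a2
      exact Real.rpow_le_rpow (by linarith) (by linarith) h.e_nonneg

theorem measurable_comp_scale (h : HalfLineWeight m w A e α) {s : ℝ} (hs : 0 ≤ s) :
    AEStronglyMeasurable (fun q => w (s * q)) (volume.restrict (Set.Ioi 0)) := by
  refine ContinuousOn.aestronglyMeasurable ?_ measurableSet_Ioi
  refine h.cont.comp (by fun_prop) ?_
  intro q hq
  exact mul_nonneg hs (le_of_lt hq)

theorem aestronglyMeasurable_subtractedKernel (h : HalfLineWeight m w A e α) {s : ℝ} (hs : 0 ≤ s)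
    (z : ℂ) :
    AEStronglyMeasurable (subtractedKernel m w s z) (volume.restrict (Set.Ioi 0)) := by
  unfold subtractedKernel
  simp only [div_eq_mul_inv]
  refine AEStronglyMeasurable.mul ?_ ?_
  · have h1 : AEStronglyMeasurable (fun q => w s * cutoffPow m q) (volume.restrict (Set.Ioi 0)) :=
      ((measurable_cutoffPow m).const_mul (w s)).aestronglyMeasurable
    have h2 : AEStronglyMeasurable (fun q => w (s * q) - w s * cutoffPow m q)
        (volume.restrict (Set.Ioi 0)) := (h.measurable_comp_scale hs).sub h1
    exact Complex.continuous_ofReal.comp_aestronglyMeasurable h2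
  · exact Measurable.aestronglyMeasurable (by fun_prop)

theorem integrableOn_subtractedKernel (h : HalfLineWeight m w A e α) {s : ℝ} (hs : 0 ≤ s) {z : ℂ}
    (hz : ‖z‖ = 1) : IntegrableOn (subtractedKernel m w s z) (Set.Ioi 0) := by
  refine Integrable.mono' (h.integrableOn_kernelMajorant.const_mul ((1 + s) ^ e))
    (h.aestronglyMeasurable_subtractedKernel hs z) ?_
  refine (ae_restrict_iff' measurableSet_Ioi).mpr (Eventually.of_forall ?_)
  intro q hq
  exact h.norm_subtractedKernel_le hs hz hq

/-- Dominated convergence: the majorant is independent of the angle and locally uniform in the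
scale, and only the null set q = 1 has to be avoided. The domain includes the cut φ = 0 and the
threshold edge s = 0. -/
theorem continuousOn_cauchyHalf (h : HalfLineWeight m w A e α) :
    ContinuousOn (fun p : ℝ × ℝ => cauchyHalf m w p.1 p.2) (Set.Ici 0 ×ˢ Set.univ) := by
  unfold cauchyHalf
  have hw : ContinuousOn (fun p : ℝ × ℝ => w p.1) (Set.Ici 0 ×ˢ Set.univ) :=
    h.cont.comp continuousOn_fst (fun p hp => hp.1)
  refine ContinuousOn.add ?_ ?_
  · intro p hp
    refine continuousWithinAt_of_dominated (bound := fun q => (1 + (p.1 + 1)) ^ e *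
      kernelMajorant m A e α q) ?_ ?_ ?_ ?_
    · filter_upwards [self_mem_nhdsWithin] with p' hp'
      exact h.aestronglyMeasurable_subtractedKernel hp'.1 _
    · have h1 : ∀ᶠ p' : ℝ × ℝ in 𝓝[Set.Ici 0 ×ˢ Set.univ] p, p'.1 < p.1 + 1 :=
        (continuous_fst.continuousWithinAt (s := Set.Ici (0 : ℝ) ×ˢ Set.univ)).eventually
          (gt_mem_nhds (lt_add_one p.1))
      filter_upwards [self_mem_nhdsWithin, h1] with p' hp' hlt
      refine (ae_restrict_iff' measurableSet_Ioi).mpr (Eventually.of_forall ?_)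
      intro q hq
      have hp0 : 0 ≤ p'.1 := hp'.1
      have hk := h.norm_subtractedKernel_le hp0 (Complex.norm_exp_ofReal_mul_I p'.2) hq
      have hg : 0 ≤ kernelMajorant m A e α q := by
        have := (norm_nonneg _).trans hk
        exact nonneg_of_mul_nonneg_right this (Real.rpow_pos_of_pos (by linarith) _)
      refine hk.trans (mul_le_mul_of_nonneg_right ?_ hg)
      exact Real.rpow_le_rpow (by linarith) (by linarith) h.e_nonneg
    · exact h.integrableOn_kernelMajorant.const_mul _
    · have h1 : ∀ᵐ q : ℝ ∂(volume.restrict (Set.Ioi 0)), q ≠ 1 :=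
        ae_restrict_of_ae (Measure.ae_ne volume 1)
      filter_upwards [h1, ae_restrict_mem measurableSet_Ioi] with q hq1 hq0
      have hq0' : (0 : ℝ) < q := hq0
      unfold subtractedKernel
      refine ContinuousWithinAt.div ?_ ?_ ?_
      · refine Complex.continuous_ofReal.continuousAt.comp_continuousWithinAt ?_
        refine ContinuousWithinAt.sub ?_ ((hw p hp).mul continuousWithinAt_const)
        have : ContinuousOn (fun p : ℝ × ℝ => w (p.1 * q)) (Set.Ici 0 ×ˢ Set.univ) :=
          h.cont.comp (by fun_prop) (fun p hp => mul_nonneg hp.1 hq0'.le)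
        exact this p hp
      · exact Continuous.continuousWithinAt (by fun_prop)
      · have := abs_one_sub_le_norm (Complex.norm_exp_ofReal_mul_I p.2) (x := q ^ m)
          (by positivity)
        have h2 := abs_one_sub_pow_ge (m := m) (le_trans one_le_two h.two_le) hq0'.le
        have h3 : 0 < |1 - q| := abs_pos.mpr (sub_ne_zero.mpr hq1.symm)
        exact norm_pos_iff.mp (by linarith)
  · refine ContinuousOn.mul ?_ (Continuous.continuousOn ?_)
    · exact Complex.continuous_ofReal.comp_continuousOn (hw.div_const _)
    · refine Continuous.sub (by fun_prop) ?_
      refine Continuous.clog (by fun_prop) ?_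
      intro p
      refine Or.inl ?_
      have : (Complex.exp ((p.2 : ℂ) * Complex.I)).re ≤ 1 :=
        (Complex.re_le_norm _).trans (Complex.norm_exp_ofReal_mul_I p.2).le
      rw [Complex.sub_re, Complex.re_ofNat]
      linarith

/-- The Plemelj jump: on the cut the subtracted integral is real and log(2 - 1) = 0, so that only
the term -iπ of the explicit part is imaginary. -/
theorem im_cauchyHalf_zero (m : ℕ) (w : ℝ → ℝ) (s : ℝ) :
    (cauchyHalf m w s 0).im = -Real.pi * (w s / m) := by
  unfold cauchyHalf
  have h1 : ∫ q in Set.Ioi (0 : ℝ), subtractedKernel m w s (Complex.exp ((0 : ℝ) * Complex.I)) q =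
      ((∫ q in Set.Ioi (0 : ℝ), (w (s * q) - w s * cutoffPow m q) / (1 - q ^ m) : ℝ) : ℂ) := by
    rw [← integral_complex_ofReal]
    refine integral_congr_ae (Eventually.of_forall fun q => ?_)
    simp [subtractedKernel]
  rw [h1]
  have h2 : (2 : ℂ) - Complex.exp ((0 : ℝ) * Complex.I) = 1 := by
    simp; norm_num
  rw [h2, Complex.log_one, sub_zero, Complex.add_im, Complex.ofReal_im, Complex.im_ofReal_mul]
  simp
  ring

theorem norm_cauchyHalf_le (h : HalfLineWeight m w A e α) :
    ∃ C, ∀ s φ, 0 ≤ s → φ ∈ Set.Icc 0 Real.pi → ‖cauchyHalf m w s φ‖ ≤ C * (1 + s) ^ e := by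
  set I := ∫ q in Set.Ioi (0 : ℝ), kernelMajorant m A e α q
  have hcont : Continuous fun φ : ℝ => ((φ - Real.pi : ℝ) * Complex.I -
      Complex.log (2 - Complex.exp (φ * Complex.I)) : ℂ) := by
    refine Continuous.sub (by fun_prop) ?_
    refine Continuous.clog (by fun_prop) ?_
    intro φ
    refine Or.inl ?_
    have : (Complex.exp ((φ : ℂ) * Complex.I)).re ≤ 1 :=
      (Complex.re_le_norm _).trans (Complex.norm_exp_ofReal_mul_I φ).le
    rw [Complex.sub_re, Complex.re_ofNat]
    linarith
  obtain ⟨B, hB⟩ := (isCompact_Icc (a := (0 : ℝ)) (b := Real.pi)).exists_bound_of_continuousOn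
    hcont.continuousOn
  have hA := h.A_nonneg
  have hB0 : 0 ≤ B := (norm_nonneg _).trans (hB 0 ⟨le_rfl, Real.pi_pos.le⟩)
  refine ⟨I + A * B, fun s φ hs hφ => ?_⟩
  have hse : 0 ≤ (1 + s) ^ e := Real.rpow_nonneg (by linarith) _
  have hm1 : (1 : ℝ) ≤ m := by exact_mod_cast le_trans one_le_two h.two_le
  unfold cauchyHalf
  refine (norm_add_le _ _).trans ?_
  rw [add_mul]
  refine add_le_add ?_ ?_
  · refine (norm_integral_le_of_norm_le (h.integrableOn_kernelMajorant.const_mul ((1 + s) ^ e))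
      ?_).trans ?_
    · refine (ae_restrict_iff' measurableSet_Ioi).mpr (Eventually.of_forall ?_)
      intro q hq
      exact h.norm_subtractedKernel_le hs (Complex.norm_exp_ofReal_mul_I φ) hq
    · rw [integral_const_mul, mul_comm]
  · rw [norm_mul, Complex.norm_real, Real.norm_of_nonneg (div_nonneg (h.nonneg s hs) (by linarith))]
    calc w s / m * _ ≤ (A * (1 + s) ^ e) * B := by
          refine mul_le_mul ?_ (hB φ hφ) (norm_nonneg _) (by positivity)
          exact (div_le_self (h.nonneg s hs) hm1).trans (h.bound s hs)
      _ = _ := by ring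

end HalfLineWeight

end

/-! ### Cauchy integrals off the cut, and the constant weight -/

noncomputable section

theorem two_rpow_inv_pow {m : ℕ} (hm : m ≠ 0) : ((2 : ℝ) ^ ((m : ℝ)⁻¹)) ^ m = 2 :=
  Real.rpow_inv_natCast_pow zero_le_two hm

theorem neg_exp_mem {φ : ℝ} (h0 : 0 < φ) (hπ : φ ≤ Real.pi) {x : ℝ} (hx : 0 ≤ x) :
    (x : ℂ) - Complex.exp (φ * Complex.I) ∈ Complex.slitPlane := by
  rw [Complex.mem_slitPlane_iff]
  rcases hπ.eq_or_lt with h | h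
  · left
    rw [h, Complex.exp_pi_mul_I]
    simp
    linarith
  · right
    rw [Complex.sub_im, Complex.exp_ofReal_mul_I_im, Complex.ofReal_im, zero_sub]
    exact (neg_neg_of_pos (Real.sin_pos_of_pos_of_lt_pi h0 h)).ne

theorem exp_sub_ne_zero {φ : ℝ} (h0 : 0 < φ) (hπ : φ ≤ Real.pi) {x : ℝ} (hx : 0 ≤ x) :
    Complex.exp (φ * Complex.I) - (x : ℂ) ≠ 0 := by
  have := Complex.slitPlane_ne_zero (neg_exp_mem h0 hπ hx)
  rw [← neg_sub]
  exact neg_ne_zero.mpr this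

/-- The profile q^(m-1) is a multiple of the derivative of q^m, so -(1/m) log(q^m - z) is a
primitive. For 0 < φ ≤ π the principal logarithm is smooth along the path, and log(-z) = i(φ - π).
This is the explicit term in `cauchyHalf`, and it continues to φ = 0. -/
theorem integral_cutoffPow {m : ℕ} (hm : 1 ≤ m) {φ : ℝ} (h0 : 0 < φ) (hπ : φ ≤ Real.pi) :
    IntegrableOn (fun q : ℝ => (cutoffPow m q : ℂ) /
      (Complex.exp (φ * Complex.I) - ((q ^ m : ℝ) : ℂ))) (Set.Ioi 0) ∧
    ∫ q in Set.Ioi (0 : ℝ), (cutoffPow m q : ℂ) /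
      (Complex.exp (φ * Complex.I) - ((q ^ m : ℝ) : ℂ)) =
      (1 / m : ℝ) * ((φ - Real.pi : ℝ) * Complex.I -
        Complex.log (2 - Complex.exp (φ * Complex.I))) := by
  set z := Complex.exp (φ * Complex.I) with hz
  set r : ℝ := (2 : ℝ) ^ ((m : ℝ)⁻¹) with hr
  have hm0 : m ≠ 0 := by omega
  have hrm : r ^ m = 2 := two_rpow_inv_pow hm0
  have hr0 : 0 < r := Real.rpow_pos_of_pos two_pos _
  set f : ℝ → ℂ := fun q => ((q ^ (m - 1) : ℝ) : ℂ) / (z - ((q ^ m : ℝ) : ℂ)) with hf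
  have hind : Set.EqOn (fun q : ℝ => (cutoffPow m q : ℂ) / (z - ((q ^ m : ℝ) : ℂ)))
      ((Set.Ioc 0 r).indicator f) (Set.Ioi 0) := by
    intro q hq
    have hq' : (0 : ℝ) < q := hq
    have hiff : q ^ m ≤ 2 ↔ q ≤ r := by
      rw [← hrm]
      exact pow_le_pow_iff_left₀ hq'.le hr0.le hm0
    simp only [cutoffPow, Set.indicator, Set.mem_Ioc, hq', true_and, hiff]
    split_ifs <;> simp [hf]
  have hcont : ContinuousOn f (Set.Icc 0 r) := by
    refine ContinuousOn.div (by fun_prop) (by fun_prop) ?_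
    intro q hq
    exact exp_sub_ne_zero h0 hπ (pow_nonneg hq.1 m)
  have hint : IntegrableOn f (Set.Ioc 0 r) :=
    (hcont.integrableOn_Icc).mono_set Set.Ioc_subset_Icc_self
  have hsub : Set.Ioc 0 r ⊆ Set.Ioi 0 := fun q hq => hq.1
  constructor
  · refine IntegrableOn.congr_fun ?_ hind.symm measurableSet_Ioi
    exact (IntegrableOn.integrable_indicator hint measurableSet_Ioc).integrableOn
  · rw [setIntegral_congr_fun measurableSet_Ioi hind, setIntegral_indicator measurableSet_Ioc,
      Set.inter_eq_right.mpr hsub, ← intervalIntegral.integral_of_le hr0.le]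
    have hderiv : ∀ q ∈ Set.uIcc 0 r, HasDerivAt
        (fun q : ℝ => -((1 / m : ℝ) : ℂ) * Complex.log (((q ^ m : ℝ) : ℂ) - z)) (f q) q := by
      intro q hq
      rw [Set.uIcc_of_le hr0.le] at hq
      have hne := exp_sub_ne_zero h0 hπ (pow_nonneg hq.1 m)
      have h1 : HasDerivAt (fun q : ℝ => ((q ^ m : ℝ) : ℂ) - z) ((m * q ^ (m - 1) : ℝ) : ℂ) q :=
        ((hasDerivAt_pow m q).ofReal_comp).sub_const z
      have h2 := (h1.clog_real (neg_exp_mem h0 hπ (pow_nonneg hq.1 m))).const_mul (-((1 / m : ℝ) : ℂ))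
      refine h2.congr_deriv ?_
      have hne2 : ((q ^ m : ℝ) : ℂ) - z ≠ 0 := by
        rw [← neg_sub]; exact neg_ne_zero.mpr hne
      have hmc : (m : ℂ) ≠ 0 := by exact_mod_cast hm0
      simp only [hf]
      rw [show z - ((q ^ m : ℝ) : ℂ) = -(((q ^ m : ℝ) : ℂ) - z) by ring]
      push_cast at hne2 ⊢
      field_simp
    have hii : IntervalIntegrable f volume 0 r :=
      (intervalIntegrable_iff_integrableOn_Ioc_of_le hr0.le).mpr hint
    rw [intervalIntegral.integral_eq_sub_of_hasDerivAt hderiv hii, hrm, zero_pow hm0]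
    have hlog : Complex.log (((0 : ℝ) : ℂ) - z) = (φ - Real.pi : ℝ) * Complex.I := by
      have : ((0 : ℝ) : ℂ) - z = Complex.exp ((φ - Real.pi : ℝ) * Complex.I) := by
        rw [hz, Complex.ofReal_sub, sub_mul, Complex.exp_sub, Complex.exp_pi_mul_I, div_neg, div_one]
        simp
      rw [this, Complex.log_exp]
      · simp; linarith
      · simp; linarith [Real.pi_pos]
    rw [hlog]
    push_cast
    ring

namespace HalfLineWeight

variable {m : ℕ} {w : ℝ → ℝ} {A e α : ℝ}

theorem cauchyHalf_eq (h : HalfLineWeight m w A e α) {s φ : ℝ} (hs : 0 ≤ s) (h0 : 0 < φ)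
    (hπ : φ ≤ Real.pi) :
    IntegrableOn (fun q : ℝ => (w (s * q) : ℂ) /
      (Complex.exp (φ * Complex.I) - ((q ^ m : ℝ) : ℂ))) (Set.Ioi 0) ∧
    cauchyHalf m w s φ = ∫ q in Set.Ioi (0 : ℝ), (w (s * q) : ℂ) /
      (Complex.exp (φ * Complex.I) - ((q ^ m : ℝ) : ℂ)) := by
  obtain ⟨hi, hv⟩ := integral_cutoffPow (le_trans one_le_two h.two_le) h0 hπ
  have hs1 := h.integrableOn_subtractedKernel hs (Complex.norm_exp_ofReal_mul_I φ)
  have heq : (fun q : ℝ => (w (s * q) : ℂ) / (Complex.exp (φ * Complex.I) - ((q ^ m : ℝ) : ℂ))) =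
      fun q => subtractedKernel m w s (Complex.exp (φ * Complex.I)) q + (w s : ℂ) *
        ((cutoffPow m q : ℂ) / (Complex.exp (φ * Complex.I) - ((q ^ m : ℝ) : ℂ))) := by
    funext q
    simp only [subtractedKernel]
    push_cast
    ring
  constructor
  · rw [heq]
    exact hs1.add (hi.const_mul _)
  · rw [heq, integral_add hs1 (hi.const_mul _), integral_const_mul, hv, cauchyHalf]
    push_cast
    ring

end HalfLineWeight

/-! ### The constant weight -/

theorem halfLineWeight_one {m : ℕ} (hm : 2 ≤ m) : HalfLineWeight m (fun _ => 1) 1 0 1 where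
  two_le := hm
  A_nonneg := zero_le_one
  e_nonneg := le_rfl
  e_lt := by
    have : (2 : ℝ) ≤ m := by exact_mod_cast hm
    linarith
  α_pos := one_pos
  nonneg := fun _ _ => zero_le_one
  cont := continuousOn_const
  bound := by intro k _; simp
  holder := by intro s q _ _ _; simp

/-- The scaled Cauchy integral of the constant weight `1`. -/
def cauchyOne (m : ℕ) (φ : ℝ) : ℂ := cauchyHalf m (fun _ => 1) 0 φ

theorem cauchyHalf_zero (m : ℕ) (w : ℝ → ℝ) (φ : ℝ) :
    cauchyHalf m w 0 φ = w 0 * cauchyOne m φ := by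
  unfold cauchyOne cauchyHalf
  rw [mul_add, ← integral_const_mul]
  congr 1
  · congr 1
    funext q
    simp only [subtractedKernel, zero_mul]
    push_cast
    ring
  · push_cast
    ring

theorem continuous_cauchyOne {m : ℕ} (hm : 2 ≤ m) : Continuous (cauchyOne m) := by
  have := (halfLineWeight_one hm).continuousOn_cauchyHalf
  rw [← continuousOn_univ]
  exact this.comp (f := fun φ : ℝ => ((0 : ℝ), φ)) (by fun_prop) (fun φ _ => ⟨Set.self_mem_Ici, trivial⟩)

theorem cauchyOne_eq {m : ℕ} (hm : 2 ≤ m) {φ : ℝ} (h0 : 0 < φ) (hπ : φ ≤ Real.pi) :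
    IntegrableOn (fun q : ℝ => 1 / (Complex.exp (φ * Complex.I) - ((q ^ m : ℝ) : ℂ))) (Set.Ioi 0) ∧
    cauchyOne m φ = ∫ q in Set.Ioi (0 : ℝ), 1 /
      (Complex.exp (φ * Complex.I) - ((q ^ m : ℝ) : ℂ)) := by
  have := (halfLineWeight_one hm).cauchyHalf_eq le_rfl h0 hπ
  simpa [cauchyOne] using this

/-- From |z - x|² = 1 - 2x cos φ + x² and 2|x| ≤ 1 + x². The constant stays away from 0 locally
uniformly in 0 < φ < π, which permits differentiation under the integral. -/
theorem normSq_exp_sub_ge (φ x : ℝ) :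
    (1 - |Real.cos φ|) * (1 + x ^ 2) ≤ ‖Complex.exp (φ * Complex.I) - (x : ℂ)‖ ^ 2 := by
  rw [← Complex.normSq_eq_norm_sq, Complex.normSq_apply, Complex.sub_re, Complex.sub_im,
    Complex.exp_ofReal_mul_I_re, Complex.exp_ofReal_mul_I_im, Complex.ofReal_re, Complex.ofReal_im]
  have h1 := Real.sin_sq_add_cos_sq φ
  have h2 : Real.cos φ * x ≤ |Real.cos φ| * |x| := by rw [← abs_mul]; exact le_abs_self _
  have h3 : |x| ^ 2 = x ^ 2 := sq_abs x
  have h4 := abs_nonneg (Real.cos φ)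
  nlinarith [sq_nonneg (|x| - 1), mul_nonneg h4 (sq_nonneg (|x| - 1))]

theorem abs_cos_lt_one {φ : ℝ} (h0 : 0 < φ) (hπ : φ < Real.pi) : |Real.cos φ| < 1 := by
  rw [← sq_lt_one_iff_abs_lt_one]
  have h1 := Real.sin_sq_add_cos_sq φ
  have h2 := Real.sin_pos_of_pos_of_lt_pi h0 hπ
  nlinarith

theorem integrableOn_inv_one_add_pow_sq {m : ℕ} (hm : 2 ≤ m) :
    IntegrableOn (fun q : ℝ => 1 / (1 + (q ^ m) ^ 2)) (Set.Ioi 0) := by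
  have h1 : Integrable (fun q : ℝ => 2 * (1 + q ^ 2)⁻¹) := integrable_inv_one_add_sq.const_mul 2
  refine Integrable.mono' h1.integrableOn (Measurable.aestronglyMeasurable (by fun_prop)) ?_
  refine (ae_restrict_iff' measurableSet_Ioi).mpr (Eventually.of_forall ?_)
  intro q hq
  have hq' : (0 : ℝ) < q := hq
  rw [Real.norm_of_nonneg (by positivity), ← div_eq_mul_inv]
  rw [div_le_div_iff₀ (by positivity) (by positivity)]
  rcases le_total q 1 with h | h
  · nlinarith [sq_nonneg (q ^ m)]
  · have : q ^ 1 ≤ q ^ m := pow_le_pow_right₀ h (by omega)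
    rw [pow_one] at this
    nlinarith

theorem integrableOn_inv_sq {m : ℕ} (hm : 2 ≤ m) {φ : ℝ} (h0 : 0 < φ) (hπ : φ < Real.pi) :
    IntegrableOn (fun q : ℝ => 1 / (Complex.exp (φ * Complex.I) - ((q ^ m : ℝ) : ℂ)) ^ 2)
      (Set.Ioi 0) := by
  have hc := abs_cos_lt_one h0 hπ
  refine Integrable.mono' ((integrableOn_inv_one_add_pow_sq hm).const_mul (1 / (1 - |Real.cos φ|)))
    (Measurable.aestronglyMeasurable (by fun_prop)) ?_
  refine Eventually.of_forall fun q => ?_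
  have h1 := normSq_exp_sub_ge φ (q ^ m)
  rw [norm_div, norm_one, norm_pow, one_div_mul_one_div_rev]
  refine one_div_le_one_div_of_le ?_ ?_
  · have : 0 < 1 - |Real.cos φ| := by linarith
    positivity
  · linarith

/-- Integration by parts relates the second power of the kernel to the first. -/
theorem integral_inv_sq {m : ℕ} (hm : 2 ≤ m) {φ : ℝ} (h0 : 0 < φ) (hπ : φ < Real.pi) :
    (m : ℂ) * Complex.exp (φ * Complex.I) * ∫ q in Set.Ioi (0 : ℝ), 1 /
      (Complex.exp (φ * Complex.I) - ((q ^ m : ℝ) : ℂ)) ^ 2 = (m - 1) * cauchyOne m φ := by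
  set z := Complex.exp (φ * Complex.I) with hz
  obtain ⟨hi, hv⟩ := cauchyOne_eq hm h0 hπ.le
  have hi2 := integrableOn_inv_sq hm h0 hπ
  rw [hv, ← integral_const_mul, ← integral_const_mul, ← sub_eq_zero]
  rw [← integral_sub (hi2.const_mul _) (hi.const_mul _)]
  have hne : ∀ q : ℝ, 0 ≤ q → z - ((q ^ m : ℝ) : ℂ) ≠ 0 := fun q hq =>
    exp_sub_ne_zero h0 hπ.le (pow_nonneg hq m)
  -- Writing q^m = z - (z - q^m) in the derivative of q/(z - q^m) produces both kernels. This
  -- primitive vanishes at 0 and, as m ≥ 2, at infinity.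
  have hderiv : ∀ q ∈ Set.Ici (0 : ℝ), HasDerivAt (fun q : ℝ => (q : ℂ) / (z - ((q ^ m : ℝ) : ℂ)))
      (m * z * (1 / (z - ((q ^ m : ℝ) : ℂ)) ^ 2) - (m - 1) * (1 / (z - ((q ^ m : ℝ) : ℂ)))) q := by
    intro q hq
    have h1 : HasDerivAt (fun q : ℝ => z - ((q ^ m : ℝ) : ℂ)) (-((m * q ^ (m - 1) : ℝ) : ℂ)) q :=
      ((hasDerivAt_pow m q).ofReal_comp).const_sub z
    have h2 := (hasDerivAt_id q).ofReal_comp.div h1 (hne q hq)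
    refine h2.congr_deriv ?_
    have h3 := hne q hq
    have h4 : q ^ m = q ^ (m - 1) * q := by
      rw [← pow_succ]; congr 1; omega
    simp only [id, h4] at h3 ⊢
    push_cast at h3 ⊢
    field_simp
    ring
  have hlim : Tendsto (fun q : ℝ => (q : ℂ) / (z - ((q ^ m : ℝ) : ℂ))) atTop (𝓝 0) := by
    rw [tendsto_zero_iff_norm_tendsto_zero]
    refine squeeze_zero' (Eventually.of_forall fun q => norm_nonneg _) (g := fun q : ℝ => 2 * q⁻¹)
      ?_ ?_
    · filter_upwards [eventually_ge_atTop (2 : ℝ)] with q hq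
      have h1 := abs_one_sub_le_norm (Complex.norm_exp_ofReal_mul_I φ) (x := q ^ m) (by positivity)
      have h2 : q ^ 2 ≤ q ^ m := pow_le_pow_right₀ (by linarith) hm
      rw [abs_of_nonpos (by nlinarith)] at h1
      rw [norm_div, Complex.norm_real, Real.norm_of_nonneg (by linarith), ← div_eq_mul_inv]
      rw [div_le_div_iff₀ (by nlinarith) (by linarith)]
      nlinarith
    · simpa using tendsto_inv_atTop_zero.const_mul (2 : ℝ)
  have h5 := integral_Ioi_of_hasDerivAt_of_tendsto' hderiv
    ((hi2.const_mul _).sub (hi.const_mul _)) hlim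
  rw [h5]
  simp

/-- Differentiation in φ squares the kernel, and integration by parts turns the square back into the
first power. The resulting linear differential equation is the source of the threshold exponent 1/m
- 1. -/
theorem hasDerivAt_cauchyOne {m : ℕ} (hm : 2 ≤ m) {φ : ℝ} (h0 : 0 < φ) (hπ : φ < Real.pi) :
    HasDerivAt (cauchyOne m) ((((m : ℝ)⁻¹ - 1 : ℝ) : ℂ) * Complex.I * cauchyOne m φ) φ := by
  have hc := abs_cos_lt_one h0 hπ
  set δ := (1 - |Real.cos φ|) / 2 with hδ
  have hδ0 : 0 < δ := by rw [hδ]; linarith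
  obtain ⟨r, hr0, hr⟩ : ∃ r > 0, ∀ x ∈ Metric.ball φ r, 0 < x ∧ x < Real.pi ∧
      δ < 1 - |Real.cos x| := by
    have h1 : ∀ᶠ x in 𝓝 φ, 0 < x ∧ x < Real.pi ∧ δ < 1 - |Real.cos x| := by
      refine (lt_mem_nhds h0).and ((gt_mem_nhds hπ).and ?_)
      have h2 : Continuous fun x => 1 - |Real.cos x| := by fun_prop
      exact (h2.continuousAt (x := φ)).eventually (lt_mem_nhds (by rw [hδ]; linarith))
    obtain ⟨r, hr0, hr⟩ := Metric.eventually_nhds_iff_ball.mp h1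
    exact ⟨r, hr0, hr⟩
  have key := hasDerivAt_integral_of_dominated_loc_of_deriv_le (μ := volume.restrict (Set.Ioi 0))
    (F := fun (x : ℝ) (q : ℝ) => 1 / (Complex.exp (x * Complex.I) - ((q ^ m : ℝ) : ℂ)))
    (F' := fun (x : ℝ) (q : ℝ) => -(Complex.I * Complex.exp (x * Complex.I)) *
      (1 / (Complex.exp (x * Complex.I) - ((q ^ m : ℝ) : ℂ)) ^ 2)) (x₀ := φ)
    (bound := fun q => (1 / δ) * (1 / (1 + (q ^ m) ^ 2))) (Metric.ball_mem_nhds φ hr0)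
    (Eventually.of_forall fun x => Measurable.aestronglyMeasurable (by fun_prop))
    (cauchyOne_eq hm h0 hπ.le).1
    (Measurable.aestronglyMeasurable (by fun_prop))
    (Eventually.of_forall fun q x hx => by
      obtain ⟨hx0, hxπ, hxc⟩ := hr x hx
      have h1 := normSq_exp_sub_ge x (q ^ m)
      rw [norm_mul, norm_neg, norm_mul, Complex.norm_I, Complex.norm_exp_ofReal_mul_I, one_mul,
        one_mul, norm_div, norm_one, norm_pow, one_div_mul_one_div_rev]
      refine one_div_le_one_div_of_le (by positivity) ?_
      refine le_trans ?_ h1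
      rw [mul_comm]
      exact mul_le_mul_of_nonneg_right hxc.le (by positivity))
    ((integrableOn_inv_one_add_pow_sq hm).const_mul _)
    (by
      filter_upwards [ae_restrict_mem measurableSet_Ioi] with q hq x hx
      obtain ⟨hx0, hxπ, hxc⟩ := hr x hx
      have hne := exp_sub_ne_zero hx0 hxπ.le (pow_nonneg (le_of_lt hq) m)
      have h1 : HasDerivAt (fun x : ℝ => Complex.exp (x * Complex.I) - ((q ^ m : ℝ) : ℂ))
          (Complex.exp (x * Complex.I) * (1 * Complex.I)) x :=
        (((hasDerivAt_id x).ofReal_comp.mul_const Complex.I).cexp).sub_const _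
      have h2 := h1.inv hne
      simp only [one_div]
      refine HasDerivAt.congr_deriv h2 ?_
      rw [div_eq_mul_inv]
      ring)
  have h2 := key.2
  have heq : cauchyOne m =ᶠ[𝓝 φ] fun x => ∫ q in Set.Ioi (0 : ℝ), 1 /
      (Complex.exp (x * Complex.I) - ((q ^ m : ℝ) : ℂ)) := by
    filter_upwards [Metric.ball_mem_nhds φ hr0] with x hx
    exact (cauchyOne_eq hm (hr x hx).1 (hr x hx).2.1.le).2
  refine (h2.congr_of_eventuallyEq heq).congr_deriv ?_
  rw [integral_const_mul]
  have h3 := integral_inv_sq hm h0 hπ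
  have hmc : (m : ℂ) ≠ 0 := by exact_mod_cast (by omega : m ≠ 0)
  have h4 : Complex.exp (φ * Complex.I) * ∫ q in Set.Ioi (0 : ℝ), 1 /
      (Complex.exp (φ * Complex.I) - ((q ^ m : ℝ) : ℂ)) ^ 2 = (m - 1) / m * cauchyOne m φ := by
    rw [div_mul_eq_mul_div, ← h3]
    field_simp
  rw [neg_mul, mul_assoc, h4]
  push_cast
  field_simp
  ring

/-- The scaled Cauchy integral of the constant weight is a pure phase times a constant. -/
theorem cauchyOne_eq_exp {m : ℕ} (hm : 2 ≤ m) : ∃ c : ℝ, 0 < c ∧ ∀ φ ∈ Set.Icc 0 Real.pi,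
    cauchyOne m φ = -c * Complex.exp (((m : ℝ)⁻¹ - 1 : ℝ) * (φ - Real.pi : ℝ) * Complex.I) := by
  set t : ℝ := (m : ℝ)⁻¹ - 1 with ht
  set c : ℝ := ∫ q in Set.Ioi (0 : ℝ), 1 / (1 + q ^ m) with hc
  have hval : cauchyOne m Real.pi = -(c : ℂ) := by
    rw [(cauchyOne_eq hm Real.pi_pos le_rfl).2, hc, ← integral_complex_ofReal, ← integral_neg]
    refine integral_congr_ae (Eventually.of_forall fun q => ?_)
    simp only [Complex.exp_pi_mul_I]
    push_cast
    rw [show (-1 - (q : ℂ) ^ m) = -(1 + (q : ℂ) ^ m) by ring, div_neg]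
  have hint : IntegrableOn (fun q : ℝ => 1 / (1 + q ^ m)) (Set.Ioi 0) := by
    have h1 := (cauchyOne_eq hm Real.pi_pos le_rfl).1.norm
    refine IntegrableOn.congr_fun h1 ?_ measurableSet_Ioi
    intro q hq
    have hq' : (0 : ℝ) < q := hq
    simp only [Complex.exp_pi_mul_I]
    rw [show (-1 - ((q ^ m : ℝ) : ℂ)) = ((-(1 + q ^ m) : ℝ) : ℂ) by push_cast; ring, norm_div,
      norm_one, Complex.norm_real, norm_neg, Real.norm_of_nonneg (by positivity)]
  have hcpos : 0 < c := by
    rw [hc, setIntegral_pos_iff_support_of_nonneg_ae _ hint]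
    · have : Set.Ioi (0 : ℝ) ⊆ Function.support (fun q : ℝ => 1 / (1 + q ^ m)) := by
        intro q hq
        have hq' : (0 : ℝ) < q := hq
        rw [Function.mem_support]
        positivity
      rw [Set.inter_eq_right.mpr this, Real.volume_Ioi]
      exact ENNReal.zero_lt_top
    · refine (ae_restrict_iff' measurableSet_Ioi).mpr (Eventually.of_forall ?_)
      intro q hq
      have hq' : (0 : ℝ) < q := hq
      simp only [Pi.zero_apply]
      positivity
  refine ⟨c, hcpos, ?_⟩
  -- The differential equation holds only for 0 < φ < π. It makes `g` constant on (0, π], and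
  -- continuity carries this to the cut φ = 0.
  set g : ℝ → ℂ := fun φ => cauchyOne m φ * Complex.exp (-(t * Complex.I * φ)) with hg
  have hgc : ContinuousOn g (Set.Icc 0 Real.pi) :=
    ((continuous_cauchyOne hm).mul (by fun_prop)).continuousOn
  have hgd : ∀ x ∈ Set.Ioo 0 Real.pi, HasDerivAt g 0 x := by
    intro x hx
    have h1 := hasDerivAt_cauchyOne hm hx.1 hx.2
    rw [← ht] at h1
    have h2 : HasDerivAt (fun φ : ℝ => Complex.exp (-(t * Complex.I * φ)))
        (Complex.exp (-(t * Complex.I * x)) * (-(t * Complex.I * (1 : ℝ)))) x :=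
      (((hasDerivAt_id x).ofReal_comp).const_mul (t * Complex.I)).neg.cexp
    refine (h1.mul h2).congr_deriv ?_
    push_cast
    ring
  have hconst : ∀ x ∈ Set.Ioc 0 Real.pi, g x = g Real.pi := by
    intro x hx
    have := constant_of_has_deriv_right_zero (hgc.mono (Set.Icc_subset_Icc_left hx.1.le))
      (fun y hy => (hgd y ⟨lt_of_lt_of_le hx.1 hy.1, hy.2⟩).hasDerivWithinAt)
    exact (this Real.pi ⟨hx.2, le_rfl⟩).symm
  have hconst' : Set.EqOn g (fun _ => g Real.pi) (Set.Icc 0 Real.pi) := by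
    refine Set.EqOn.of_subset_closure (s := Set.Ioc 0 Real.pi) hconst hgc continuousOn_const
      Set.Ioc_subset_Icc_self ?_
    rw [closure_Ioc Real.pi_pos.ne]
  intro φ hφ
  have h1 : g φ = g Real.pi := hconst' hφ
  simp only [hg, hval] at h1
  have h2 : cauchyOne m φ = cauchyOne m φ * Complex.exp (-(t * Complex.I * φ)) *
      Complex.exp (t * Complex.I * φ) := by
    rw [mul_assoc, ← Complex.exp_add]; simp
  rw [h2, h1, mul_assoc, ← Complex.exp_add]
  congr 2
  push_cast
  ring

end

/-! ### Continuous phases on the half strip of polar coordinates -/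

/-- The image is order connected, so two distinct integer values would force a half-integer value
between them. -/
theorem IsPreconnected.eq_of_int_valued {X : Type*} [TopologicalSpace X] {S : Set X}
    (hS : IsPreconnected S) {f : X → ℝ} (hf : ContinuousOn f S)
    (hint : ∀ x ∈ S, ∃ k : ℤ, f x = k) {x y : X} (hx : x ∈ S) (hy : y ∈ S) : f x = f y := by
  have key : ∀ x ∈ S, ∀ y ∈ S, ¬ f x < f y := by
    intro x hx y hy hlt
    have himg := (hS.image f hf).ordConnected
    obtain ⟨a, ha⟩ := hint x hx
    obtain ⟨b, hb⟩ := hint y hy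
    have hab : a + 1 ≤ b := by
      rw [ha, hb] at hlt
      exact_mod_cast hlt
    have hab' : (a : ℝ) + 1 ≤ b := by exact_mod_cast hab
    have hmem : (a : ℝ) + 1 / 2 ∈ Set.Icc (f x) (f y) := by
      rw [ha, hb]
      constructor <;> linarith
    obtain ⟨z, hz, hfz⟩ := himg.out (Set.mem_image_of_mem f hx) (Set.mem_image_of_mem f hy) hmem
    obtain ⟨c, hc⟩ := hint z hz
    rw [hc] at hfz
    have h1 : (a : ℝ) < c := by linarith
    have h2 : (c : ℝ) < a + 1 := by linarith
    have h1' : a < c := by exact_mod_cast h1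
    have h2' : c < a + 1 := by exact_mod_cast h2
    omega
  exact le_antisymm (not_lt.mp (key y hy x hx)) (not_lt.mp (key x hx y hy))

/-- Two continuous phases of the same function on a preconnected set differ by a constant. -/
theorem IsPreconnected.sub_eq_of_exp_eq {X : Type*} [TopologicalSpace X] {S : Set X}
    (hS : IsPreconnected S) {f g : X → ℝ} (hf : ContinuousOn f S) (hg : ContinuousOn g S)
    (hfg : ∀ x ∈ S, Complex.exp (f x * Complex.I) = Complex.exp (g x * Complex.I))
    {x y : X} (hx : x ∈ S) (hy : y ∈ S) : f x - g x = f y - g y := by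
  have h2π : (2 * Real.pi) ≠ 0 := by positivity
  have h := hS.eq_of_int_valued (f := fun x => (f x - g x) / (2 * Real.pi))
    ((hf.sub hg).div_const _) ?_ hx hy
  · field_simp at h
    exact h
  · intro x hx
    obtain ⟨n, hn⟩ := Complex.exp_eq_exp_iff_exists_int.mp (hfg x hx)
    refine ⟨n, ?_⟩
    have h1 : (f x : ℂ) = g x + n * (2 * Real.pi) := by
      have := Complex.I_ne_zero
      apply mul_right_cancel₀ this
      rw [hn]; ring
    have h2 : f x = g x + n * (2 * Real.pi) := by exact_mod_cast h1
    rw [h2]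
    field_simp
    ring

/-- The closed half-strip of moduli and angles that parametrizes a punctured half plane. -/
def polarStrip : Set (ℝ × ℝ) := Set.Ioi 0 ×ˢ Set.Icc 0 Real.pi

/-- Clamping the angle to [0, π] extends `F` to the open convex set (0, ∞) × ℝ. This set is simply
connected, so the extension lifts through the exponential. The phase is the imaginary part of the
lift. -/
theorem exists_continuousOn_phase {F : ℝ × ℝ → ℂ} (hF : ContinuousOn F polarStrip)
    (hF0 : ∀ p ∈ polarStrip, F p ≠ 0) :
    ∃ θ : ℝ × ℝ → ℝ, ContinuousOn θ polarStrip ∧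
      ∀ p ∈ polarStrip, F p = ‖F p‖ * Complex.exp (θ p * Complex.I) := by
  set cl : ℝ × ℝ → ℝ × ℝ := fun p => (p.1, max 0 (min p.2 Real.pi)) with hcl
  have hclc : Continuous cl := by fun_prop
  set U : Set (ℝ × ℝ) := Set.Ioi 0 ×ˢ Set.univ with hU
  have hmaps : Set.MapsTo cl U polarStrip := fun p hp =>
    ⟨hp.1, le_max_left _ _, max_le Real.pi_pos.le (min_le_right _ _)⟩
  have hUo : IsOpen U := isOpen_Ioi.prod isOpen_univ
  have hUc : Convex ℝ U := (convex_Ioi 0).prod convex_univ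
  have hUs : IsSimplyConnected U := by
    have := hUc.contractibleSpace ⟨(1, 0), by simp [hU]⟩
    exact SimplyConnectedSpace.ofContractible U
  obtain ⟨f, hfc, hf⟩ := Complex.exists_continuousOn_eqOn_exp_comp hUs hUo
    (hF.comp hclc.continuousOn hmaps) (by
      rintro ⟨p, hp, h0⟩
      exact hF0 _ (hmaps hp) h0)
  have hsub : polarStrip ⊆ U := fun p hp => ⟨hp.1, trivial⟩
  refine ⟨fun p => (f p).im, Complex.continuous_im.comp_continuousOn (hfc.mono hsub), ?_⟩
  intro p hp
  have h1 := hf (hsub hp)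
  have hclp : cl p = p := by
    have h2 := hp.2
    simp only [hcl]
    rw [min_eq_left h2.2, max_eq_right h2.1]
  simp only [Function.comp_apply, hclp] at h1
  rw [← h1, Complex.norm_exp]
  conv_lhs => rw [← Complex.re_add_im (f p), Complex.exp_add]
  push_cast
  rfl

/-- A uniform asymptotic law F ~ c R(s) e^{inφ} fixes the phase up to one multiple of 2π, the same
for all small or all large half circles. Hence the phase converges along both edges, and its limits
differ by nπ. -/
theorem tendsto_phase {F : ℝ × ℝ → ℂ} {θ : ℝ × ℝ → ℝ} (hθ : ContinuousOn θ polarStrip)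
    (hF : ∀ p ∈ polarStrip, F p = ‖F p‖ * Complex.exp (θ p * Complex.I))
    {l : Filter ℝ} [l.NeBot] (hl : ∀ S ∈ l, ∃ T ∈ l, T ⊆ S ∧ T ⊆ Set.Ioi 0 ∧ IsPreconnected T)
    {R : ℝ → ℝ} (hR : ∀ s, 0 < s → 0 < R s) {n : ℝ} {c : ℂ} (hc : c ≠ 0)
    (hlim : Tendsto (fun p : ℝ × ℝ => F p / (R p.1 * Complex.exp (n * p.2 * Complex.I)))
      (l ×ˢ 𝓟 (Set.Icc 0 Real.pi)) (𝓝 c)) :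
    ∃ a, Tendsto (fun s => θ (s, 0)) l (𝓝 a) ∧
      Tendsto (fun s => θ (s, Real.pi)) l (𝓝 (a + n * Real.pi)) := by
  set γ := Complex.arg c with hγ
  set u : ℝ × ℝ → ℝ := fun p => θ p - n * p.2 - γ with hu
  have huc : ContinuousOn u polarStrip := by
    refine (hθ.sub (Continuous.continuousOn (by fun_prop))).sub continuousOn_const
  have hpos : ∀ᶠ p in l ×ˢ 𝓟 (Set.Icc 0 Real.pi), p ∈ polarStrip := by
    obtain ⟨T, hT, -, hT0, -⟩ := hl Set.univ univ_mem
    filter_upwards [prod_mem_prod hT (mem_principal_self (Set.Icc 0 Real.pi))] with p hp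
    exact ⟨hT0 hp.1, hp.2⟩
  have hce : c = ‖c‖ * Complex.exp (γ * Complex.I) := (Complex.norm_mul_exp_arg_mul_I c).symm
  -- the normalized function tends to one
  have hlim1 : Tendsto (fun p => Complex.exp (u p * Complex.I)) (l ×ˢ 𝓟 (Set.Icc 0 Real.pi))
      (𝓝 1) := by
    have h1 := hlim.div (Complex.continuous_ofReal.continuousAt.tendsto.comp hlim.norm)
      (by simpa using hc)
    have h2 := h1.mul_const (Complex.exp (-(γ * Complex.I)))
    have h3 : c / (‖c‖ : ℂ) * Complex.exp (-(γ * Complex.I)) = 1 := by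
      have hcn : (‖c‖ : ℂ) ≠ 0 := by simpa using hc
      rw [Complex.exp_neg]
      have hen := Complex.exp_ne_zero (γ * Complex.I)
      field_simp
      exact hce
    rw [h3] at h2
    have hne : ∀ᶠ p in l ×ˢ 𝓟 (Set.Icc 0 Real.pi), F p ≠ 0 := by
      filter_upwards [hlim.eventually_ne hc] with p hp h0
      exact hp (by rw [h0, zero_div])
    refine h2.congr' ?_
    filter_upwards [hpos, hne] with p hp hFp
    have hRp := hR p.1 hp.1
    have hRc : (R p.1 : ℂ) ≠ 0 := by exact_mod_cast hRp.ne'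
    have hFn : (‖F p‖ : ℂ) ≠ 0 := by simpa using hFp
    have e1 : ‖F p / (R p.1 * Complex.exp (n * p.2 * Complex.I))‖ = ‖F p‖ / R p.1 := by
      rw [norm_div, norm_mul, Complex.norm_real, Real.norm_of_nonneg hRp.le]
      rw [show (n * p.2 * Complex.I : ℂ) = ((n * p.2 : ℝ) : ℂ) * Complex.I by push_cast; ring,
        Complex.norm_exp_ofReal_mul_I, mul_one]
    rw [Pi.div_apply, Function.comp_apply, e1]
    have e2 : Complex.exp (u p * Complex.I) = Complex.exp (θ p * Complex.I) *
        (Complex.exp (n * p.2 * Complex.I))⁻¹ * Complex.exp (-(γ * Complex.I)) := by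
      rw [← Complex.exp_neg, ← Complex.exp_add, ← Complex.exp_add, hu]
      congr 1
      push_cast
      ring
    rw [e2]
    congr 1
    have hexp := Complex.exp_ne_zero (n * p.2 * Complex.I)
    have hFe := hF p hp
    rw [Complex.ofReal_div]
    conv_lhs => rw [hFe]
    rw [norm_mul, Complex.norm_real, norm_norm, Complex.norm_exp_ofReal_mul_I, mul_one]
    field_simp
  -- The principal argument `v` tends to 0, while `u - v` has values in 2πℤ and is continuous near
  -- the end of the strip. On a connected tail times [0, π] it is therefore constant.
  set v : ℝ × ℝ → ℝ := fun p => Complex.arg (Complex.exp (u p * Complex.I)) with hv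
  have hvlim : Tendsto v (l ×ˢ 𝓟 (Set.Icc 0 Real.pi)) (𝓝 0) := by
    have := (Complex.continuousAt_arg Complex.one_mem_slitPlane).tendsto.comp hlim1
    rwa [Complex.arg_one] at this
  have hslit : ∀ᶠ p in l ×ˢ 𝓟 (Set.Icc 0 Real.pi),
      Complex.exp (u p * Complex.I) ∈ Complex.slitPlane :=
    hlim1.eventually (Complex.isOpen_slitPlane.mem_nhds Complex.one_mem_slitPlane)
  obtain ⟨S, hS, hS'⟩ : ∃ S ∈ l, ∀ s ∈ S, ∀ φ ∈ Set.Icc 0 Real.pi,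
      Complex.exp (u (s, φ) * Complex.I) ∈ Complex.slitPlane := by
    obtain ⟨A, hA, B, hB, hAB⟩ := mem_prod_iff.mp hslit
    exact ⟨A, hA, fun s hs φ hφ => hAB ⟨hs, hB hφ⟩⟩
  obtain ⟨T, hT, hTS, hT0, hTc⟩ := hl S hS
  have hTsub : T ×ˢ Set.Icc 0 Real.pi ⊆ polarStrip := Set.prod_mono hT0 le_rfl
  have hconn : IsPreconnected (T ×ˢ Set.Icc 0 Real.pi) := hTc.prod isPreconnected_Icc
  have huT := huc.mono hTsub
  have hvT : ContinuousOn v (T ×ˢ Set.Icc 0 Real.pi) := by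
    intro p hp
    have h1 : ContinuousWithinAt (fun p => Complex.exp (u p * Complex.I))
        (T ×ˢ Set.Icc 0 Real.pi) p :=
      ((Complex.continuous_ofReal.continuousAt.comp_continuousWithinAt (huT p hp)).mul
        continuousWithinAt_const).cexp
    exact ContinuousAt.comp_continuousWithinAt (f := fun p => Complex.exp (u p * Complex.I)) (x := p)
      (Complex.continuousAt_arg (hS' p.1 (hTS hp.1) p.2 hp.2)) h1
  have hdiff : ∀ p ∈ T ×ˢ Set.Icc 0 Real.pi, ∀ q ∈ T ×ˢ Set.Icc 0 Real.pi,
      u p - v p = u q - v q := by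
    intro p hp q hq
    refine hconn.sub_eq_of_exp_eq huT hvT ?_ hp hq
    intro x _
    have := Complex.norm_mul_exp_arg_mul_I (Complex.exp (u x * Complex.I))
    rw [Complex.norm_exp_ofReal_mul_I, Complex.ofReal_one, one_mul] at this
    exact this.symm
  obtain ⟨s₀, hs₀⟩ := l.nonempty_of_mem hT
  have h0 : (0 : ℝ) ∈ Set.Icc 0 Real.pi := ⟨le_rfl, Real.pi_pos.le⟩
  have hπ : Real.pi ∈ Set.Icc 0 Real.pi := ⟨Real.pi_pos.le, le_rfl⟩
  set K := u (s₀, 0) - v (s₀, 0) with hK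
  have hgen : ∀ φ ∈ Set.Icc 0 Real.pi,
      Tendsto (fun s => θ (s, φ)) l (𝓝 (K + γ + n * φ)) := by
    intro φ hφ
    have h1 : Tendsto (fun s => v (s, φ)) l (𝓝 0) := by
      refine hvlim.comp (tendsto_id.prodMk ?_)
      exact tendsto_principal.mpr (Eventually.of_forall fun _ => hφ)
    have h2 := h1.add_const (K + γ + n * φ)
    rw [zero_add] at h2
    refine h2.congr' ?_
    filter_upwards [hT] with s hs
    have := hdiff (s, φ) ⟨hs, hφ⟩ (s₀, 0) ⟨hs₀, h0⟩
    rw [← hK] at this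
    rw [← this]
    simp only [hu]
    ring
  refine ⟨K + γ, ?_, hgen _ hπ⟩
  simpa using hgen 0 h0

theorem atTop_tail_preconnected (S : Set ℝ) (hS : S ∈ (atTop : Filter ℝ)) :
    ∃ T ∈ (atTop : Filter ℝ), T ⊆ S ∧ T ⊆ Set.Ioi 0 ∧ IsPreconnected T := by
  obtain ⟨a, ha⟩ := mem_atTop_sets.mp hS
  refine ⟨Set.Ici (max a 1), Ici_mem_atTop _, fun x hx => ha x ((le_max_left _ _).trans hx),
    fun x hx => lt_of_lt_of_le (one_pos (α := ℝ)) ((le_max_right a 1).trans hx), isPreconnected_Ici⟩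

theorem nhdsGT_tail_preconnected (S : Set ℝ) (hS : S ∈ 𝓝[>] (0 : ℝ)) :
    ∃ T ∈ 𝓝[>] (0 : ℝ), T ⊆ S ∧ T ⊆ Set.Ioi 0 ∧ IsPreconnected T := by
  obtain ⟨b, hb, hbS⟩ := mem_nhdsGT_iff_exists_Ioo_subset.mp hS
  exact ⟨Set.Ioo 0 b, Ioo_mem_nhdsGT hb, hbS, fun x hx => hx.1, isPreconnected_Ioo⟩

/-! ### Weights from growth and Hölder bounds -/

theorem isLittleO_cocompact_bound {f : ℝ → ℝ} (hf : Continuous f) {a b : ℝ} (hab : a ≤ b)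
    (hb : 0 ≤ b) (h : f =o[cocompact ℝ] fun k : ℝ => |k| ^ a) :
    ∃ A, 1 ≤ A ∧ ∀ k, f k ≤ A * (1 + |k|) ^ b := by
  have h1 := h.bound one_pos
  rw [Filter.Eventually, Filter.mem_cocompact] at h1
  obtain ⟨t, ht, hts⟩ := h1
  obtain ⟨B, hB⟩ := (ht.union (isCompact_Icc (a := (-1 : ℝ)) (b := 1))).exists_bound_of_continuousOn
    hf.continuousOn
  refine ⟨max 1 B, le_max_left _ _, fun k => ?_⟩
  have h1k : (1 : ℝ) ≤ (1 + |k|) ^ b := Real.one_le_rpow (by linarith [abs_nonneg k]) hb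
  by_cases hk : k ∈ t ∪ Set.Icc (-1) 1
  · have h2 := (le_abs_self (f k)).trans (hB k hk)
    have h3 : f k ≤ max 1 B := h2.trans (le_max_right _ _)
    refine h3.trans (le_mul_of_one_le_right (le_trans zero_le_one (le_max_left _ _)) h1k)
  · have hkt : k ∈ tᶜ := fun hh => hk (Or.inl hh)
    have hk1 : 1 ≤ |k| := by
      by_contra hlt
      push Not at hlt
      exact hk (Or.inr (abs_le.mp hlt.le))
    have h2 := hts hkt
    simp only [Set.mem_ofPred_eq, one_mul] at h2
    rw [Real.norm_of_nonneg (Real.rpow_nonneg (abs_nonneg k) a)] at h2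
    calc f k ≤ |k| ^ a := (le_abs_self _).trans h2
      _ ≤ |k| ^ b := Real.rpow_le_rpow_of_exponent_le hk1 hab
      _ ≤ (1 + |k|) ^ b := Real.rpow_le_rpow (abs_nonneg _) (by linarith) hb
      _ ≤ max 1 B * (1 + |k|) ^ b := le_mul_of_one_le_left (by positivity) (le_max_left _ _)

theorem continuous_of_holder_growth {f : ℝ → ℝ} {C α : ℝ} {p : ℕ} (hα : 0 < α)
    (h : ∀ k k', |f k - f k'| ≤ C * (1 + |k| + |k'|) ^ p * |k - k'| ^ α) : Continuous f := by
  rw [continuous_iff_continuousAt]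
  intro k₀
  rw [ContinuousAt, tendsto_iff_norm_sub_tendsto_zero]
  have hc : ContinuousAt (fun k : ℝ => C * (1 + |k| + |k₀|) ^ p * |k - k₀| ^ α) k₀ := by
    refine ContinuousAt.mul (by fun_prop) ?_
    exact ContinuousAt.rpow_const (by fun_prop) (Or.inr hα.le)
  have h0 : Tendsto (fun k : ℝ => C * (1 + |k| + |k₀|) ^ p * |k - k₀| ^ α) (𝓝 k₀) (𝓝 0) := by
    have := hc.tendsto
    simpa [Real.zero_rpow hα.ne'] using this
  exact squeeze_zero (fun _ => norm_nonneg _) (fun k => h k k₀) h0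

/-- Interpolation between a Hölder bound with polynomially growing constant and a growth bound. -/
theorem halfLineWeight_of_holder_growth {m : ℕ} (hm : 2 ≤ m) {f : ℝ → ℝ} (hf0 : ∀ k, 0 ≤ f k)
    {C α : ℝ} {p : ℕ} (hα : 0 < α)
    (h : ∀ k k', |f k - f k'| ≤ C * (1 + |k| + |k'|) ^ p * |k - k'| ^ α)
    {e₀ A₀ : ℝ} (he₀ : 0 ≤ e₀) (he₀m : e₀ < (m : ℝ) - 1) (hA₀ : 1 ≤ A₀)
    (hb : ∀ k, f k ≤ A₀ * (1 + |k|) ^ e₀) :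
    ∃ A e β, HalfLineWeight m f A e β := by
  set η : ℝ := min ((m : ℝ) - 1 - e₀) 1 with hη
  have hη0 : 0 < η := lt_min (by linarith) one_pos
  have hη1 : η ≤ (m : ℝ) - 1 - e₀ := min_le_left _ _
  have hη2 : η ≤ 1 := min_le_right _ _
  have hpα : 0 < (p : ℝ) + α := by positivity
  -- An increment Δ is split as Δ^τ Δ^(1-τ). The Hölder bound, of growth p + α in the scale, is used
  -- for the first factor and the bound of growth e₀ for the second. This `τ` is small enough that
  -- e₀ + τ(p + α) < m - 1, at the price of the smaller Hölder exponent ατ.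
  set τ : ℝ := η / (p + α + 1) with hτ
  have hτ0 : 0 < τ := by positivity
  have hτ1 : τ * (p + α) < η := by
    rw [hτ, div_mul_eq_mul_div, div_lt_iff₀ (by positivity)]
    nlinarith
  have hτ2 : τ < 1 := by
    rw [hτ, div_lt_one (by positivity)]
    linarith
  -- The maximum with 1 ensures C₁^τ ≤ C₁ and covers a nonpositive `C`.
  set C₁ : ℝ := max (C * 3 ^ p) 1 with hC₁
  set C₂ : ℝ := A₀ * (2 ^ e₀ + 1) with hC₂
  have hC₁1 : 1 ≤ C₁ := le_max_right _ _
  have h2e : 0 < (2 : ℝ) ^ e₀ := Real.rpow_pos_of_pos two_pos _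
  have hC₂1 : A₀ ≤ C₂ := by rw [hC₂]; nlinarith
  have hA : A₀ ≤ C₁ * C₂ := by nlinarith
  refine ⟨C₁ * C₂, e₀ + τ * (p + α), α * τ, hm, by linarith, by positivity, by linarith,
    by positivity, fun k _ => hf0 k, (continuous_of_holder_growth hα h).continuousOn, ?_, ?_⟩
  · intro k hk
    have h1 := hb k
    rw [abs_of_nonneg hk] at h1
    refine h1.trans (mul_le_mul hA ?_ (by positivity) (by linarith))
    exact Real.rpow_le_rpow_of_exponent_le (by linarith) (by linarith [mul_pos hτ0 hpα])
  · intro s q hs hq hq2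
    set Δ := |f (s * q) - f s| with hΔ
    have hΔ0 : 0 ≤ Δ := abs_nonneg _
    have hs1 : 0 < 1 + s := by linarith
    have hX : Δ ≤ C₁ * (1 + s) ^ ((p : ℝ) + α) * |q - 1| ^ α := by
      refine (h _ _).trans ?_
      have e1 : |s * q - s| = s * |q - 1| := by
        rw [← mul_sub_one, abs_mul, abs_of_nonneg hs]
      rw [e1, Real.mul_rpow hs (abs_nonneg _), ← mul_assoc]
      refine mul_le_mul_of_nonneg_right ?_ (by positivity)
      rw [Real.rpow_add hs1, ← mul_assoc, Real.rpow_natCast]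
      have e2 : s ^ α ≤ (1 + s) ^ α := Real.rpow_le_rpow hs (by linarith) hα.le
      refine mul_le_mul ?_ e2 (by positivity) (by positivity)
      rw [abs_of_nonneg (mul_nonneg hs hq), abs_of_nonneg hs]
      have e3 : (1 + s * q + s) ^ p ≤ (3 * (1 + s)) ^ p :=
        pow_le_pow_left₀ (by positivity) (by nlinarith) p
      rw [mul_pow] at e3
      rcases le_total 0 C with hC | hC
      · calc C * (1 + s * q + s) ^ p ≤ C * (3 ^ p * (1 + s) ^ p) :=
              mul_le_mul_of_nonneg_left e3 hC
          _ = (C * 3 ^ p) * (1 + s) ^ p := by ring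
          _ ≤ C₁ * (1 + s) ^ p := mul_le_mul_of_nonneg_right (le_max_left _ _) (by positivity)
      · have : C * (1 + s * q + s) ^ p ≤ 0 := mul_nonpos_of_nonpos_of_nonneg hC (by positivity)
        exact this.trans (by positivity)
    have hY : Δ ≤ C₂ * (1 + s) ^ e₀ := by
      have h1 := hb (s * q)
      have h2 := hb s
      rw [abs_of_nonneg (mul_nonneg hs hq)] at h1
      rw [abs_of_nonneg hs] at h2
      have h3 : Δ ≤ f (s * q) + f s := by
        rw [hΔ, abs_sub_le_iff]
        constructor <;> linarith [hf0 (s * q), hf0 s]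
      have h4 : (1 + s * q) ^ e₀ ≤ 2 ^ e₀ * (1 + s) ^ e₀ := by
        rw [← Real.mul_rpow two_pos.le hs1.le]
        exact Real.rpow_le_rpow (by positivity) (by nlinarith) he₀
      calc Δ ≤ A₀ * (2 ^ e₀ * (1 + s) ^ e₀) + A₀ * (1 + s) ^ e₀ := by nlinarith
        _ = _ := by rw [hC₂]; ring
    have hsplit : Δ = Δ ^ τ * Δ ^ (1 - τ) := by
      rw [← Real.rpow_add_of_nonneg hΔ0 hτ0.le (by linarith)]
      simp
    have hXτ : Δ ^ τ ≤ C₁ * (1 + s) ^ (τ * (p + α)) * |q - 1| ^ (α * τ) := by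
      refine (Real.rpow_le_rpow hΔ0 hX hτ0.le).trans ?_
      rw [Real.mul_rpow (by positivity) (by positivity), Real.mul_rpow (by positivity)
        (by positivity), ← Real.rpow_mul hs1.le, ← Real.rpow_mul (abs_nonneg _), mul_comm τ]
      have : C₁ ^ τ ≤ C₁ := by
        conv_rhs => rw [← Real.rpow_one C₁]
        exact Real.rpow_le_rpow_of_exponent_le hC₁1 hτ2.le
      gcongr
    have hYτ : Δ ^ (1 - τ) ≤ C₂ * (1 + s) ^ e₀ := by
      refine (Real.rpow_le_rpow hΔ0 hY (by linarith)).trans ?_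
      rw [Real.mul_rpow (by positivity) (by positivity), ← Real.rpow_mul hs1.le]
      have h1 : C₂ ^ (1 - τ) ≤ C₂ := by
        conv_rhs => rw [← Real.rpow_one C₂]
        exact Real.rpow_le_rpow_of_exponent_le (hA₀.trans hC₂1) (by linarith)
      have h2 : (1 + s) ^ (e₀ * (1 - τ)) ≤ (1 + s) ^ e₀ :=
        Real.rpow_le_rpow_of_exponent_le (by linarith) (by nlinarith)
      gcongr
    rw [hsplit]
    calc Δ ^ τ * Δ ^ (1 - τ) ≤ (C₁ * (1 + s) ^ (τ * (p + α)) * |q - 1| ^ (α * τ)) *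
          (C₂ * (1 + s) ^ e₀) := by
          refine mul_le_mul hXτ hYτ (by positivity) (by positivity)
      _ = C₁ * C₂ * (1 + s) ^ (e₀ + τ * (p + α)) * |q - 1| ^ (α * τ) := by
          rw [Real.rpow_add hs1]; ring

/-! ### Cauchy integrals for both signs of the dispersion -/

noncomputable section

/-- At φ = π the energy is negative, off the cut, and every term is real. -/
theorem im_cauchyHalf_pi (m : ℕ) (w : ℝ → ℝ) (s : ℝ) : (cauchyHalf m w s Real.pi).im = 0 := by
  unfold cauchyHalf
  have h1 : ∫ q in Set.Ioi (0 : ℝ), subtractedKernel m w s (Complex.exp (Real.pi * Complex.I)) q =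
      ((∫ q in Set.Ioi (0 : ℝ), (w (s * q) - w s * cutoffPow m q) / (-1 - q ^ m) : ℝ) : ℂ) := by
    rw [← integral_complex_ofReal]
    refine integral_congr_ae (Eventually.of_forall fun q => ?_)
    simp [subtractedKernel]
  have h2 : Complex.log (2 - Complex.exp (Real.pi * Complex.I)) = (Real.log 3 : ℝ) := by
    rw [Complex.exp_pi_mul_I, show (2 - (-1) : ℂ) = ((3 : ℝ) : ℂ) by push_cast; norm_num,
      Complex.ofReal_log (by norm_num)]
  rw [h1, h2, Complex.add_im, Complex.ofReal_im, Complex.im_ofReal_mul, Complex.sub_im,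
    Complex.ofReal_im, sub_self, Complex.ofReal_zero, zero_mul, Complex.zero_im]
  ring

/-- Boundary values from the upper half plane of the Cauchy integral
`∫₀^∞ w (s q) / (e^{iφ} - τ q ^ m) dq`, for a sign `τ`. -/
def cauchySigned (m : ℕ) (w : ℝ → ℝ) (τ s φ : ℝ) : ℂ :=
  if τ = 1 then cauchyHalf m w s φ else -(starRingEnd ℂ) (cauchyHalf m w s (Real.pi - φ))

theorem im_cauchySigned_zero (m : ℕ) (w : ℝ → ℝ) (τ s : ℝ) :
    (cauchySigned m w τ s 0).im = if τ = 1 then -Real.pi * (w s / m) else 0 := by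
  unfold cauchySigned
  split_ifs
  · exact HalfLineWeight.im_cauchyHalf_zero m w s
  · simp [im_cauchyHalf_pi]

theorem im_cauchySigned_pi (m : ℕ) (w : ℝ → ℝ) (τ s : ℝ) :
    (cauchySigned m w τ s Real.pi).im = if τ = 1 then 0 else -Real.pi * (w s / m) := by
  unfold cauchySigned
  split_ifs
  · exact im_cauchyHalf_pi m w s
  · simp [HalfLineWeight.im_cauchyHalf_zero]

/-- Both signs carry the same dependence e^{i(1/m - 1)φ} on the angle and differ only by a constant
phase, so the two momentum half lines add up to a single exponential. -/
theorem cauchySigned_zero {m : ℕ} (hm : 2 ≤ m) : ∃ c : ℝ, 0 < c ∧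
    ∀ (w : ℝ → ℝ) (τ : ℝ), ∀ φ ∈ Set.Icc 0 Real.pi,
      cauchySigned m w τ 0 φ =
        (w 0 * c : ℝ) * (if τ = 1 then -Complex.exp ((Real.pi - Real.pi / m : ℝ) * Complex.I) else 1) *
        Complex.exp (((m : ℝ)⁻¹ - 1 : ℝ) * φ * Complex.I) := by
  obtain ⟨c, hc, h⟩ := cauchyOne_eq_exp hm
  refine ⟨c, hc, fun w τ φ hφ => ?_⟩
  unfold cauchySigned
  split_ifs
  · rw [cauchyHalf_zero, h φ hφ]
    have : Complex.exp (((m : ℝ)⁻¹ - 1 : ℝ) * (φ - Real.pi : ℝ) * Complex.I) =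
        Complex.exp ((Real.pi - Real.pi / m : ℝ) * Complex.I) *
        Complex.exp (((m : ℝ)⁻¹ - 1 : ℝ) * φ * Complex.I) := by
      rw [← Complex.exp_add]
      congr 1
      push_cast
      ring
    rw [this]
    push_cast
    ring
  · rw [cauchyHalf_zero, h (Real.pi - φ) ⟨by linarith [hφ.2], by linarith [hφ.1]⟩]
    have : (starRingEnd ℂ) (Complex.exp (((m : ℝ)⁻¹ - 1 : ℝ) * ((Real.pi - φ) - Real.pi : ℝ) *
        Complex.I)) = Complex.exp (((m : ℝ)⁻¹ - 1 : ℝ) * φ * Complex.I) := by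
      rw [← Complex.exp_conj]
      congr 1
      simp only [map_mul, Complex.conj_ofReal, Complex.conj_I]
      push_cast
      ring
    rw [map_mul, map_mul, map_neg, this]
    simp only [Complex.conj_ofReal]
    push_cast
    ring

namespace HalfLineWeight

variable {m : ℕ} {w : ℝ → ℝ} {A e α : ℝ}

theorem continuousOn_cauchySigned (h : HalfLineWeight m w A e α) (τ : ℝ) :
    ContinuousOn (fun p : ℝ × ℝ => cauchySigned m w τ p.1 p.2) (Set.Ici 0 ×ˢ Set.univ) := by
  unfold cauchySigned
  split_ifs
  · exact h.continuousOn_cauchyHalf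
  · refine ContinuousOn.neg (Complex.continuous_conj.comp_continuousOn ?_)
    exact h.continuousOn_cauchyHalf.comp (f := fun p : ℝ × ℝ => (p.1, Real.pi - p.2))
      (by fun_prop) (fun p hp => ⟨hp.1, trivial⟩)

theorem norm_cauchySigned_le (h : HalfLineWeight m w A e α) (τ : ℝ) :
    ∃ C, ∀ s φ, 0 ≤ s → φ ∈ Set.Icc 0 Real.pi →
      ‖cauchySigned m w τ s φ‖ ≤ C * (1 + s) ^ e := by
  obtain ⟨C, hC⟩ := h.norm_cauchyHalf_le
  refine ⟨C, fun s φ hs hφ => ?_⟩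
  unfold cauchySigned
  split_ifs
  · exact hC s φ hs hφ
  · rw [norm_neg, RCLike.norm_conj]
    exact hC s _ hs ⟨by linarith [hφ.2], by linarith [hφ.1]⟩

/-- The signed Cauchy integral away from its cut, at energy `d s ^ m e^{iφ}`. -/
theorem cauchySigned_eq (h : HalfLineWeight m w A e α) {τ d s φ : ℝ} (hτ : τ = 1 ∨ τ = -1)
    (hs : 0 < s) (hφ : φ ∈ Set.Icc 0 Real.pi) (h0 : φ = 0 → τ ≠ 1)
    (hπ : φ = Real.pi → τ ≠ -1) :
    IntegrableOn (fun k : ℝ => (w k : ℂ) / ((d * s ^ m : ℝ) * Complex.exp (φ * Complex.I) -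
      ((τ * d * k ^ m : ℝ) : ℂ))) (Set.Ioi 0) ∧
    ∫ k in Set.Ioi (0 : ℝ), (w k : ℂ) / ((d * s ^ m : ℝ) * Complex.exp (φ * Complex.I) -
      ((τ * d * k ^ m : ℝ) : ℂ)) = (s / (d * s ^ m) : ℝ) * cauchySigned m w τ s φ := by
  set f : ℝ → ℂ := fun k => (w k : ℂ) / ((d * s ^ m : ℝ) * Complex.exp (φ * Complex.I) -
      ((τ * d * k ^ m : ℝ) : ℂ)) with hf
  set g : ℝ → ℂ := fun q => (w (s * q) : ℂ) / (Complex.exp (φ * Complex.I) -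
      ((τ * q ^ m : ℝ) : ℂ)) with hg
  have hfg : ∀ q, f (s * q) = ((1 / (d * s ^ m) : ℝ) : ℂ) * g q := by
    intro q
    simp only [hf, hg]
    have : ((d * s ^ m : ℝ) : ℂ) * Complex.exp (φ * Complex.I) - ((τ * d * (s * q) ^ m : ℝ) : ℂ) =
        ((d * s ^ m : ℝ) : ℂ) * (Complex.exp (φ * Complex.I) - ((τ * q ^ m : ℝ) : ℂ)) := by
      rw [mul_pow]; push_cast; ring
    rw [this, div_mul_eq_div_div_swap]
    push_cast
    ring
  have hgmain : IntegrableOn g (Set.Ioi 0) ∧ ∫ q in Set.Ioi (0 : ℝ), g q =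
      cauchySigned m w τ s φ := by
    unfold cauchySigned
    split_ifs with h1
    · have hφ0 : 0 < φ := lt_of_le_of_ne hφ.1 (fun hh => h0 hh.symm h1)
      obtain ⟨hi, hv⟩ := h.cauchyHalf_eq hs.le hφ0 hφ.2
      have : g = fun q : ℝ => (w (s * q) : ℂ) /
          (Complex.exp (φ * Complex.I) - ((q ^ m : ℝ) : ℂ)) := by
        funext q; simp only [hg, h1, one_mul]
      rw [this]
      exact ⟨hi, hv.symm⟩
    · have hτ' : τ = -1 := hτ.resolve_left h1
      have hφπ : φ < Real.pi := lt_of_le_of_ne hφ.2 (fun hh => hπ hh hτ')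
      obtain ⟨hi, hv⟩ := h.cauchyHalf_eq hs.le (φ := Real.pi - φ) (by linarith) (by linarith [hφ.1])
      -- For sign -1, the reflection of the upper half plane in the imaginary axis moves the cut
      -- back to the positive axis.
      have hz : Complex.exp ((Real.pi - φ : ℝ) * Complex.I) =
          -(starRingEnd ℂ) (Complex.exp (φ * Complex.I)) := by
        rw [← Complex.exp_conj, map_mul, Complex.conj_ofReal, Complex.conj_I, Complex.ofReal_sub,
          sub_mul, Complex.exp_sub, Complex.exp_pi_mul_I, mul_neg, Complex.exp_neg]
        ring
      have hgc : g = fun q : ℝ => -(starRingEnd ℂ) ((w (s * q) : ℂ) /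
          (Complex.exp ((Real.pi - φ : ℝ) * Complex.I) - ((q ^ m : ℝ) : ℂ))) := by
        funext q
        simp only [hg, hz, hτ', map_div₀, map_sub, map_neg, Complex.conj_conj, Complex.conj_ofReal]
        rw [← div_neg]
        congr 1
        push_cast
        ring
      rw [hgc, hv]
      refine ⟨?_, ?_⟩
      · have h2 := (Complex.conjCLE.toContinuousLinearMap.integrable_comp hi).neg
        exact h2
      · rw [integral_neg, integral_conj]
  constructor
  · have h1 : IntegrableOn (fun q => f (s * q)) (Set.Ioi 0) := by
      simp only [hfg]
      exact hgmain.1.const_mul _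
    have := (integrableOn_Ioi_comp_mul_left_iff f 0 hs).mp h1
    rwa [mul_zero] at this
  · have h1 := integral_comp_mul_left_Ioi f 0 hs
    simp only [hfg, mul_zero] at h1
    rw [integral_const_mul, hgmain.2] at h1
    have hsc : (s : ℂ) ≠ 0 := by exact_mod_cast hs.ne'
    have h2 : ∫ k in Set.Ioi (0 : ℝ), f k = s * (s⁻¹ • ∫ k in Set.Ioi (0 : ℝ), f k) := by
      rw [Complex.real_smul, ← mul_assoc, Complex.ofReal_inv, mul_inv_cancel₀ hsc, one_mul]
    rw [h2, ← h1]
    push_cast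
    ring

end HalfLineWeight

end

/-! ### Bordered determinants and rank-one perturbations -/

section Bordered

variable {n R : Type*} [Fintype n] [DecidableEq n] [CommRing R]

/-- The square matrix `A` bordered by a column `u` and a row `v`, with zero corner. -/
def borderedMatrix (A : Matrix n n R) (u v : n → R) : Matrix (n ⊕ Unit) (n ⊕ Unit) R :=
  Matrix.fromBlocks A (Matrix.replicateCol Unit u) (Matrix.replicateRow Unit v) 0

/-- The left side is the determinant of the bordered matrix with last column (cu, 1), by the Schur
complement of the corner 1. Linearity in that column splits it as c(u, 0) + (0, 1). -/
theorem det_sub_smul_vecMulVec (A : Matrix n n R) (u v : n → R) (c : R) :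
    (A - c • Matrix.vecMulVec u v).det = A.det + c * (borderedMatrix A u v).det := by
  have h1 := Matrix.det_fromBlocks_one₂₂ A (Matrix.replicateCol Unit (c • u))
    (Matrix.replicateRow Unit v)
  have h2 : Matrix.replicateCol Unit (c • u) * Matrix.replicateRow Unit v =
      c • Matrix.vecMulVec u v := by
    ext i j
    simp [Matrix.mul_apply, Matrix.vecMulVec_apply, mul_assoc]
  rw [h2] at h1
  rw [← h1]
  set B := Matrix.fromBlocks A (Matrix.replicateCol Unit u) (Matrix.replicateRow Unit v)
    (0 : Matrix Unit Unit R) with hB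
  have h3 : Matrix.fromBlocks A (Matrix.replicateCol Unit (c • u)) (Matrix.replicateRow Unit v)
      (1 : Matrix Unit Unit R) = B.updateCol (Sum.inr ())
        (c • Sum.elim u 0 + Sum.elim (0 : n → R) 1) := by
    ext i j
    rcases i with i | i <;> rcases j with j | j <;> simp [hB]
  have h4 : B.updateCol (Sum.inr ()) (Sum.elim u 0) = B := by
    ext i j
    rcases i with i | i <;> rcases j with j | j <;> simp [hB]
  have h5 : B.updateCol (Sum.inr ()) (Sum.elim (0 : n → R) 1) =
      Matrix.fromBlocks A 0 (Matrix.replicateRow Unit v) (1 : Matrix Unit Unit R) := by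
    ext i j
    rcases i with i | i <;> rcases j with j | j <;> simp [hB]
  rw [h3, Matrix.det_updateCol_add, Matrix.det_updateCol_smul, h4, h5,
    Matrix.det_fromBlocks_zero₁₂, Matrix.det_one, mul_one, borderedMatrix, add_comm]

/-- The perturbation is a column operation with the border column. Hence the bordered determinant of
the inverse propagator does not see the self-energy κ. -/
theorem det_borderedMatrix_sub (A : Matrix n n R) (u v : n → R) (c : R) :
    (borderedMatrix (A - c • Matrix.vecMulVec u v) u v).det = (borderedMatrix A u v).det := by
  have h : borderedMatrix (A - c • Matrix.vecMulVec u v) u v = borderedMatrix A u v *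
      Matrix.fromBlocks 1 0 (Matrix.replicateRow Unit (-(c • v))) 1 := by
    rw [borderedMatrix, borderedMatrix, Matrix.fromBlocks_multiply]
    simp only [Matrix.mul_one, Matrix.mul_zero, add_zero, zero_add, Matrix.zero_mul]
    congr 1
    ext i j
    simp [Matrix.mul_apply, Matrix.vecMulVec_apply]
    ring
  rw [h, Matrix.det_mul, Matrix.det_fromBlocks_zero₁₂, Matrix.det_one, Matrix.det_one, mul_one,
    mul_one]

/-- Schur complement of the invertible block `A` in the bordered matrix. -/
theorem dotProduct_inv_mulVec_of_bordered {A : Matrix n n R} (hA : IsUnit A.det) (u v : n → R) :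
    A.det * (v ⬝ᵥ (A⁻¹ *ᵥ u)) = -(borderedMatrix A u v).det := by
  have := Matrix.invertibleOfIsUnitDet A hA
  rw [borderedMatrix, Matrix.det_fromBlocks₁₁, Matrix.det_unique (n := Unit), zero_sub, Matrix.neg_apply,
    mul_neg, neg_neg, Matrix.invOf_eq_nonsing_inv, Matrix.mul_assoc]
  congr 1

end Bordered

/-! ### The characteristic function and the self-energy in polar coordinates -/

noncomputable section

namespace EmitterModel

variable {N : ℕ} (M : EmitterModel N)

/-- The squared modulus of the coupling. -/
def weight (k : ℝ) : ℝ := ‖M.V k‖ ^ 2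

/-- Regularity of the coupling on both half lines. -/
structure RegularCoupling : Prop where
  meas : AEStronglyMeasurable M.V volume
  pos : ∃ A e α, HalfLineWeight M.m M.weight A e α
  neg : ∃ A e α, HalfLineWeight M.m (fun k => M.weight (-k)) A e α
  ne_zero : M.V 0 ≠ 0

theorem regularCoupling (hV_meas : AEStronglyMeasurable M.V volume) (hV_zero : M.V 0 ≠ 0)
    (hV_decay : ∃ γ : ℝ, 1 < γ ∧
      (fun k : ℝ => ‖M.V k‖ ^ 2) =o[cocompact ℝ] fun k : ℝ => |k| ^ ((M.m : ℝ) - γ))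
    (hV_holder : ∃ (C α : ℝ) (p : ℕ), 0 < α ∧ ∀ k k' : ℝ,
      |‖M.V k‖ ^ 2 - ‖M.V k'‖ ^ 2| ≤ C * (1 + |k| + |k'|) ^ p * |k - k'| ^ α) :
    M.RegularCoupling := by
  obtain ⟨γ, hγ, hdec⟩ := hV_decay
  obtain ⟨C, α, p, hα, hh⟩ := hV_holder
  have hm : (2 : ℝ) ≤ M.m := by exact_mod_cast M.two_le_m
  -- Lowering γ to at most 3/2 makes the exponent m - γ' nonnegative, as m ≥ 2, while it stays below
  -- m - 1.
  set γ' := min γ (3 / 2) with hγ'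
  have h1 : 1 < γ' := lt_min hγ (by norm_num)
  have h2 : γ' ≤ 3 / 2 := min_le_right _ _
  have h3 : γ' ≤ γ := min_le_left _ _
  obtain ⟨A, hA, hb⟩ := isLittleO_cocompact_bound (continuous_of_holder_growth hα hh)
    (a := (M.m : ℝ) - γ) (b := (M.m : ℝ) - γ') (by linarith) (by linarith) hdec
  refine ⟨hV_meas, ?_, ?_, hV_zero⟩
  · exact halfLineWeight_of_holder_growth M.two_le_m (fun k => sq_nonneg _) hα hh
      (by linarith) (by linarith) hA hb
  · refine halfLineWeight_of_holder_growth M.two_le_m (fun k => sq_nonneg _) hα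
      (C := C) (p := p) (fun k k' => ?_) (e₀ := (M.m : ℝ) - γ')
      (by linarith) (by linarith) hA (fun k => ?_)
    · have := hh (-k) (-k')
      rwa [abs_neg, abs_neg, neg_sub_neg, abs_sub_comm k' k] at this
    · have := hb (-k)
      rwa [abs_neg] at this

/-- The scalar Cauchy integral with `K(ω) = κ(ω) |u⟩⟨u|`. -/
def kappa (ω : ℂ) : ℂ := ∫ k : ℝ, (M.weight k : ℂ) / (ω - (M.ε k : ℂ))

theorem K_eq (ω : ℂ) : M.K ω = M.kappa ω • Matrix.vecMulVec M.u (star M.u) := by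
  ext i j
  rw [K, Matrix.of_apply, Matrix.smul_apply, Matrix.vecMulVec_apply, smul_eq_mul, kappa,
    mul_comm, ← integral_const_mul]
  congr 1
  funext k
  have h : (M.weight k : ℂ) = M.V k * star (M.V k) := by
    rw [weight, Complex.ofReal_pow, ← Complex.mul_conj', Complex.star_def]
  rw [h]
  simp only [v, Pi.smul_apply, smul_eq_mul, star_mul', Pi.star_apply]
  ring

theorem invG_eq (ω : ℂ) : M.invG ω = (ω • (1 : Matrix (Fin N) (Fin N) ℂ) - M.KR) -
    M.kappa ω • Matrix.vecMulVec M.u (star M.u) := by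
  rw [invG, K_eq]

/-- Characteristic polynomial of the emitters. -/
def polyA : Polynomial ℂ := M.KR.charpoly

/-- Determinant of the bordered characteristic matrix of the emitters. -/
def polyB : Polynomial ℂ := (borderedMatrix M.KR.charmatrix (fun i => Polynomial.C (M.u i))
  (fun i => Polynomial.C (star (M.u i)))).det

theorem eval_polyA (ω : ℂ) :
    M.polyA.eval ω = (ω • (1 : Matrix (Fin N) (Fin N) ℂ) - M.KR).det := by
  rw [polyA, Matrix.eval_charpoly, Matrix.smul_one_eq_diagonal]
  rfl

theorem map_eval_charmatrix (A : Matrix (Fin N) (Fin N) ℂ) (ω : ℂ) :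
    A.charmatrix.map (Polynomial.eval ω) = ω • (1 : Matrix (Fin N) (Fin N) ℂ) - A := by
  ext i j
  by_cases h : i = j
  · subst h; simp
  · simp [h]

theorem eval_polyB (ω : ℂ) : M.polyB.eval ω =
    (borderedMatrix (ω • (1 : Matrix (Fin N) (Fin N) ℂ) - M.KR) M.u (star M.u)).det := by
  have h1 := RingHom.map_det (Polynomial.evalRingHom ω) (borderedMatrix M.KR.charmatrix
    (fun i => Polynomial.C (M.u i)) (fun i => Polynomial.C (star (M.u i))))
  rw [Polynomial.coe_evalRingHom] at h1
  rw [polyB, h1, borderedMatrix, borderedMatrix]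
  congr 1
  rw [RingHom.mapMatrix_apply, Matrix.fromBlocks_map, Polynomial.coe_evalRingHom,
    map_eval_charmatrix]
  congr 1
  · ext i j; simp
  · ext i j; simp
  · ext i j; simp

/-- The characteristic function `det (ω - K^R - K(ω))`. -/
def charFun (ω : ℂ) : ℂ := (M.invG ω).det

theorem charFun_eq (ω : ℂ) :
    M.charFun ω = M.polyA.eval ω + M.kappa ω * M.polyB.eval ω := by
  rw [charFun, invG_eq, det_sub_smul_vecMulVec, ← eval_polyA, ← eval_polyB]

/-- The numerator of ⟨u|G|u⟩ is a bordered determinant, which is insensitive to the self-energy, so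
it is the polynomial `polyB` up to sign. -/
theorem T_eq {ω : ℂ} (h : M.charFun ω ≠ 0) (k k' : ℝ) :
    M.T ω k k' = star (M.V k') * M.V k * (-M.polyB.eval ω / M.charFun ω) := by
  have h1 := dotProduct_inv_mulVec_of_bordered (isUnit_iff_ne_zero.mpr h) M.u (star M.u)
  have h2 : (borderedMatrix (M.invG ω) M.u (star M.u)).det = M.polyB.eval ω := by
    rw [invG_eq, det_borderedMatrix_sub, ← eval_polyB]
  rw [h2] at h1
  have h3 : star M.u ⬝ᵥ ((M.invG ω)⁻¹ *ᵥ M.u) = -M.polyB.eval ω / M.charFun ω := by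
    rw [eq_div_iff h, ← h1, charFun, mul_comm]
  rw [T, G, v, v, star_smul, Matrix.mulVec_smul, smul_dotProduct, dotProduct_smul, h3,
    smul_eq_mul, smul_eq_mul, mul_assoc]

/-! ### The Cauchy integral in polar coordinates -/

/-- Scaled boundary values of `κ` from the upper half plane. -/
def scaledKappa (p : ℝ × ℝ) : ℂ :=
  cauchySigned M.m M.weight M.σ p.1 p.2 +
    cauchySigned M.m (fun k => M.weight (-k)) (M.σ * (-1) ^ M.m) p.1 p.2

/-- Values of `κ` on the closed upper half plane, at the energy `d s ^ m e^{iφ}`. -/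
def kappaPlus (p : ℝ × ℝ) : ℂ := (p.1 / (M.d * p.1 ^ M.m) : ℝ) * M.scaledKappa p

/-- The energy with polar coordinates `(s, φ)`. -/
def polarEnergy (p : ℝ × ℝ) : ℂ := (M.d * p.1 ^ M.m : ℝ) * Complex.exp (p.2 * Complex.I)

theorem m_ne_zero : M.m ≠ 0 := by have := M.two_le_m; omega

theorem m_pos : (0 : ℝ) < M.m := by exact_mod_cast Nat.pos_of_ne_zero M.m_ne_zero

theorem sign_mul_eq : M.σ * (-1) ^ M.m = 1 ∨ M.σ * (-1) ^ M.m = -1 := by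
  rcases M.σ_eq with h | h <;> rcases neg_one_pow_eq_or ℝ M.m with h' | h' <;> simp [h, h']

theorem mem_offContinuum_iff {ω : ℂ} (h0 : ω ≠ 0) :
    ω ∈ M.offContinuum ↔ ∀ k, ω ≠ (M.ε k : ℂ) := by
  constructor
  · intro h k hk
    refine h (M.ε k) ⟨?_, k, rfl⟩ hk
    intro h1
    rw [hk, h1] at h0
    exact h0 rfl
  · rintro h x ⟨hx, k, rfl⟩
    exact h k

theorem ε_neg (k : ℝ) : M.ε (-k) = M.σ * (-1) ^ M.m * M.d * k ^ M.m := by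
  rw [ε, neg_pow]; ring

theorem polarEnergy_ne_zero {p : ℝ × ℝ} (hp : 0 < p.1) : M.polarEnergy p ≠ 0 := by
  refine mul_ne_zero ?_ (Complex.exp_ne_zero _)
  have := M.d_pos
  exact_mod_cast (by positivity : M.d * p.1 ^ M.m ≠ 0)

variable {M}

/-- The map k ↦ -k folds the negative half line onto the positive one and changes the sign of the
dispersion to σ(-1)^m. On each half, k = sq gives a signed Cauchy integral. An energy off the
continuum at angle 0 or π differs from ε(±s), which rules out the excluded combinations of angle and
sign. -/
theorem RegularCoupling.kappa_polar (hM : M.RegularCoupling) {p : ℝ × ℝ} (hp : p ∈ polarStrip)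
    (hoff : M.polarEnergy p ∈ M.offContinuum) :
    Integrable (fun k : ℝ => (M.weight k : ℂ) / (M.polarEnergy p - (M.ε k : ℂ))) ∧
    M.kappa (M.polarEnergy p) = M.kappaPlus p := by
  obtain ⟨s, φ⟩ := p
  have hs : 0 < s := hp.1
  have hφ : φ ∈ Set.Icc 0 Real.pi := hp.2
  obtain ⟨A, e, α, h1⟩ := hM.pos
  obtain ⟨A', e', α', h2⟩ := hM.neg
  have hne := (M.mem_offContinuum_iff (M.polarEnergy_ne_zero (p := (s, φ)) hs)).mp hoff
  have hz0 : φ = 0 → M.polarEnergy (s, φ) = ((M.d * s ^ M.m : ℝ) : ℂ) := by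
    intro h; simp [polarEnergy, h]
  have hzπ : φ = Real.pi → M.polarEnergy (s, φ) = ((-(M.d * s ^ M.m) : ℝ) : ℂ) := by
    intro h; simp [polarEnergy, h]
  have a1 := h1.cauchySigned_eq (τ := M.σ) (d := M.d) M.σ_eq hs hφ
    (fun h hσ => hne s (by rw [hz0 h, ε, hσ, one_mul]))
    (fun h hσ => hne s (by rw [hzπ h, ε, hσ]; congr 1; ring))
  have a2 := h2.cauchySigned_eq (τ := M.σ * (-1) ^ M.m) (d := M.d) M.sign_mul_eq hs hφ
    (fun h hσ => hne (-s) (by rw [hz0 h, ε_neg, hσ, one_mul]))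
    (fun h hσ => hne (-s) (by rw [hzπ h, ε_neg, hσ]; congr 1; ring))
  set f : ℝ → ℂ := fun k => (M.weight k : ℂ) / (M.polarEnergy (s, φ) - (M.ε k : ℂ)) with hf
  have hneg : (fun k => f (-k)) = fun k : ℝ => ((M.weight (-k) : ℝ) : ℂ) /
      ((M.d * s ^ M.m : ℝ) * Complex.exp (φ * Complex.I) -
      ((M.σ * (-1) ^ M.m * M.d * k ^ M.m : ℝ) : ℂ)) := by
    funext k
    simp only [hf, ε_neg, polarEnergy]
  have hpos : f = fun k : ℝ => ((M.weight k : ℝ) : ℂ) /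
      ((M.d * s ^ M.m : ℝ) * Complex.exp (φ * Complex.I) - ((M.σ * M.d * k ^ M.m : ℝ) : ℂ)) := rfl
  have i1 : IntegrableOn f (Set.Ioi 0) := a1.1
  have i2 : IntegrableOn f (Set.Iic 0) := by
    rw [integrableOn_Iic_iff_integrableOn_Iio, 
      ← (Measure.measurePreserving_neg volume).integrableOn_comp_preimage
        (MeasurableEquiv.neg ℝ).measurableEmbedding]
    have : (Neg.neg : ℝ → ℝ) ⁻¹' Set.Iio 0 = Set.Ioi 0 := by ext x; simp
    rw [this, Function.comp_def, hneg]
    exact a2.1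
  have hint : Integrable f := by
    rw [← integrableOn_univ, ← Set.Iic_union_Ioi (a := (0 : ℝ))]
    exact i2.union i1
  refine ⟨hint, ?_⟩
  have hv2 : ∫ k in Set.Iic (0 : ℝ), f k = (s / (M.d * s ^ M.m) : ℝ) *
      cauchySigned M.m (fun k => M.weight (-k)) (M.σ * (-1) ^ M.m) s φ := by
    rw [← a2.2, ← hneg, integral_comp_neg_Ioi, neg_zero]
  have hv1 : ∫ k in Set.Ioi (0 : ℝ), f k = (s / (M.d * s ^ M.m) : ℝ) *
      cauchySigned M.m M.weight M.σ s φ := a1.2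
  have : M.kappa (M.polarEnergy (s, φ)) = ∫ k, f k := rfl
  rw [this, ← intervalIntegral.integral_Iic_add_Ioi i2 i1, hv1, hv2, kappaPlus, scaledKappa]
  ring

theorem kappa_conj (ω : ℂ) : M.kappa ((starRingEnd ℂ) ω) = (starRingEnd ℂ) (M.kappa ω) := by
  rw [kappa, kappa, ← integral_conj]
  congr 1
  funext k
  simp

theorem RegularCoupling.continuousOn_scaledKappa (hM : M.RegularCoupling) :
    ContinuousOn M.scaledKappa (Set.Ici 0 ×ˢ Set.univ) := by
  obtain ⟨A, e, α, h1⟩ := hM.pos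
  obtain ⟨A', e', α', h2⟩ := hM.neg
  exact (h1.continuousOn_cauchySigned _).add (h2.continuousOn_cauchySigned _)

theorem RegularCoupling.continuousOn_kappaPlus (hM : M.RegularCoupling) :
    ContinuousOn M.kappaPlus polarStrip := by
  refine ContinuousOn.mul ?_ (hM.continuousOn_scaledKappa.mono
    (Set.prod_mono (fun x hx => Set.mem_Ici.mpr (le_of_lt hx)) (Set.subset_univ _)))
  refine Complex.continuous_ofReal.comp_continuousOn ?_
  refine ContinuousOn.div (by fun_prop) (by fun_prop) ?_
  intro p hp
  have hp0 : 0 < p.1 := hp.1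
  have := M.d_pos
  positivity

/-- The prefactor decays like s^(1-m), and the Cauchy integrals grow at most like (1 + s)^e with e <
m - 1. -/
theorem RegularCoupling.tendsto_kappaPlus_atTop (hM : M.RegularCoupling) :
    Tendsto M.kappaPlus (atTop ×ˢ 𝓟 (Set.Icc 0 Real.pi)) (𝓝 0) := by
  obtain ⟨A, e, α, h1⟩ := hM.pos
  obtain ⟨A', e', α', h2⟩ := hM.neg
  obtain ⟨C₁, hC₁⟩ := h1.norm_cauchySigned_le M.σ
  obtain ⟨C₂, hC₂⟩ := h2.norm_cauchySigned_le (M.σ * (-1) ^ M.m)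
  have hlim : ∀ e : ℝ, e < (M.m : ℝ) - 1 →
      Tendsto (fun s : ℝ => s / (M.d * s ^ M.m) * (1 + s) ^ e) atTop (𝓝 0) := by
    intro e he
    have hd := M.d_pos
    have t1 : Tendsto (fun s : ℝ => (1 / M.d) * (s ^ (-((M.m : ℝ) - 1 - e)) *
        ((1 + s) / s) ^ e)) atTop (𝓝 ((1 / M.d) * (0 * 1 ^ e))) := by
      refine Tendsto.const_mul _ (Tendsto.mul (tendsto_rpow_neg_atTop (by linarith)) ?_)
      refine Tendsto.rpow_const ?_ (Or.inl one_ne_zero)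
      have : Tendsto (fun s : ℝ => s⁻¹ + 1) atTop (𝓝 (0 + 1)) :=
        tendsto_inv_atTop_zero.add_const 1
      rw [zero_add] at this
      refine this.congr' ?_
      filter_upwards [eventually_gt_atTop 0] with s hs
      field_simp
    rw [zero_mul, mul_zero] at t1
    refine t1.congr' ?_
    filter_upwards [eventually_gt_atTop 0] with s hs
    rw [Real.div_rpow (by linarith) hs.le, neg_sub, Real.rpow_sub hs, Real.rpow_sub hs,
      Real.rpow_one, Real.rpow_natCast]
    have := Real.rpow_pos_of_pos hs e
    field_simp
  have hb : Tendsto (fun p : ℝ × ℝ => C₁ * (p.1 / (M.d * p.1 ^ M.m) * (1 + p.1) ^ e) +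
      C₂ * (p.1 / (M.d * p.1 ^ M.m) * (1 + p.1) ^ e')) (atTop ×ˢ 𝓟 (Set.Icc 0 Real.pi)) (𝓝 0) := by
    have := ((hlim e h1.e_lt).const_mul C₁).add ((hlim e' h2.e_lt).const_mul C₂)
    rw [mul_zero, mul_zero, add_zero] at this
    exact this.comp tendsto_fst
  rw [tendsto_zero_iff_norm_tendsto_zero]
  refine squeeze_zero' (Eventually.of_forall fun _ => norm_nonneg _) ?_ hb
  have hev : ∀ᶠ p : ℝ × ℝ in atTop ×ˢ 𝓟 (Set.Icc 0 Real.pi), 0 < p.1 ∧ p.2 ∈ Set.Icc 0 Real.pi :=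
    prod_mem_prod (eventually_gt_atTop 0) (mem_principal_self _)
  filter_upwards [hev] with p hp
  have hd := M.d_pos
  have hp1 := hp.1
  have hc : 0 ≤ p.1 / (M.d * p.1 ^ M.m) := by positivity
  rw [kappaPlus, norm_mul, Complex.norm_real, Real.norm_of_nonneg hc, scaledKappa]
  have := (norm_add_le (cauchySigned M.m M.weight M.σ p.1 p.2) (cauchySigned M.m
    (fun k => M.weight (-k)) (M.σ * (-1) ^ M.m) p.1 p.2)).trans
    (add_le_add (hC₁ _ _ hp.1.le hp.2) (hC₂ _ _ hp.1.le hp.2))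
  calc _ ≤ p.1 / (M.d * p.1 ^ M.m) * (C₁ * (1 + p.1) ^ e + C₂ * (1 + p.1) ^ e') :=
        mul_le_mul_of_nonneg_left this hc
    _ = _ := by ring

/-- A function jointly continuous up to the edge `s = 0` of the strip converges uniformly in the
angle. -/
theorem tendsto_sub_edge {L : ℝ × ℝ → ℂ} (hL : ContinuousOn L (Set.Ici 0 ×ˢ Set.univ)) :
    Tendsto (fun p : ℝ × ℝ => L p - L (0, p.2)) (𝓝[>] 0 ×ˢ 𝓟 (Set.Icc 0 Real.pi)) (𝓝 0) := by
  have hK : IsCompact (Set.Icc (0 : ℝ) 1 ×ˢ Set.Icc 0 Real.pi) := isCompact_Icc.prod isCompact_Icc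
  have huc : UniformContinuousOn L (Set.Icc (0 : ℝ) 1 ×ˢ Set.Icc 0 Real.pi) :=
    hK.uniformContinuousOn_of_continuous
      (hL.mono (Set.prod_mono (fun x hx => hx.1) (Set.subset_univ _)))
  rw [Metric.uniformContinuousOn_iff] at huc
  rw [Metric.tendsto_nhds]
  intro r hr
  obtain ⟨δ, hδ, hh⟩ := huc r hr
  have hev : ∀ᶠ p : ℝ × ℝ in 𝓝[>] 0 ×ˢ 𝓟 (Set.Icc 0 Real.pi),
      p.1 ∈ Set.Ioo 0 (min δ 1) ∧ p.2 ∈ Set.Icc 0 Real.pi :=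
    prod_mem_prod (Ioo_mem_nhdsGT (lt_min hδ one_pos)) (mem_principal_self _)
  filter_upwards [hev] with p hp
  have h1 := hh p ⟨⟨hp.1.1.le, (hp.1.2.trans_le (min_le_right _ _)).le⟩, hp.2⟩ (0, p.2)
    ⟨⟨le_rfl, zero_le_one⟩, hp.2⟩ ?_
  · rw [dist_zero_right, ← dist_eq_norm]
    exact h1
  · rw [Prod.dist_eq, dist_self, Real.dist_eq, sub_zero, abs_of_pos hp.1.1]
    exact max_lt (hp.1.2.trans_le (min_le_left _ _)) hδ

/-- Each half line contributes a positive multiple of -z or of 1, with z = e^{i(π - π/m)}. As m ≥ 2,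
z is not real, so the two contributions cannot cancel. -/
theorem RegularCoupling.scaledKappa_edge (hM : M.RegularCoupling) :
    ∃ c : ℂ, c ≠ 0 ∧ ∀ φ ∈ Set.Icc 0 Real.pi,
      M.scaledKappa (0, φ) = c * Complex.exp (((M.m : ℝ)⁻¹ - 1 : ℝ) * φ * Complex.I) := by
  obtain ⟨c, hc, h⟩ := cauchySigned_zero M.two_le_m
  set z := Complex.exp ((Real.pi - Real.pi / M.m : ℝ) * Complex.I) with hz
  set x : ℝ → ℂ := fun τ => if τ = 1 then -z else 1 with hx
  have hw0 : 0 < M.weight 0 := by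
    have := hM.ne_zero
    rw [weight]; positivity
  have hm2 : (2 : ℝ) ≤ M.m := by exact_mod_cast M.two_le_m
  have hzim : 0 < z.im := by
    rw [hz, Complex.exp_ofReal_mul_I_im]
    have hpi := Real.pi_pos
    have h1 : 0 < Real.pi / M.m := div_pos hpi M.m_pos
    have h2 : Real.pi / M.m < Real.pi := div_lt_self hpi (by linarith)
    exact Real.sin_pos_of_pos_of_lt_pi (by linarith) (by linarith)
  refine ⟨(M.weight 0 * c : ℝ) * (x M.σ + x (M.σ * (-1) ^ M.m)), ?_, ?_⟩
  · refine mul_ne_zero (by exact_mod_cast (mul_pos hw0 hc).ne') ?_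
    have hz0 : z ≠ 0 := Complex.exp_ne_zero _
    have hz1 : -z + 1 ≠ 0 := by
      intro h0
      have := congrArg Complex.im h0
      simp at this
      linarith
    simp only [hx]
    split_ifs
    · intro h0
      exact hz0 (by linear_combination (-1 / 2) * h0)
    · exact hz1
    · rwa [add_comm]
    · norm_num
  · intro φ hφ
    rw [scaledKappa, h _ _ φ hφ, h _ _ φ hφ, neg_zero]
    simp only [hx, hz]
    ring

end EmitterModel

end

/-! ### Boundary values on the cut and the determinant of the scattering matrix -/

noncomputable section

namespace EmitterModel

variable {N : ℕ} (M : EmitterModel N)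

/-- Polar coordinates `(s, φ)` of an energy. -/
def polarOf (ω : ℂ) : ℝ × ℝ := ((‖ω‖ / M.d) ^ ((M.m : ℝ)⁻¹), ω.arg)

theorem polarOf_fst_pos {ω : ℂ} (h : ω ≠ 0) : 0 < (M.polarOf ω).1 :=
  Real.rpow_pos_of_pos (div_pos (norm_pos_iff.mpr h) M.d_pos) _

theorem d_mul_polarOf_pow (ω : ℂ) : M.d * (M.polarOf ω).1 ^ M.m = ‖ω‖ := by
  rw [polarOf, Real.rpow_inv_natCast_pow (div_nonneg (norm_nonneg _) M.d_pos.le) M.m_ne_zero]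
  have := M.d_pos
  field_simp

theorem polarEnergy_polarOf (ω : ℂ) : M.polarEnergy (M.polarOf ω) = ω := by
  rw [polarEnergy, d_mul_polarOf_pow]
  exact Complex.norm_mul_exp_arg_mul_I ω

theorem polarOf_mem {ω : ℂ} (h : ω ≠ 0) (him : 0 ≤ ω.im) : M.polarOf ω ∈ polarStrip :=
  ⟨M.polarOf_fst_pos h, Complex.arg_nonneg_iff.mpr him, Complex.arg_le_pi ω⟩

/-- The argument is continuous from above even at the negative axis, so polar coordinates are
continuous on the punctured closed upper half plane. -/
theorem continuousWithinAt_polarOf {ω : ℂ} (h : ω ≠ 0) :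
    ContinuousWithinAt M.polarOf {z | 0 ≤ z.im} ω := by
  refine ContinuousWithinAt.prodMk ?_ ?_
  · refine ContinuousAt.continuousWithinAt ?_
    exact ContinuousAt.rpow_const (by fun_prop)
      (Or.inl (div_pos (norm_pos_iff.mpr h) M.d_pos).ne')
  · by_cases hs : ω ∈ Complex.slitPlane
    · exact (Complex.continuousAt_arg hs).continuousWithinAt
    · rw [Complex.mem_slitPlane_iff] at hs
      push Not at hs
      refine Complex.continuousWithinAt_arg_of_re_neg_of_im_zero (lt_of_le_of_ne hs.1 ?_) hs.2
      intro h0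
      exact h (Complex.ext h0 hs.2)

/-- The complement of the closed continuum. -/
def gap : Set ℂ := {ω | ∀ k, ω ≠ (M.ε k : ℂ)}

theorem mem_gap_iff {ω : ℂ} : ω ∈ M.gap ↔ ω ≠ 0 ∧ ω ∈ M.offContinuum := by
  constructor
  · intro h
    have h0 : ω ≠ 0 := by
      have := h 0
      rwa [ε, zero_pow M.m_ne_zero, mul_zero, Complex.ofReal_zero] at this
    exact ⟨h0, (M.mem_offContinuum_iff h0).mpr h⟩
  · rintro ⟨h0, h⟩
    exact (M.mem_offContinuum_iff h0).mp h

theorem mem_gap_of_im_ne_zero {ω : ℂ} (h : ω.im ≠ 0) : ω ∈ M.gap := by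
  intro k hk
  rw [hk, Complex.ofReal_im] at h
  exact h rfl

theorem conj_mem_gap {ω : ℂ} : (starRingEnd ℂ) ω ∈ M.gap ↔ ω ∈ M.gap := by
  have key : ∀ ω, ω ∈ M.gap → (starRingEnd ℂ) ω ∈ M.gap := by
    intro ω h k hk
    refine h k ?_
    rw [← Complex.conj_conj ω, hk, Complex.conj_ofReal]
  exact ⟨fun h => by simpa using key _ h, key ω⟩

theorem continuous_ε : Continuous M.ε := by unfold ε; fun_prop

theorem isClosed_range_ε : IsClosed (Set.range fun k : ℝ => (M.ε k : ℂ)) := by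
  have hcont : Continuous fun k : ℝ => (M.ε k : ℂ) :=
    Complex.continuous_ofReal.comp M.continuous_ε
  have htend : Tendsto (fun k : ℝ => (M.ε k : ℂ)) (cocompact ℝ) (cocompact ℂ) := by
    rw [← Metric.cobounded_eq_cocompact, ← Metric.cobounded_eq_cocompact,
      ← tendsto_norm_atTop_iff_cobounded]
    have h1 : ∀ k : ℝ, ‖(M.ε k : ℂ)‖ = M.d * ‖k‖ ^ M.m := by
      intro k
      rw [Complex.norm_real, ε, norm_mul, norm_mul, norm_pow, Real.norm_of_nonneg M.d_pos.le]
      rcases M.σ_eq with h | h <;> simp [h]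
    simp only [h1]
    exact Tendsto.const_mul_atTop M.d_pos
      ((tendsto_pow_atTop M.m_ne_zero).comp tendsto_norm_cobounded_atTop)
  exact (isProperMap_iff_tendsto_cocompact.mpr ⟨hcont, htend⟩).isClosedMap.isClosed_range

theorem isOpen_gap : IsOpen M.gap := by
  have : M.gap = (Set.range fun k : ℝ => (M.ε k : ℂ))ᶜ := by
    ext ω
    simp [gap, eq_comm]
  rw [this]
  exact M.isClosed_range_ε.isOpen_compl

theorem exists_gap_radius {ω : ℂ} (h : ω ∈ M.gap) :
    ∃ r, 0 < r ∧ ∀ k, r ≤ ‖ω - (M.ε k : ℂ)‖ := by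
  obtain ⟨r, hr, hball⟩ := Metric.isOpen_iff.mp M.isOpen_gap ω h
  refine ⟨r, hr, fun k => ?_⟩
  by_contra hlt
  push Not at hlt
  have : (M.ε k : ℂ) ∈ Metric.ball ω r := by
    rwa [Metric.mem_ball, dist_comm, dist_eq_norm]
  exact hball this k rfl

theorem charFun_conj_of (ω : ℂ) : M.charFun ((starRingEnd ℂ) ω) =
    M.polyA.eval ((starRingEnd ℂ) ω) + (starRingEnd ℂ) (M.kappa ω) *
      M.polyB.eval ((starRingEnd ℂ) ω) := by
  rw [charFun_eq, kappa_conj]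

/-- Boundary values of the characteristic function from the upper half plane. -/
def charPlus (p : ℝ × ℝ) : ℂ :=
  M.polyA.eval (M.polarEnergy p) + M.kappaPlus p * M.polyB.eval (M.polarEnergy p)

/-- Boundary values of the characteristic function from the lower half plane, at the complex
conjugate energy. -/
def charMinus (p : ℝ × ℝ) : ℂ :=
  M.polyA.eval ((starRingEnd ℂ) (M.polarEnergy p)) +
    (starRingEnd ℂ) (M.kappaPlus p) * M.polyB.eval ((starRingEnd ℂ) (M.polarEnergy p))

theorem continuous_polarEnergy : Continuous M.polarEnergy := by
  unfold polarEnergy; fun_prop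

variable {M}

namespace RegularCoupling

variable (hM : M.RegularCoupling)
include hM

theorem integrable_kernel {ω : ℂ} (h : ω ∈ M.gap) :
    Integrable (fun k : ℝ => (M.weight k : ℂ) / (ω - (M.ε k : ℂ))) := by
  have key : ∀ ω ∈ M.gap, 0 ≤ ω.im →
      Integrable (fun k : ℝ => (M.weight k : ℂ) / (ω - (M.ε k : ℂ))) := by
    intro ω hω him
    have h1 := M.mem_gap_iff.mp hω
    have := (hM.kappa_polar (M.polarOf_mem h1.1 him)
      (by rw [polarEnergy_polarOf]; exact h1.2)).1
    rwa [polarEnergy_polarOf] at this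
  rcases le_total 0 ω.im with him | him
  · exact key ω h him
  · have h1 := key _ (M.conj_mem_gap.mpr h) (by rw [Complex.conj_im]; linarith)
    have h2 := Complex.conjCLE.toContinuousLinearMap.integrable_comp h1
    refine h2.congr (Eventually.of_forall fun k => ?_)
    simp

theorem kappa_eq_kappaPlus {p : ℝ × ℝ} (hp : p ∈ polarStrip) (h : M.polarEnergy p ∈ M.gap) :
    M.kappa (M.polarEnergy p) = M.kappaPlus p :=
  (hM.kappa_polar hp (M.mem_gap_iff.mp h).2).2

theorem charFun_eq_charPlus {p : ℝ × ℝ} (hp : p ∈ polarStrip) (h : M.polarEnergy p ∈ M.gap) :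
    M.charFun (M.polarEnergy p) = M.charPlus p := by
  rw [charFun_eq, hM.kappa_eq_kappaPlus hp h, charPlus]

theorem charFun_eq_charMinus {p : ℝ × ℝ} (hp : p ∈ polarStrip) (h : M.polarEnergy p ∈ M.gap) :
    M.charFun ((starRingEnd ℂ) (M.polarEnergy p)) = M.charMinus p := by
  rw [charFun_conj_of, hM.kappa_eq_kappaPlus hp h, charMinus]

theorem tendsto_kappa {E : ℝ} (hE : E ≠ 0) :
    Tendsto (fun η : ℝ => M.kappa (E + η * Complex.I)) (𝓝[>] 0)
      (𝓝 (M.kappaPlus (M.polarOf E))) := by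
  have hE' : (E : ℂ) ≠ 0 := by exact_mod_cast hE
  have hmem : M.polarOf E ∈ polarStrip := M.polarOf_mem hE' (by simp)
  have hc : ContinuousWithinAt (fun ω => M.kappaPlus (M.polarOf ω)) ({z | 0 ≤ z.im} \ {0}) E := by
    refine ContinuousWithinAt.comp (t := polarStrip) (hM.continuousOn_kappaPlus _ hmem)
      ((M.continuousWithinAt_polarOf hE').mono Set.sdiff_subset) ?_
    intro ω hω
    exact M.polarOf_mem (by simpa using hω.2) hω.1
  have ht : Tendsto (fun η : ℝ => (E : ℂ) + η * Complex.I) (𝓝[>] 0)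
      (𝓝[{z | 0 ≤ z.im} \ {0}] (E : ℂ)) := by
    refine tendsto_nhdsWithin_iff.mpr ⟨?_, ?_⟩
    · have : Continuous fun η : ℝ => (E : ℂ) + η * Complex.I := by fun_prop
      have := this.tendsto 0
      simp only [Complex.ofReal_zero, zero_mul, add_zero] at this
      exact this.mono_left nhdsWithin_le_nhds
    · filter_upwards [self_mem_nhdsWithin] with η hη
      have hη' : (0 : ℝ) < η := hη
      have him : ((E : ℂ) + η * Complex.I).im = η := by simp
      refine ⟨by simp [hη'.le], ?_⟩
      intro h0
      rw [Set.mem_singleton_iff] at h0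
      rw [h0, Complex.zero_im] at him
      exact hη'.ne him
  refine (hc.tendsto.comp ht).congr' ?_
  filter_upwards [self_mem_nhdsWithin] with η hη
  have hη' : (0 : ℝ) < η := hη
  have him : ((E : ℂ) + η * Complex.I).im = η := by simp
  have hgap : (E : ℂ) + η * Complex.I ∈ M.gap :=
    M.mem_gap_of_im_ne_zero (by rw [him]; exact hη'.ne')
  have := hM.kappa_eq_kappaPlus (M.polarOf_mem (M.mem_gap_iff.mp hgap).1 (by rw [him]; exact hη'.le))
    (by rw [polarEnergy_polarOf]; exact hgap)
  rw [polarEnergy_polarOf] at this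
  exact this.symm

/-- For ω close to ω₀, compared with the distance of ω₀ to the spectrum, |ω - ε| is at least half of
|ω₀ - ε|. The derivative of the integrand is then dominated by a multiple of the integrable kernel
at ω₀. -/
theorem differentiableOn_kappa : DifferentiableOn ℂ M.kappa M.gap := by
  intro ω₀ hω₀
  obtain ⟨r, hr, hrk⟩ := M.exists_gap_radius hω₀
  have hlow : ∀ ω ∈ Metric.ball ω₀ (r / 2), ∀ k, ‖ω₀ - (M.ε k : ℂ)‖ / 2 ≤ ‖ω - (M.ε k : ℂ)‖ := by
    intro ω hω k
    have h1 := hrk k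
    have h2 : ‖ω₀ - (M.ε k : ℂ)‖ ≤ ‖ω - (M.ε k : ℂ)‖ + ‖ω₀ - ω‖ := by
      have := norm_add_le (ω - (M.ε k : ℂ)) (ω₀ - ω)
      rwa [show ω - (M.ε k : ℂ) + (ω₀ - ω) = ω₀ - (M.ε k : ℂ) by ring] at this
    have h3 : ‖ω₀ - ω‖ < r / 2 := by
      rw [← dist_eq_norm, dist_comm]; exact hω
    linarith
  have hsub : Metric.ball ω₀ (r / 2) ⊆ M.gap := by
    intro ω hω k hk
    have h1 := hlow ω hω k
    have h2 := hrk k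
    rw [hk, sub_self, norm_zero] at h1
    linarith
  have hmeas : AEStronglyMeasurable (fun k : ℝ => (M.weight k : ℂ)) volume := by
    refine Complex.continuous_ofReal.comp_aestronglyMeasurable ?_
    exact hM.meas.norm.pow 2
  have hεm : Measurable fun k : ℝ => (M.ε k : ℂ) :=
    (Complex.continuous_ofReal.comp M.continuous_ε).measurable
  have key := hasDerivAt_integral_of_dominated_loc_of_deriv_le (μ := volume)
    (F := fun (ω : ℂ) (k : ℝ) => (M.weight k : ℂ) / (ω - (M.ε k : ℂ)))
    (F' := fun (ω : ℂ) (k : ℝ) => (M.weight k : ℂ) * (-1 / (ω - (M.ε k : ℂ)) ^ 2)) (x₀ := ω₀)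
    (bound := fun k => (4 / r) * ‖(M.weight k : ℂ) / (ω₀ - (M.ε k : ℂ))‖)
    (Metric.ball_mem_nhds ω₀ (half_pos hr))
    (Eventually.of_forall fun ω => by
      simp only [div_eq_mul_inv]
      exact hmeas.mul (Measurable.aestronglyMeasurable (by fun_prop)))
    (hM.integrable_kernel hω₀)
    (hmeas.mul (Measurable.aestronglyMeasurable (by fun_prop)))
    (Eventually.of_forall fun k ω hω => by
      have h1 := hlow ω hω k
      have h2 := hrk k
      have h3 : 0 < ‖ω₀ - (M.ε k : ℂ)‖ := by linarith
      have h4 : r / 4 * ‖ω₀ - (M.ε k : ℂ)‖ ≤ ‖ω - (M.ε k : ℂ)‖ ^ 2 := by nlinarith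
      rw [norm_mul, norm_div, norm_neg, norm_one, norm_pow, norm_div]
      have h5 : 1 / ‖ω - (M.ε k : ℂ)‖ ^ 2 ≤ 1 / (r / 4 * ‖ω₀ - (M.ε k : ℂ)‖) :=
        one_div_le_one_div_of_le (by positivity) h4
      calc ‖(M.weight k : ℂ)‖ * (1 / ‖ω - (M.ε k : ℂ)‖ ^ 2)
          ≤ ‖(M.weight k : ℂ)‖ * (1 / (r / 4 * ‖ω₀ - (M.ε k : ℂ)‖)) :=
            mul_le_mul_of_nonneg_left h5 (norm_nonneg _)
        _ = _ := by field_simp)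
    ((hM.integrable_kernel hω₀).norm.const_mul _)
    (Eventually.of_forall fun k ω hω => by
      have hne : ω - (M.ε k : ℂ) ≠ 0 := sub_ne_zero.mpr (hsub hω k)
      have h1 := (((hasDerivAt_id ω).sub_const (M.ε k : ℂ)).inv hne).const_mul (M.weight k : ℂ)
      exact h1)
  exact key.2.differentiableAt.differentiableWithinAt

theorem differentiableOn_charFun : DifferentiableOn ℂ M.charFun M.gap := by
  have : M.charFun = fun ω => M.polyA.eval ω + M.kappa ω * M.polyB.eval ω := by
    funext ω; exact M.charFun_eq ω
  rw [this]
  exact M.polyA.differentiable.differentiableOn.add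
    (hM.differentiableOn_kappa.mul M.polyB.differentiable.differentiableOn)

theorem continuousOn_charPlus : ContinuousOn M.charPlus polarStrip := by
  have h := M.continuous_polarEnergy
  exact (M.polyA.continuous.comp h).continuousOn.add
    (hM.continuousOn_kappaPlus.mul (M.polyB.continuous.comp h).continuousOn)

theorem continuousOn_charMinus : ContinuousOn M.charMinus polarStrip := by
  have h := Complex.continuous_conj.comp M.continuous_polarEnergy
  exact (M.polyA.continuous.comp h).continuousOn.add
    ((Complex.continuous_conj.comp_continuousOn hM.continuousOn_kappaPlus).mul
      (M.polyB.continuous.comp h).continuousOn)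

/-! ### Boundary values -/

theorem tendsto_charFun {E : ℝ} (hE : E ≠ 0) :
    Tendsto (fun η : ℝ => M.charFun (E + η * Complex.I)) (𝓝[>] 0)
      (𝓝 (M.charPlus (M.polarOf E))) := by
  have hc : Continuous fun η : ℝ => (E : ℂ) + η * Complex.I := by fun_prop
  have hl : Tendsto (fun η : ℝ => (E : ℂ) + η * Complex.I) (𝓝[>] 0) (𝓝 (E : ℂ)) := by
    have := hc.tendsto 0
    simp only [Complex.ofReal_zero, zero_mul, add_zero] at this
    exact this.mono_left nhdsWithin_le_nhds
  simp only [charFun_eq, charPlus, polarEnergy_polarOf]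
  exact ((M.polyA.continuous.tendsto _).comp hl).add
    ((hM.tendsto_kappa hE).mul ((M.polyB.continuous.tendsto _).comp hl))

/-- If the limiting determinant vanishes, the limiting matrix has a null vector. Since κ converges
at E + i0, that vector is a bound state in the continuum. -/
theorem charPlus_ne_zero_of_no_bic {E : ℝ} (hE : E ∈ M.continuum)
    (h : ¬ M.IsBoundStateInContinuum E) : M.charPlus (M.polarOf E) ≠ 0 := by
  intro h0
  apply h
  refine ⟨hE, ?_⟩
  set B : Matrix (Fin N) (Fin N) ℂ := ((E : ℂ) • (1 : Matrix (Fin N) (Fin N) ℂ) - M.KR) -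
    M.kappaPlus (M.polarOf E) • Matrix.vecMulVec M.u (star M.u) with hB
  have hdet : B.det = 0 := by
    rw [hB, det_sub_smul_vecMulVec, ← eval_polyA, ← eval_polyB, ← h0, charPlus,
      polarEnergy_polarOf]
  obtain ⟨e, he, hBe⟩ := Matrix.exists_mulVec_eq_zero_iff.mpr hdet
  refine ⟨e, he, ?_⟩
  have hl : Tendsto (fun η : ℝ => (E : ℂ) + η * Complex.I) (𝓝[>] 0) (𝓝 (E : ℂ)) := by
    have hc : Continuous fun η : ℝ => (E : ℂ) + η * Complex.I := by fun_prop
    have := hc.tendsto 0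
    simp only [Complex.ofReal_zero, zero_mul, add_zero] at this
    exact this.mono_left nhdsWithin_le_nhds
  have h1 : ∀ ω : ℂ, M.invG ω *ᵥ e = ω • e - M.KR *ᵥ e -
      M.kappa ω • (Matrix.vecMulVec M.u (star M.u) *ᵥ e) := by
    intro ω
    rw [invG_eq, Matrix.sub_mulVec, Matrix.sub_mulVec, Matrix.smul_mulVec, Matrix.smul_mulVec,
      Matrix.one_mulVec]
  have h2 : B *ᵥ e = (E : ℂ) • e - M.KR *ᵥ e -
      M.kappaPlus (M.polarOf E) • (Matrix.vecMulVec M.u (star M.u) *ᵥ e) := by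
    rw [hB, Matrix.sub_mulVec, Matrix.sub_mulVec, Matrix.smul_mulVec, Matrix.smul_mulVec,
      Matrix.one_mulVec]
  rw [← hBe, h2]
  simp only [h1]
  exact ((hl.smul_const e).sub tendsto_const_nhds).sub ((hM.tendsto_kappa hE.1).smul_const _)

theorem tendsto_T {E : ℝ} (hE : E ≠ 0) (h : M.charPlus (M.polarOf E) ≠ 0) (k k' : ℝ) :
    Tendsto (fun η : ℝ => M.T (E + η * Complex.I) k k') (𝓝[>] 0)
      (𝓝 (star (M.V k') * M.V k * (-M.polyB.eval (E : ℂ) / M.charPlus (M.polarOf E)))) := by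
  have hl : Tendsto (fun η : ℝ => (E : ℂ) + η * Complex.I) (𝓝[>] 0) (𝓝 (E : ℂ)) := by
    have hc : Continuous fun η : ℝ => (E : ℂ) + η * Complex.I := by fun_prop
    have := hc.tendsto 0
    simp only [Complex.ofReal_zero, zero_mul, add_zero] at this
    exact this.mono_left nhdsWithin_le_nhds
  have h1 := hM.tendsto_charFun hE
  have h2 := ((((M.polyB.continuous.tendsto _).comp hl).neg).div h1 h).const_mul
    (star (M.V k') * M.V k)
  refine h2.congr' ?_
  filter_upwards [h1.eventually_ne h] with η hη
  rw [M.T_eq hη]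
  rfl

theorem TPlus_eq {E : ℝ} (hE : E ≠ 0) (h : M.charPlus (M.polarOf E) ≠ 0) (k k' : ℝ) :
    M.TPlus E k k' = star (M.V k') * M.V k *
      (-M.polyB.eval (E : ℂ) / M.charPlus (M.polarOf E)) :=
  (hM.tendsto_T hE h k k').limUnder_eq

end RegularCoupling

variable (M)

theorem abs_deriv_ε (k : ℝ) : |deriv M.ε k| = M.d * M.m * |k| ^ (M.m - 1) := by
  have h : deriv M.ε k = M.σ * M.d * (M.m * k ^ (M.m - 1)) := by
    have : M.ε = fun k => M.σ * M.d * k ^ M.m := rfl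
    rw [this, deriv_const_mul _ (by fun_prop), deriv_pow_field]
  have hm : |(M.m : ℝ)| = M.m := abs_of_nonneg (Nat.cast_nonneg _)
  rw [h, abs_mul, abs_mul, abs_mul, abs_of_pos M.d_pos, abs_pow, hm]
  rcases M.σ_eq with h | h <;> simp [h] <;> ring

theorem mem_momenta {E k : ℝ} : k ∈ M.momenta E ↔ M.ε k = E := by
  simp [momenta]

/-- The Plemelj formula. The on-shell momenta are among ±s; each half line whose dispersion has the
sign of `E` contributes one of them, and it also contributes the jump -πw/m to the scaled
self-energy. -/
theorem sum_momenta {E : ℝ} (hE : E ≠ 0) :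
    ∑ k ∈ M.momenta E, M.weight k / |deriv M.ε k| =
      -(1 / Real.pi) * (M.kappaPlus (M.polarOf E)).im := by
  have hE' : (E : ℂ) ≠ 0 := by exact_mod_cast hE
  set s := (M.polarOf E).1 with hs
  have hs0 : 0 < s := M.polarOf_fst_pos hE'
  have hd := M.d_pos
  have hsm : M.d * s ^ M.m = |E| := by
    rw [hs, d_mul_polarOf_pow, Complex.norm_real, Real.norm_eq_abs]
  have hsub : M.momenta E ⊆ {s, -s} := by
    intro k hk
    rw [mem_momenta] at hk
    have h1 : M.d * |k| ^ M.m = M.d * s ^ M.m := by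
      rw [hsm, ← hk, ε, abs_mul, abs_mul, abs_of_pos hd, abs_pow]
      rcases M.σ_eq with h | h <;> simp [h]
    have h2 : |k| = s :=
      (pow_left_inj₀ (abs_nonneg k) hs0.le M.m_ne_zero).mp (mul_left_cancel₀ hd.ne' h1)
    rcases abs_choice k with h | h
    · simp [← h2, h]
    · have : k = -s := by rw [← h2, h]; ring
      simp [this]
  have hfilter : M.momenta E = ({s, -s} : Finset ℝ).filter fun k => M.ε k = E := by
    ext k
    rw [Finset.mem_filter, mem_momenta]
    exact ⟨fun h => ⟨hsub (M.mem_momenta.mpr h), h⟩, fun h => h.2⟩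
  have hne : s ≠ -s := by linarith
  rw [hfilter, Finset.sum_filter, Finset.sum_pair hne, abs_deriv_ε, abs_deriv_ε, abs_neg,
    abs_of_pos hs0]
  have hpow : s ^ M.m = s ^ (M.m - 1) * s := by
    rw [← pow_succ]; congr 1; have := M.m_ne_zero; omega
  have him : (M.kappaPlus (M.polarOf E)).im = s / (M.d * s ^ M.m) *
      ((cauchySigned M.m M.weight M.σ s (M.polarOf E).2).im +
      (cauchySigned M.m (fun k => M.weight (-k)) (M.σ * (-1) ^ M.m) s (M.polarOf E).2).im) := by
    rw [kappaPlus, Complex.im_ofReal_mul, scaledKappa, Complex.add_im]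
  have hπ := Real.pi_ne_zero
  have hm := M.m_pos
  have hs1 : 0 < s ^ (M.m - 1) := by positivity
  rcases lt_or_gt_of_ne hE with hneg | hpos
  · have harg : (M.polarOf E).2 = Real.pi := Complex.arg_ofReal_of_neg hneg
    have e1 : M.ε s = E ↔ ¬ M.σ = 1 := by
      rw [ε, mul_assoc, hsm, abs_of_neg hneg]
      rcases M.σ_eq with h | h <;> simp [h]
      · intro h'; linarith
      · norm_num
    have e2 : M.ε (-s) = E ↔ ¬ M.σ * (-1) ^ M.m = 1 := by
      rw [ε_neg, mul_assoc (M.σ * (-1) ^ M.m), hsm, abs_of_neg hneg]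
      rcases M.sign_mul_eq with h | h <;> simp [h]
      · intro h'; linarith
      · norm_num
    rw [him, harg, im_cauchySigned_pi, im_cauchySigned_pi]
    simp only [e1, e2, hpow, ite_not]
    clear_value s
    split_ifs <;> field_simp <;> ring
  · have harg : (M.polarOf E).2 = 0 := Complex.arg_ofReal_of_nonneg hpos.le
    have e1 : M.ε s = E ↔ M.σ = 1 := by
      rw [ε, mul_assoc, hsm, abs_of_pos hpos]
      rcases M.σ_eq with h | h <;> simp [h]
      · norm_num
        intro h'; linarith
    have e2 : M.ε (-s) = E ↔ M.σ * (-1) ^ M.m = 1 := by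
      rw [ε_neg, mul_assoc (M.σ * (-1) ^ M.m), hsm, abs_of_pos hpos]
      rcases M.sign_mul_eq with h | h <;> simp [h]
      · norm_num
        intro h'; linarith
    rw [him, harg, im_cauchySigned_zero, im_cauchySigned_zero]
    simp only [e1, e2, hpow]
    clear_value s
    split_ifs <;> field_simp <;> ring

variable {M}

/-- `S` is the identity plus a rank-one matrix, so its determinant is a scalar expression in κ. By
the Plemelj formula the numerator becomes A + (κ - 2i Im κ)B = A + κ̄B, the boundary value of the
characteristic function from below. -/
theorem RegularCoupling.detS_eq (hM : M.RegularCoupling) {E : ℝ} (hE : E ≠ 0)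
    (h : M.charPlus (M.polarOf E) ≠ 0) :
    M.detS E = M.charMinus (M.polarOf E) / M.charPlus (M.polarOf E) := by
  set g : ℂ := -M.polyB.eval (E : ℂ) / M.charPlus (M.polarOf E) with hg
  set x : M.momenta E → ℂ := fun α => -(2 * Real.pi * Complex.I) * g * M.V α /
    (Real.sqrt |deriv M.ε α| : ℂ) with hx
  set y : M.momenta E → ℂ := fun β => star (M.V β) / (Real.sqrt |deriv M.ε β| : ℂ) with hy
  have hS : M.S E = 1 + Matrix.replicateCol Unit x * Matrix.replicateRow Unit y := by
    ext α β
    rw [S, Matrix.of_apply, Matrix.add_apply, Matrix.one_apply, Matrix.mul_apply]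
    simp only [Finset.univ_unique, Finset.sum_singleton, Matrix.replicateCol_apply,
      Matrix.replicateRow_apply, hx, hy]
    rw [hM.TPlus_eq hE h, ← hg, abs_mul, Real.sqrt_mul (abs_nonneg _), Complex.ofReal_mul]
    ring
  have hsum : y ⬝ᵥ x = -(2 * Real.pi * Complex.I) * g *
      ((∑ k ∈ M.momenta E, M.weight k / |deriv M.ε k| : ℝ) : ℂ) := by
    rw [dotProduct, ← Finset.sum_coe_sort (M.momenta E)
      (fun k => M.weight k / |deriv M.ε k|), Complex.ofReal_sum, Finset.mul_sum]
    refine Finset.sum_congr rfl fun α _ => ?_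
    have h1 : (M.weight α : ℂ) = star (M.V α) * M.V α := by
      rw [weight, Complex.ofReal_pow, ← Complex.conj_mul', Complex.star_def]
    have h2 : ((|deriv M.ε α| : ℝ) : ℂ) = (Real.sqrt |deriv M.ε α| : ℂ) *
        (Real.sqrt |deriv M.ε α| : ℂ) := by
      rw [← Complex.ofReal_mul, Real.mul_self_sqrt (abs_nonneg _)]
    rw [Complex.ofReal_div, h1, h2, hx, hy]
    simp only
    ring
  rw [detS, hS, Matrix.det_one_add_replicateCol_mul_replicateRow, hsum, M.sum_momenta hE, hg]
  have hconj : (starRingEnd ℂ) (M.kappaPlus (M.polarOf E)) = M.kappaPlus (M.polarOf E) -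
      2 * Complex.I * ((M.kappaPlus (M.polarOf E)).im : ℂ) := by
    apply Complex.ext <;> simp
    ring
  have hπ : (Real.pi : ℂ) ≠ 0 := by exact_mod_cast Real.pi_ne_zero
  rw [eq_div_iff h, charMinus, polarEnergy_polarOf, Complex.conj_ofReal, hconj]
  have hplus : M.charPlus (M.polarOf E) = M.polyA.eval (E : ℂ) +
      M.kappaPlus (M.polarOf E) * M.polyB.eval (E : ℂ) := by
    rw [charPlus, polarEnergy_polarOf]
  rw [add_mul, one_mul]
  have : -(2 * (Real.pi : ℂ) * Complex.I) * (-M.polyB.eval (E : ℂ) / M.charPlus (M.polarOf E)) *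
      ((-(1 / Real.pi) * (M.kappaPlus (M.polarOf E)).im : ℝ) : ℂ) * M.charPlus (M.polarOf E) =
      -(2 * Complex.I * ((M.kappaPlus (M.polarOf E)).im : ℂ)) * M.polyB.eval (E : ℂ) := by
    push_cast
    field_simp
  rw [this, hplus]
  ring

end EmitterModel

end

/-! ### Jordan chains of the Hamiltonian off the closed continuum -/

noncomputable section

namespace EmitterModel

variable {N : ℕ} (M : EmitterModel N)

/-- Photon wave functions `-V^* / (ε - E) ^ (j + 1)` from which generalized eigenstates are
built. -/
def photonMode (E : ℂ) (j : ℕ) (k : ℝ) : ℂ := -star (M.V k) / ((M.ε k : ℂ) - E) ^ (j + 1)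

/-- Taylor coefficients of `κ` at `E`. -/
def kappaCoeff (E : ℂ) (j : ℕ) : ℂ := ∫ k : ℝ, M.V k * M.photonMode E j k

variable {M}

theorem V_mul_photonMode (E : ℂ) (j : ℕ) (k : ℝ) : M.V k * M.photonMode E j k =
    (-1) ^ j * ((M.weight k : ℂ) / (E - (M.ε k : ℂ)) ^ (j + 1)) := by
  have h1 : (M.weight k : ℂ) = M.V k * star (M.V k) := by
    rw [weight, Complex.ofReal_pow, ← Complex.mul_conj', Complex.star_def]
  have h2 : ((M.ε k : ℂ) - E) ^ (j + 1) = (-1) ^ (j + 1) * (E - (M.ε k : ℂ)) ^ (j + 1) := by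
    rw [← mul_pow]; congr 1; ring
  rw [photonMode, h1, h2, pow_succ (-1 : ℂ) j]
  generalize (E - (M.ε k : ℂ)) ^ (j + 1) = x
  rcases neg_one_pow_eq_or ℂ j with h | h <;> rw [h]
  · rw [one_mul, one_mul, neg_one_mul, div_neg, neg_div, neg_neg, mul_div_assoc]
  · rw [neg_one_mul, neg_neg, one_mul, neg_one_mul, neg_div, mul_neg, mul_div_assoc]

theorem sub_mul_photonMode_zero {E : ℂ} (hE : E ∈ M.gap) (k : ℝ) :
    ((M.ε k : ℂ) - E) * M.photonMode E 0 k = -star (M.V k) := by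
  have : (M.ε k : ℂ) - E ≠ 0 := sub_ne_zero.mpr (hE k).symm
  rw [photonMode, zero_add, pow_one]
  field_simp

theorem sub_mul_photonMode_succ {E : ℂ} (hE : E ∈ M.gap) (j : ℕ) (k : ℝ) :
    ((M.ε k : ℂ) - E) * M.photonMode E (j + 1) k = M.photonMode E j k := by
  have : (M.ε k : ℂ) - E ≠ 0 := sub_ne_zero.mpr (hE k).symm
  rw [photonMode, photonMode, pow_succ _ (j + 1)]
  field_simp

namespace RegularCoupling

variable (hM : M.RegularCoupling)
include hM

theorem aestronglyMeasurable_photonMode (E : ℂ) (j : ℕ) :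
    AEStronglyMeasurable (M.photonMode E j) volume := by
  have hεm : Measurable fun k : ℝ => (M.ε k : ℂ) :=
    (Complex.continuous_ofReal.comp M.continuous_ε).measurable
  unfold photonMode
  simp only [div_eq_mul_inv]
  exact (continuous_star.comp_aestronglyMeasurable hM.meas).neg.mul
    (Measurable.aestronglyMeasurable (by fun_prop))

/-- Since |ε - E| is bounded below, all but one factor of the denominator can be discarded, which
leaves the integrable kernel of κ. -/
theorem memLp_photonMode {E : ℂ} (hE : E ∈ M.gap) (j : ℕ) : MemLp (M.photonMode E j) 2 := by
  obtain ⟨r, hr, hrk⟩ := M.exists_gap_radius hE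
  rw [memLp_two_iff_integrable_sq_norm (hM.aestronglyMeasurable_photonMode E j)]
  refine ((hM.integrable_kernel hE).norm.const_mul (1 / r ^ (2 * j + 1))).mono'
    ((hM.aestronglyMeasurable_photonMode E j).norm.pow 2) (Eventually.of_forall fun k => ?_)
  have h1 := hrk k
  have h2 : 0 < ‖E - (M.ε k : ℂ)‖ := by linarith
  rw [norm_pow, norm_norm, photonMode, norm_div, norm_neg, norm_star, norm_pow, norm_sub_rev,
    norm_div, Complex.norm_real, weight, norm_pow, norm_norm, div_pow, ← pow_mul]
  have h3 : r ^ (2 * j + 1) ≤ ‖E - (M.ε k : ℂ)‖ ^ (2 * j + 1) := pow_le_pow_left₀ hr.le h1 _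
  have h4 : ‖E - (M.ε k : ℂ)‖ ^ ((j + 1) * 2) =
      ‖E - (M.ε k : ℂ)‖ ^ (2 * j + 1) * ‖E - (M.ε k : ℂ)‖ := by ring
  rw [h4, div_mul_div_comm, one_mul]
  exact div_le_div_of_nonneg_left (by positivity) (by positivity)
    (mul_le_mul_of_nonneg_right h3 h2.le)

theorem integrable_V_mul_photonMode {E : ℂ} (hE : E ∈ M.gap) (j : ℕ) :
    Integrable (fun k => M.V k * M.photonMode E j k) := by
  obtain ⟨r, hr, hrk⟩ := M.exists_gap_radius hE
  refine ((hM.integrable_kernel hE).norm.const_mul (1 / r ^ j)).mono'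
    (hM.meas.mul (hM.aestronglyMeasurable_photonMode E j)) (Eventually.of_forall fun k => ?_)
  have h1 := hrk k
  have h2 : 0 < ‖E - (M.ε k : ℂ)‖ := by linarith
  rw [V_mul_photonMode, norm_mul, norm_pow, norm_neg, norm_one, one_pow, one_mul, norm_div,
    norm_div, norm_pow, pow_succ, div_mul_div_comm, one_mul]
  exact div_le_div_of_nonneg_left (norm_nonneg _) (by positivity)
    (mul_le_mul_of_nonneg_right (pow_le_pow_left₀ hr.le h1 j) h2.le)

/-- A finite geometric series: the integrand of the remainder is w(-t)^n / ((E - ε)^n (E + t - ε)),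
with both denominators controlled by the distance to the spectrum. -/
theorem kappa_taylor {E : ℂ} (hE : E ∈ M.gap) (n : ℕ) :
    ∃ C, ∀ᶠ t : ℂ in 𝓝 0, ‖M.kappa (E + t) - ∑ j ∈ Finset.range n, M.kappaCoeff E j * t ^ j‖ ≤
      C * ‖t‖ ^ n := by
  obtain ⟨r, hr, hrk⟩ := M.exists_gap_radius hE
  refine ⟨∫ k : ℝ, (2 / r ^ n) * ‖(M.weight k : ℂ) / (E - (M.ε k : ℂ))‖, ?_⟩
  filter_upwards [Metric.ball_mem_nhds (0 : ℂ) (half_pos hr)] with t ht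
  rw [Metric.mem_ball, dist_zero_right] at ht
  have hlow : ∀ k, ‖E - (M.ε k : ℂ)‖ / 2 ≤ ‖E + t - (M.ε k : ℂ)‖ := by
    intro k
    have h1 := hrk k
    have h2 := norm_sub_norm_le (E - (M.ε k : ℂ)) (-t)
    rw [norm_neg, show E - (M.ε k : ℂ) - -t = E + t - (M.ε k : ℂ) by ring] at h2
    linarith
  have hgap : E + t ∈ M.gap := by
    intro k hk
    have h1 := hlow k
    have h2 := hrk k
    rw [hk, sub_self, norm_zero] at h1
    linarith
  have hint : ∀ j ∈ Finset.range n, Integrable fun k => M.V k * M.photonMode E j k * t ^ j :=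
    fun j _ => (hM.integrable_V_mul_photonMode hE j).mul_const _
  have e1 : ∑ j ∈ Finset.range n, M.kappaCoeff E j * t ^ j =
      ∫ k : ℝ, ∑ j ∈ Finset.range n, M.V k * M.photonMode E j k * t ^ j := by
    rw [integral_finsetSum _ hint]
    refine Finset.sum_congr rfl fun j _ => ?_
    rw [integral_mul_const, kappaCoeff]
  rw [e1, kappa, ← integral_sub (hM.integrable_kernel hgap) (integrable_finsetSum _ hint)]
  rw [← integral_mul_const]
  refine norm_integral_le_of_norm_le (((hM.integrable_kernel hE).norm.const_mul _).mul_const _)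
    (Eventually.of_forall fun k => ?_)
  have ha : E - (M.ε k : ℂ) ≠ 0 := sub_ne_zero.mpr (hE k)
  have hat : E + t - (M.ε k : ℂ) ≠ 0 := sub_ne_zero.mpr (hgap k)
  have hid : ∀ n : ℕ, (M.weight k : ℂ) / (E + t - (M.ε k : ℂ)) -
      ∑ j ∈ Finset.range n, M.V k * M.photonMode E j k * t ^ j =
      (M.weight k : ℂ) / (E - (M.ε k : ℂ)) ^ n * ((-t) ^ n / (E + t - (M.ε k : ℂ))) := by
    intro n
    induction n with
    | zero => simp; ring
    | succ n ih =>
      rw [Finset.sum_range_succ, ← sub_sub, ih, V_mul_photonMode, neg_pow t n, neg_pow t (n + 1)]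
      rw [pow_succ (-1 : ℂ), pow_succ t, pow_succ (E - (M.ε k : ℂ))]
      field_simp
      ring
  rw [hid n, norm_mul, norm_div, norm_div, norm_div, norm_pow, norm_pow, norm_neg]
  have h1 := hrk k
  have h2 : 0 < ‖E - (M.ε k : ℂ)‖ := by linarith
  have h3 := hlow k
  have h4 : ‖t‖ ^ n / ‖E + t - (M.ε k : ℂ)‖ ≤ ‖t‖ ^ n / (‖E - (M.ε k : ℂ)‖ / 2) :=
    div_le_div_of_nonneg_left (by positivity) (by positivity) h3
  have h5 : ‖(M.weight k : ℂ)‖ / ‖E - (M.ε k : ℂ)‖ ^ n ≤ ‖(M.weight k : ℂ)‖ / r ^ n :=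
    div_le_div_of_nonneg_left (norm_nonneg _) (by positivity) (pow_le_pow_left₀ hr.le h1 n)
  calc _ ≤ ‖(M.weight k : ℂ)‖ / r ^ n * (‖t‖ ^ n / (‖E - (M.ε k : ℂ)‖ / 2)) :=
        mul_le_mul h5 h4 (by positivity) (by positivity)
    _ = _ := by field_simp

/-- The photon modes as normalizable states. -/
def photonModeLp {E : ℂ} (hE : E ∈ M.gap) (j : ℕ) : Lp ℂ 2 (volume : Measure ℝ) :=
  (hM.memLp_photonMode hE j).toLp

theorem coeFn_sum_photonModeLp {E : ℂ} (hE : E ∈ M.gap) (n : ℕ) (a : ℕ → ℂ) :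
    (∑ j ∈ Finset.range n, a j • hM.photonModeLp hE j : Lp ℂ 2 (volume : Measure ℝ)) =ᵐ[volume]
      fun k => ∑ j ∈ Finset.range n, a j * M.photonMode E j k := by
  induction n with
  | zero =>
    simp only [Finset.range_zero, Finset.sum_empty]
    exact Lp.coeFn_zero _ _ _
  | succ n ih =>
    rw [Finset.sum_range_succ]
    filter_upwards [Lp.coeFn_add (∑ j ∈ Finset.range n, a j • hM.photonModeLp hE j)
      (a n • hM.photonModeLp hE n), ih, Lp.coeFn_smul (a n) (hM.photonModeLp hE n),
      (hM.memLp_photonMode hE n).coeFn_toLp] with k h1 h2 h3 h4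
    rw [h1, Pi.add_apply, h2, h3, Pi.smul_apply, smul_eq_mul, Finset.sum_range_succ]
    congr 2

/-- Off the closed continuum the photon equation can be divided by ε - E. This raises the index of
every mode of the right-hand side by one and adds mode 0 with amplitude ⟨u|e⟩, so only an equation
for the emitters is left. -/
theorem mem_hamiltonian_iff {E : ℂ} (hE : E ∈ M.gap) (n : ℕ) (ψ : Lp ℂ 2 (volume : Measure ℝ))
    (e g : Fin N → ℂ) (a : ℕ → ℂ) (ha : a 0 = star M.u ⬝ᵥ e) :
    ((ψ, e), E • (ψ, e) + (∑ j ∈ Finset.range n, a (j + 1) • hM.photonModeLp hE j, g)) ∈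
        M.hamiltonian ↔
      ψ = ∑ j ∈ Finset.range (n + 1), a j • hM.photonModeLp hE j ∧
      g = M.KR *ᵥ e - E • e + (∑ j ∈ Finset.range (n + 1), M.kappaCoeff E j * a j) • M.u := by
  set Φ : Lp ℂ 2 (volume : Measure ℝ) := ∑ j ∈ Finset.range n, a (j + 1) • hM.photonModeLp hE j
    with hΦ
  have hΦc := hM.coeFn_sum_photonModeLp hE n (fun j => a (j + 1))
  have hψc := hM.coeFn_sum_photonModeLp hE (n + 1) a
  have hsum : (E • (ψ, e) + (Φ, g) : State N) = (E • ψ + Φ, E • e + g) := rfl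
  have hadd := Lp.coeFn_add (E • ψ) Φ
  have hsmul := Lp.coeFn_smul E ψ
  -- the photon equation
  have hmode : ∀ k, ((M.ε k : ℂ) - E) * ∑ j ∈ Finset.range (n + 1), a j * M.photonMode E j k =
      ∑ j ∈ Finset.range n, a (j + 1) * M.photonMode E j k - star (M.V k) * a 0 := by
    intro k
    rw [Finset.sum_range_succ', mul_add, Finset.mul_sum]
    have h0 := sub_mul_photonMode_zero hE k
    have h1 : ∀ j ∈ Finset.range n, ((M.ε k : ℂ) - E) * (a (j + 1) * M.photonMode E (j + 1) k) =
        a (j + 1) * M.photonMode E j k := by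
      intro j _
      rw [← sub_mul_photonMode_succ hE j k]; ring
    rw [Finset.sum_congr rfl h1]
    linear_combination a 0 * h0
  have hphoton : (∀ᵐ k : ℝ, (E • ψ + Φ : Lp ℂ 2 (volume : Measure ℝ)) k = (M.ε k : ℂ) * ψ k +
      star (M.V k) * (star M.u ⬝ᵥ e)) ↔
      ψ = ∑ j ∈ Finset.range (n + 1), a j • hM.photonModeLp hE j := by
    constructor
    · intro h
      apply Lp.ext
      filter_upwards [h, hadd, hsmul, hΦc, hψc] with k h1 h2 h3 h4 h5
      rw [h5]
      have hne : (M.ε k : ℂ) - E ≠ 0 := sub_ne_zero.mpr (hE k).symm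
      apply mul_left_cancel₀ hne
      rw [hmode, ha]
      rw [h2, Pi.add_apply, h3, Pi.smul_apply, smul_eq_mul, h4] at h1
      linear_combination -h1
    · rintro h
      rw [← h] at hψc
      filter_upwards [hadd, hsmul, hΦc, hψc] with k h2 h3 h4 h5
      have := hmode k
      rw [← h5, ha] at this
      rw [h2, Pi.add_apply, h3, Pi.smul_apply, smul_eq_mul, h4]
      linear_combination -this
  have hint : ∀ j ∈ Finset.range (n + 1), Integrable fun k => a j * (M.V k * M.photonMode E j k) :=
    fun j _ => (hM.integrable_V_mul_photonMode hE j).const_mul _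
  have hcong : ψ = ∑ j ∈ Finset.range (n + 1), a j • hM.photonModeLp hE j →
      (fun k => M.V k * ψ k) =ᵐ[volume]
        fun k => ∑ j ∈ Finset.range (n + 1), a j * (M.V k * M.photonMode E j k) := by
    intro h
    rw [← h] at hψc
    filter_upwards [hψc] with k hk
    rw [hk, Finset.mul_sum]
    exact Finset.sum_congr rfl fun j _ => by ring
  have hval : ψ = ∑ j ∈ Finset.range (n + 1), a j • hM.photonModeLp hE j →
      Integrable (fun k => M.V k * ψ k) ∧ ∫ k : ℝ, M.V k * ψ k =
        ∑ j ∈ Finset.range (n + 1), M.kappaCoeff E j * a j := by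
    intro h
    refine ⟨(integrable_finsetSum _ hint).congr (hcong h).symm, ?_⟩
    rw [integral_congr_ae (hcong h), integral_finsetSum _ hint]
    refine Finset.sum_congr rfl fun j _ => ?_
    rw [integral_const_mul, kappaCoeff, mul_comm]
  rw [hsum]
  change ((∀ᵐ k : ℝ, (E • ψ + Φ : Lp ℂ 2 (volume : Measure ℝ)) k = (M.ε k : ℂ) * ψ k +
      star (M.V k) * (star M.u ⬝ᵥ e)) ∧ Integrable (fun k : ℝ => M.V k * ψ k) ∧
      E • e + g = (∫ k : ℝ, M.V k * ψ k) • M.u + M.KR *ᵥ e) ↔ _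
  rw [hphoton]
  constructor
  · rintro ⟨h1, -, h3⟩
    refine ⟨h1, ?_⟩
    rw [(hval h1).2] at h3
    rw [← sub_eq_zero] at h3 ⊢
    rw [← h3]
    abel
  · rintro ⟨h1, h3⟩
    refine ⟨h1, (hval h1).1, ?_⟩
    rw [(hval h1).2, h3]
    abel

/-- Generalized eigenstates in terms of emitter chains. -/
theorem mem_genEigenspace_iff {E : ℂ} (hE : E ∈ M.gap) (n : ℕ) (Ψ : State N) :
    Ψ ∈ M.genEigenspace E n ↔ ∃ e : ℕ → Fin N → ℂ, (∀ k, n ≤ k → e k = 0) ∧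
      (∀ k, e (k + 1) = M.KR *ᵥ e k - E • e k +
        (∑ j ∈ Finset.range n, M.kappaCoeff E j * (star M.u ⬝ᵥ e (k + j))) • M.u) ∧
      Ψ = (∑ j ∈ Finset.range n, (star M.u ⬝ᵥ e j) • hM.photonModeLp hE j, e 0) := by
  induction n generalizing Ψ with
  | zero =>
    change Ψ ∈ (⊥ : Submodule ℂ (State N)) ↔ _
    rw [Submodule.mem_bot]
    constructor
    · rintro rfl
      exact ⟨0, fun _ _ => rfl, fun k => by simp, by simp; rfl⟩
    · rintro ⟨e, h0, -, rfl⟩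
      rw [h0 0 le_rfl]
      simp
  | succ n ih =>
    change (∃ Φ ∈ M.genEigenspace E n, (Ψ, E • Ψ + Φ) ∈ M.hamiltonian) ↔ _
    constructor
    · rintro ⟨Φ, hΦ, hH⟩
      obtain ⟨e', h0, hrec, rfl⟩ := (ih Φ).mp hΦ
      obtain ⟨ψ, e₀⟩ := Ψ
      -- The emitter part of `Ψ` is prepended to the chain of `Φ`.
      set e : ℕ → Fin N → ℂ := fun k => Nat.casesOn k e₀ e' with he
      have hes : ∀ k, e (k + 1) = e' k := fun k => rfl
      have h1 := (hM.mem_hamiltonian_iff hE n ψ e₀ (e' 0) (fun j => star M.u ⬝ᵥ e j) rfl).mp hH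
      refine ⟨e, ?_, ?_, ?_⟩
      · intro k hk
        obtain ⟨k, rfl⟩ : ∃ l, k = l + 1 := ⟨k - 1, by omega⟩
        exact h0 k (by omega)
      · intro k
        cases k with
        | zero =>
          simp only [zero_add]
          exact h1.2
        | succ k =>
          rw [hes, hes, hrec k, Finset.sum_range_succ]
          -- The sum has one term more than the recursion for `Φ`, but the chain has already ended
          -- there.
          have h2 : e (k + 1 + n) = 0 := by
            rw [show k + 1 + n = (k + n) + 1 by ring, hes]
            exact h0 _ (by omega)
          rw [h2, dotProduct_zero, mul_zero, add_zero]
          congr 2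
          refine Finset.sum_congr rfl fun j _ => ?_
          rw [show k + 1 + j = (k + j) + 1 by ring, hes]
      · exact Prod.ext h1.1 rfl
    · rintro ⟨e, h0, hrec, rfl⟩
      refine ⟨(∑ j ∈ Finset.range n, (star M.u ⬝ᵥ e (j + 1)) • hM.photonModeLp hE j, e 1),
        (ih _).mpr ⟨fun k => e (k + 1), fun k hk => h0 _ (by omega), fun k => ?_, rfl⟩, ?_⟩
      · change e (k + 1 + 1) = M.KR *ᵥ e (k + 1) - E • e (k + 1) + (∑ j ∈ Finset.range n,
          M.kappaCoeff E j * (star M.u ⬝ᵥ e (k + j + 1))) • M.u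
        rw [hrec (k + 1), Finset.sum_range_succ]
        have h2 : e (k + 1 + n) = 0 := h0 _ (by omega)
        rw [h2, dotProduct_zero, mul_zero, add_zero]
        congr 2
        refine Finset.sum_congr rfl fun j _ => ?_
        rw [show k + 1 + j = k + j + 1 by ring]
      · refine (hM.mem_hamiltonian_iff hE n _ (e 0) (e 1) (fun j => star M.u ⬝ᵥ e j) rfl).mpr
          ⟨rfl, ?_⟩
        have := hrec 0
        simpa only [zero_add] using this

end RegularCoupling

open Polynomial in
/-- The polynomial matrix `E + X - K^R - p |u⟩⟨u|`, with `p` the Taylor polynomial of `κ`. -/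
def taylorMatrix (M : EmitterModel N) (E : ℂ) (n : ℕ) : Matrix (Fin N) (Fin N) ℂ[X] :=
  Matrix.of fun i l => (if i = l then C E + X else 0) - C (M.KR i l) -
    (∑ j ∈ Finset.range n, C (M.kappaCoeff E j) * X ^ j) * C (M.u i * star (M.u l))

open Polynomial in
theorem eval_det_taylorMatrix (E : ℂ) (n : ℕ) (t : ℂ) : (M.taylorMatrix E n).det.eval t =
    M.polyA.eval (E + t) + (∑ j ∈ Finset.range n, M.kappaCoeff E j * t ^ j) *
      M.polyB.eval (E + t) := by
  have h1 := RingHom.map_det (evalRingHom t) (M.taylorMatrix E n)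
  rw [coe_evalRingHom] at h1
  rw [h1, eval_polyA, eval_polyB, ← det_sub_smul_vecMulVec]
  congr 1
  ext i l
  rw [RingHom.mapMatrix_apply, Matrix.map_apply, taylorMatrix, Matrix.of_apply]
  simp only [coe_evalRingHom, Matrix.sub_apply, Matrix.smul_apply, Matrix.vecMulVec_apply,
    Matrix.one_apply, Pi.star_apply, smul_eq_mul, eval_sub, eval_mul, eval_C, eval_finsetSum,
    eval_pow, eval_X]
  split_ifs <;> simp

open Polynomial in
-- The coefficients of X^k in the vector `x` form the k-th vector of a chain, and X acts as the
-- backward shift. The kernel of the Taylor matrix is therefore the space of solutions of the chain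
-- recursion.
theorem coeff_matrixAeval_taylorMatrix (E : ℂ) (n : ℕ) (x : Fin N → ℂ[X]) (i : Fin N) (k : ℕ) :
    (matrixAeval divXLinear (M.taylorMatrix E n) x i).coeff k =
      (x i).coeff (k + 1) - ((M.KR *ᵥ fun l => (x l).coeff k) i - E * (x i).coeff k +
        (∑ j ∈ Finset.range n, M.kappaCoeff E j * (star M.u ⬝ᵥ fun l => (x l).coeff (k + j))) *
          M.u i) := by
  have hterm : ∀ l, (aeval divXLinear (M.taylorMatrix E n i l) (x l)).coeff k =
      (if i = l then E * (x l).coeff k + (x l).coeff (k + 1) else 0) - M.KR i l * (x l).coeff k -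
      ∑ j ∈ Finset.range n, M.kappaCoeff E j * (M.u i * star (M.u l)) * (x l).coeff (k + j) := by
    intro l
    rw [taylorMatrix, Matrix.of_apply, map_sub, map_sub, LinearMap.sub_apply, LinearMap.sub_apply,
      coeff_sub, coeff_sub, Finset.sum_mul, map_sum, LinearMap.sum_apply, finsetSum_coeff]
    congr 1
    · congr 1
      · split_ifs
        · simp [Module.algebraMap_end_apply, divXLinear_apply]
        · simp
      · simp [Module.algebraMap_end_apply]
    · refine Finset.sum_congr rfl fun j _ => ?_
      rw [mul_right_comm, ← C_mul, map_mul, map_pow, aeval_X, aeval_C, Module.End.mul_apply,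
        Module.algebraMap_end_apply, coeff_smul, coeff_divXLinear_pow, smul_eq_mul]
  rw [matrixAeval_apply, finsetSum_coeff, Finset.sum_congr rfl fun l _ => hterm l,
    Finset.sum_sub_distrib, Finset.sum_sub_distrib, Finset.sum_ite_eq, if_pos (Finset.mem_univ i)]
  rw [Finset.sum_comm]
  simp only [Matrix.mulVec, dotProduct, Finset.sum_mul, Finset.mul_sum, Pi.star_apply]
  have : ∀ j ∈ Finset.range n, ∀ l ∈ Finset.univ, M.kappaCoeff E j * (M.u i * star (M.u l)) *
      (x l).coeff (k + j) = M.kappaCoeff E j * (star (M.u l) * (x l).coeff (k + j)) * M.u i :=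
    fun j _ l _ => by ring
  rw [Finset.sum_congr rfl fun j hj => Finset.sum_congr rfl (this j hj)]
  ring

open Polynomial in
theorem rootMultiplicity_zero_of_tendsto {p : ℂ[X]} {d : ℕ} {c : ℂ} (hc : c ≠ 0)
    (h : Tendsto (fun t => p.eval t / t ^ d) (𝓝[≠] 0) (𝓝 c)) :
    p ≠ 0 ∧ p.rootMultiplicity 0 = d := by
  have hp : p ≠ 0 := by
    rintro rfl
    simp only [eval_zero, zero_div] at h
    exact hc (tendsto_nhds_unique h tendsto_const_nhds)
  refine ⟨hp, ?_⟩
  obtain ⟨q, hq, hq0⟩ := exists_eq_pow_rootMultiplicity_mul_and_not_dvd p hp 0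
  set r := p.rootMultiplicity 0
  rw [C_0, sub_zero] at hq hq0
  have hq0' : q.eval 0 ≠ 0 := by
    rwa [Ne, ← IsRoot.def, ← dvd_iff_isRoot, C_0, sub_zero]
  have hqt : Tendsto (fun t => q.eval t) (𝓝[≠] 0) (𝓝 (q.eval 0)) :=
    (q.continuous.tendsto 0).mono_left nhdsWithin_le_nhds
  have hpw : ∀ l : ℕ, l ≠ 0 → Tendsto (fun t : ℂ => t ^ l) (𝓝[≠] 0) (𝓝 0) := by
    intro l hl
    have := ((continuous_pow l).tendsto (0 : ℂ)).mono_left (nhdsWithin_le_nhds (s := {0}ᶜ))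
    rwa [zero_pow hl] at this
  have hev : ∀ᶠ t in 𝓝[≠] (0 : ℂ), t ≠ 0 := self_mem_nhdsWithin
  have hpe : ∀ t, p.eval t = t ^ r * q.eval t := by
    intro t; conv_lhs => rw [hq]
    simp
  rcases lt_trichotomy r d with hlt | heq | hgt
  · exfalso
    have h1 := h.mul (hpw (d - r) (by omega))
    rw [mul_zero] at h1
    have h2 : Tendsto (fun t => q.eval t) (𝓝[≠] 0) (𝓝 0) := by
      refine h1.congr' ?_
      filter_upwards [hev] with t ht
      rw [hpe, show d = r + (d - r) by omega, pow_add, show r + (d - r) - r = d - r by omega]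
      field_simp
    exact hq0' (tendsto_nhds_unique hqt h2)
  · exact heq
  · exfalso
    have h1 := (hpw (r - d) (by omega)).mul hqt
    rw [zero_mul] at h1
    have h2 : Tendsto (fun t => p.eval t / t ^ d) (𝓝[≠] 0) (𝓝 0) := by
      refine h1.congr' ?_
      filter_upwards [hev] with t ht
      rw [hpe, show r = d + (r - d) by omega, pow_add, show d + (r - d) - d = r - d by omega]
      field_simp
    exact hc (tendsto_nhds_unique h h2)

theorem genEigenspace_mono {E : ℂ} : Monotone (M.genEigenspace E) := by
  refine monotone_nat_of_le_succ fun n => ?_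
  induction n with
  | zero => exact bot_le
  | succ n ih =>
    rintro Ψ ⟨Φ, hΦ, h⟩
    exact ⟨Φ, ih hΦ, h⟩

namespace RegularCoupling

variable (hM : M.RegularCoupling)
include hM

/-- Truncating κ changes the characteristic function by O(t^n) with n > d, so the leading term of
order t^d survives. -/
theorem rootMultiplicity_det_taylorMatrix {E : ℂ} (hE : E ∈ M.gap) {d n : ℕ}
    (hd : analyticOrderAt M.charFun E = d) (hn : d < n) :
    (M.taylorMatrix E n).det ≠ 0 ∧ (M.taylorMatrix E n).det.rootMultiplicity 0 = d := by
  have han : AnalyticAt ℂ M.charFun E :=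
    hM.differentiableOn_charFun.analyticAt (M.isOpen_gap.mem_nhds hE)
  obtain ⟨g, hg, hg0, hev⟩ := han.analyticOrderAt_eq_natCast.mp hd
  obtain ⟨C, hC⟩ := hM.kappa_taylor hE n
  refine rootMultiplicity_zero_of_tendsto hg0 ?_
  have hshift : Tendsto (fun t : ℂ => E + t) (𝓝[≠] 0) (𝓝 E) := by
    have : Continuous fun t : ℂ => E + t := by fun_prop
    have := this.tendsto 0
    rw [add_zero] at this
    exact this.mono_left nhdsWithin_le_nhds
  have h1 : Tendsto (fun t => g (E + t)) (𝓝[≠] 0) (𝓝 (g E)) :=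
    hg.continuousAt.tendsto.comp hshift
  have h2 : Tendsto (fun t : ℂ => (M.kappa (E + t) - ∑ j ∈ Finset.range n,
      M.kappaCoeff E j * t ^ j) / t ^ d) (𝓝[≠] 0) (𝓝 0) := by
    rw [tendsto_zero_iff_norm_tendsto_zero]
    have hb : Tendsto (fun t : ℂ => C * ‖t‖ ^ (n - d)) (𝓝[≠] 0) (𝓝 0) := by
      have : Continuous fun t : ℂ => C * ‖t‖ ^ (n - d) := by fun_prop
      have := (this.tendsto 0).mono_left (nhdsWithin_le_nhds (s := {0}ᶜ))
      rwa [norm_zero, zero_pow (by omega), mul_zero] at this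
    refine squeeze_zero' (Eventually.of_forall fun _ => norm_nonneg _) ?_ hb
    filter_upwards [hC.filter_mono nhdsWithin_le_nhds, self_mem_nhdsWithin] with t ht ht0
    have ht0' : 0 < ‖t‖ := norm_pos_iff.mpr ht0
    rw [norm_div, norm_pow, div_le_iff₀ (by positivity), mul_assoc, ← pow_add,
      Nat.sub_add_cancel hn.le]
    exact ht
  have h3 : Tendsto (fun t : ℂ => M.polyB.eval (E + t)) (𝓝[≠] 0) (𝓝 (M.polyB.eval E)) :=
    (M.polyB.continuous.tendsto E).comp hshift
  have h4 := h1.sub (h2.mul h3)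
  rw [zero_mul, sub_zero] at h4
  refine h4.congr' ?_
  filter_upwards [hshift.eventually hev, self_mem_nhdsWithin] with t ht ht0
  have ht0' : t ≠ 0 := ht0
  rw [eval_det_taylorMatrix]
  rw [charFun_eq, add_sub_cancel_left, smul_eq_mul] at ht
  field_simp
  linear_combination -ht

/-- The state built from an emitter chain. -/
def chainState {E : ℂ} (hE : E ∈ M.gap) (n : ℕ) :
    (Fin N → Polynomial ℂ) →ₗ[ℂ] State N where
  toFun x := (∑ j ∈ Finset.range n, (star M.u ⬝ᵥ fun l => (x l).coeff j) • hM.photonModeLp hE j,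
    fun l => (x l).coeff 0)
  map_add' x y := by
    refine Prod.ext ?_ ?_
    · simp only [Prod.fst_add]
      rw [← Finset.sum_add_distrib]
      refine Finset.sum_congr rfl fun j _ => ?_
      rw [← add_smul, ← dotProduct_add]
      congr 2
    · funext l; simp
  map_smul' c x := by
    refine Prod.ext ?_ ?_
    · simp only [Prod.smul_fst, RingHom.id_apply, Finset.smul_sum]
      refine Finset.sum_congr rfl fun j _ => ?_
      rw [smul_smul, ← smul_eq_mul, ← dotProduct_smul]
      congr 2
    · funext l; simp

/-- Generalized eigenstates are the images of chains under `chainState`, which is injective on the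
kernel of the Taylor matrix; the dimension of this kernel is the order of its determinant at 0. -/
theorem genEigenspace_finrank {E : ℂ} (hE : E ∈ M.gap) {d n : ℕ}
    (hd : analyticOrderAt M.charFun E = d) (hn : d < n) :
    FiniteDimensional ℂ (M.genEigenspace E n) ∧ Module.finrank ℂ (M.genEigenspace E n) = d := by
  obtain ⟨hdet, hmult⟩ := hM.rootMultiplicity_det_taylorMatrix hE hd hn
  obtain ⟨hfin, hrank⟩ := finrank_ker_matrixAeval divXLinear_locallyNilpotent
    divXLinear_surjective finrank_ker_divXLinear (M.taylorMatrix E n) hdet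
  set W := LinearMap.ker (matrixAeval divXLinear (M.taylorMatrix E n)) with hW
  -- Kernel vectors are killed by the `d`-th power of the shift and d < n, so every chain ends
  -- before index `n`.
  have hsupp : ∀ x ∈ W, ∀ i k, n ≤ k → (x i).coeff k = 0 := by
    intro x hx i k hk
    have h1 := pow_apply_of_mem_ker_matrixAeval divXLinear_locallyNilpotent hdet hx i
    rw [hmult] at h1
    have h2 := coeff_divXLinear_pow d (x i) (k - d)
    rw [h1, Polynomial.coeff_zero, Nat.sub_add_cancel (by omega)] at h2
    exact h2.symm
  have hrec : ∀ x : Fin N → Polynomial ℂ, x ∈ W ↔ ∀ k, (fun l => (x l).coeff (k + 1)) =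
      M.KR *ᵥ (fun l => (x l).coeff k) - E • (fun l => (x l).coeff k) +
        (∑ j ∈ Finset.range n, M.kappaCoeff E j *
          (star M.u ⬝ᵥ fun l => (x l).coeff (k + j))) • M.u := by
    intro x
    rw [hW, LinearMap.mem_ker]
    constructor
    · intro h k
      funext i
      have h1 := coeff_matrixAeval_taylorMatrix (M := M) E n x i k
      rw [h, Pi.zero_apply, Polynomial.coeff_zero] at h1
      simp only [Pi.add_apply, Pi.sub_apply, Pi.smul_apply, smul_eq_mul]
      linear_combination -h1
    · intro h
      funext i
      ext k
      rw [coeff_matrixAeval_taylorMatrix, Pi.zero_apply, Polynomial.coeff_zero]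
      have h1 := congrFun (h k) i
      simp only [Pi.add_apply, Pi.sub_apply, Pi.smul_apply, smul_eq_mul] at h1
      rw [h1]
      ring
  have hrange : W.map (hM.chainState hE n) = M.genEigenspace E n := by
    ext Ψ
    rw [Submodule.mem_map, hM.mem_genEigenspace_iff hE]
    constructor
    · rintro ⟨x, hx, rfl⟩
      exact ⟨fun k l => (x l).coeff k, fun k hk => funext fun l => hsupp x hx l k hk,
        (hrec x).mp hx, rfl⟩
    · rintro ⟨e, h0, h1, rfl⟩
      have hcoeff : ∀ l k, (∑ j ∈ Finset.range n, Polynomial.monomial j (e j l)).coeff k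
          = e k l := by
        intro l k
        rw [Polynomial.finsetSum_coeff]
        simp only [Polynomial.coeff_monomial]
        rw [Finset.sum_ite_eq']
        split_ifs with hk
        · rfl
        · rw [h0 k (by simpa using hk)]; rfl
      refine ⟨fun l => ∑ j ∈ Finset.range n, Polynomial.monomial j (e j l), ?_, ?_⟩
      · rw [hrec]
        simp only [hcoeff]
        exact h1
      · change (_, _) = _
        simp only [hcoeff]
  -- The state of the shifted chain is the image of the original state under H - E. If the latter is
  -- zero, so is the former, and by induction all vectors of the chain vanish.
  have hinj : Set.InjOn (hM.chainState hE n) W := by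
    have key : ∀ m, ∀ e : ℕ → Fin N → ℂ, (∀ k, n ≤ k → e k = 0) →
        (∀ k, e (k + 1) = M.KR *ᵥ e k - E • e k +
        (∑ j ∈ Finset.range n, M.kappaCoeff E j * (star M.u ⬝ᵥ e (k + j))) • M.u) →
        ((∑ j ∈ Finset.range n, (star M.u ⬝ᵥ e j) • hM.photonModeLp hE j, e 0) : State N) = 0 →
        e m = 0 := by
      intro m
      induction m with
      | zero =>
        intro e _ _ h
        exact congrArg Prod.snd h
      | succ m ih =>
        intro e h0 h1 h
        refine ih (fun k => e (k + 1)) (fun k hk => h0 _ (by omega)) (fun k => ?_) ?_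
        · rw [h1 (k + 1)]
          congr 2
          refine Finset.sum_congr rfl fun j _ => ?_
          rw [show k + 1 + j = k + j + 1 by ring]
        · have hψ : (∑ j ∈ Finset.range n, (star M.u ⬝ᵥ e j) • hM.photonModeLp hE j) =
              ∑ j ∈ Finset.range (n + 1), (star M.u ⬝ᵥ e j) • hM.photonModeLp hE j := by
            rw [Finset.sum_range_succ, h0 n le_rfl, dotProduct_zero, zero_smul, add_zero]
          have h2 := (hM.mem_hamiltonian_iff hE n
            (∑ j ∈ Finset.range n, (star M.u ⬝ᵥ e j) • hM.photonModeLp hE j) (e 0) (e 1)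
            (fun j => star M.u ⬝ᵥ e j) rfl).mpr ⟨hψ, by
              have := h1 0
              simp only [zero_add] at this
              rw [this, Finset.sum_range_succ, h0 n le_rfl, dotProduct_zero, mul_zero, add_zero]⟩
          have h3 : (∑ j ∈ Finset.range n, (star M.u ⬝ᵥ e j) • hM.photonModeLp hE j, e 0) =
              (0 : State N) := h
          rw [h3, smul_zero, zero_add] at h2
          obtain ⟨a1, -, a3⟩ := h2
          have hz := Lp.coeFn_zero ℂ 2 (volume : Measure ℝ)
          refine Prod.ext ?_ ?_
          · change ∑ j ∈ Finset.range n, (star M.u ⬝ᵥ e (j + 1)) • hM.photonModeLp hE j = 0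
            apply Lp.ext
            filter_upwards [a1, hz] with k h4 h5
            rw [h5, Pi.zero_apply]
            refine h4.trans ?_
            simp only [Prod.fst_zero, Prod.snd_zero, dotProduct_zero, mul_zero, add_zero]
            rw [h5, Pi.zero_apply, mul_zero]
          · change e 1 = 0
            refine a3.trans ?_
            have : (fun k : ℝ => M.V k * (0 : Lp ℂ 2 (volume : Measure ℝ)) k) =ᵐ[volume]
                fun _ => 0 := by
              filter_upwards [hz] with k h5
              rw [h5, Pi.zero_apply, mul_zero]
            simp only [Prod.fst_zero, Prod.snd_zero]
            rw [integral_congr_ae this]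
            simp
    intro x hx y hy hxy
    rw [← sub_eq_zero, ← map_sub] at hxy
    have hxyW : x - y ∈ W := W.sub_mem hx hy
    rw [← sub_eq_zero]
    funext l
    ext k
    have := key k (fun k l => ((x - y) l).coeff k)
      (fun k hk => funext fun l => hsupp _ hxyW l k hk) ((hrec _).mp hxyW) hxy
    exact congrFun this l
  have hinj' : Function.Injective ((hM.chainState hE n).domRestrict W) := by
    rintro ⟨x, hx⟩ ⟨y, hy⟩ h
    exact Subtype.ext (hinj hx hy h)
  have hrr : LinearMap.range ((hM.chainState hE n).domRestrict W) = M.genEigenspace E n := by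
    rw [← hrange, LinearMap.range_domRestrict]
  rw [← hrr]
  constructor
  · exact inferInstance
  · rw [LinearMap.finrank_range_of_inj hinj', hrank, hmult]

/-- The algebraic multiplicity of an eigenvalue off the closed continuum is the order of
vanishing of the characteristic function. -/
theorem finrank_boundSpace {E : ℂ} (hE : E ∈ M.gap) {d : ℕ}
    (hd : analyticOrderAt M.charFun E = d) :
    FiniteDimensional ℂ (M.boundSpace E) ∧ Module.finrank ℂ (M.boundSpace E) = d := by
  -- The kernels of (H - E)^n increase with n and have the same dimension `d` for all n > d.
  have heq : M.boundSpace E = M.genEigenspace E (d + 1) := by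
    refine le_antisymm (iSup_le fun n => ?_) (le_iSup (M.genEigenspace E) (d + 1))
    rcases le_total n (d + 1) with h | h
    · exact genEigenspace_mono h
    · have h1 := hM.genEigenspace_finrank hE hd (lt_add_one d)
      have h2 := hM.genEigenspace_finrank hE hd (n := n) (by omega)
      have := h2.1
      exact (Submodule.eq_of_le_of_finrank_eq (genEigenspace_mono h)
        (h1.2.trans h2.2.symm)).ge
  rw [heq]
  exact hM.genEigenspace_finrank hE hd (lt_add_one d)

end RegularCoupling

end EmitterModel

end

/-! ### Zero energy: dark states and the absence of Jordan chains -/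

noncomputable section

open scoped ComplexOrder in
-- The Hermitian matrix i(A - A†) has the quadratic form -2 Im⟨x|Ax⟩ ≥ 0. The form vanishes at a
-- null vector of `A`, and positivity puts that vector into the kernel of A - A†.
theorem Matrix.mulVec_eq_zero_of_dissipative {n : Type*} [Fintype n] {A : Matrix n n ℂ}
    (hA : ∀ x : n → ℂ, (star x ⬝ᵥ (A *ᵥ x)).im ≤ 0) {x : n → ℂ} (hx : A *ᵥ x = 0) :
    Aᴴ *ᵥ x = 0 := by
  set B : Matrix n n ℂ := Complex.I • (A - Aᴴ) with hB
  have hBH : B.IsHermitian := by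
    rw [Matrix.IsHermitian, hB, Matrix.conjTranspose_smul, Matrix.conjTranspose_sub,
      Matrix.conjTranspose_conjTranspose, Complex.star_def, Complex.conj_I, neg_smul, ← smul_neg,
      neg_sub]
  have hadj : ∀ y : n → ℂ, star y ⬝ᵥ (Aᴴ *ᵥ y) = star (star y ⬝ᵥ (A *ᵥ y)) := by
    intro y
    rw [Matrix.star_dotProduct, Matrix.star_mulVec, Matrix.conjTranspose_conjTranspose,
      ← Matrix.dotProduct_mulVec]
  have hquad : ∀ y : n → ℂ, star y ⬝ᵥ (B *ᵥ y) = ((-2 * (star y ⬝ᵥ (A *ᵥ y)).im : ℝ) : ℂ) := by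
    intro y
    rw [hB, Matrix.smul_mulVec, Matrix.sub_mulVec, dotProduct_smul, dotProduct_sub, hadj,
      Complex.star_def, Complex.sub_conj, smul_eq_mul]
    push_cast
    linear_combination (2 * ((star y ⬝ᵥ (A *ᵥ y)).im : ℂ)) * Complex.I_sq
  have hpsd : B.PosSemidef := by
    refine Matrix.PosSemidef.of_dotProduct_mulVec_nonneg hBH fun y => ?_
    rw [hquad]
    have := hA y
    exact_mod_cast (by linarith : (0 : ℝ) ≤ -2 * (star y ⬝ᵥ (A *ᵥ y)).im)
  have h0 : B *ᵥ x = 0 := by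
    rw [← hpsd.dotProduct_mulVec_zero_iff, hquad, hx, dotProduct_zero]
    simp
  rw [hB, Matrix.smul_mulVec, Matrix.sub_mulVec, hx, zero_sub, smul_neg, neg_eq_zero] at h0
  exact (smul_eq_zero.mp h0).resolve_left Complex.I_ne_zero

theorem Matrix.dotProduct_mulVec_eq_zero_of_dissipative {n : Type*} [Fintype n]
    {A : Matrix n n ℂ} (hA : ∀ x : n → ℂ, (star x ⬝ᵥ (A *ᵥ x)).im ≤ 0) {x : n → ℂ}
    (hx : A *ᵥ x = 0) (y : n → ℂ) : star x ⬝ᵥ (A *ᵥ y) = 0 := by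
  have h := Matrix.mulVec_eq_zero_of_dissipative hA hx
  rw [Matrix.dotProduct_mulVec, ← Matrix.conjTranspose_conjTranspose A, ← Matrix.star_mulVec, h,
    star_zero, zero_dotProduct]

namespace EmitterModel

variable {N : ℕ} {M : EmitterModel N}

theorem ε_ne_zero {k : ℝ} (hk : k ≠ 0) : M.ε k ≠ 0 := by
  have hσ : M.σ ≠ 0 := by rcases M.σ_eq with h | h <;> rw [h] <;> norm_num
  exact mul_ne_zero (mul_ne_zero hσ M.d_pos.ne') (pow_ne_zero _ hk)

theorem abs_ε (k : ℝ) : |M.ε k| = M.d * |k| ^ M.m := by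
  have hσ : |M.σ| = 1 := by rcases M.σ_eq with h | h <;> rw [h] <;> norm_num
  rw [ε, abs_mul, abs_mul, hσ, one_mul, abs_of_pos M.d_pos, abs_pow]

/-- A normalizable zero-energy photon amplitude does not radiate. -/
theorem eq_zero_of_zero_energy (hc : ContinuousAt M.V 0) (h0 : M.V 0 ≠ 0)
    {ψ : Lp ℂ 2 (volume : Measure ℝ)} {c : ℂ}
    (h : ∀ᵐ k : ℝ, (M.ε k : ℂ) * ψ k + star (M.V k) * c = 0) : c = 0 ∧ ψ = 0 := by
  have hc0 : c = 0 := by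
    by_contra hne
    have hb : 0 < ‖M.V 0‖ := norm_pos_iff.mpr h0
    have hev : ∀ᶠ k in 𝓝 (0 : ℝ), ‖M.V 0‖ / 2 < ‖M.V k‖ :=
      hc.norm.tendsto.eventually (lt_mem_nhds (by linarith))
    obtain ⟨r, hr, hrk⟩ := Metric.eventually_nhds_iff.mp hev
    set t := min r 1 with ht
    have ht0 : 0 < t := lt_min hr one_pos
    set β := (‖M.V 0‖ / 2) ^ 2 * ‖c‖ ^ 2 with hβ
    have hβ0 : 0 < β := by
      have := norm_pos_iff.mpr hne
      positivity
    -- If c ≠ 0, then |ψ| is at least a constant times k^(-m) near 0. Square integrability of ψ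
    -- would make 1/k integrable at 0.
    have hint : IntegrableOn (fun k : ℝ => k ^ (-1 : ℝ)) (Set.Ioo 0 t) := by
      have h2 := ((memLp_two_iff_integrable_sq_norm (Lp.aestronglyMeasurable ψ)).mp
        (Lp.memLp ψ)).const_mul (M.d ^ 2 / β)
      refine h2.integrableOn.mono' (Measurable.aestronglyMeasurable (by fun_prop)) ?_
      filter_upwards [ae_restrict_of_ae h, ae_restrict_mem measurableSet_Ioo] with k hk hkm
      have hk0 : 0 < k := hkm.1
      have hk1 : k ≤ 1 := hkm.2.le.trans (min_le_right _ _)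
      have h3 : ‖M.V 0‖ / 2 < ‖M.V k‖ := hrk (by
        rw [Real.dist_eq, sub_zero, abs_of_pos hk0]; exact hkm.2.trans_le (min_le_left _ _))
      have h4 : M.d * k ^ M.m * ‖ψ k‖ = ‖M.V k‖ * ‖c‖ := by
        have := congrArg norm (eq_neg_of_add_eq_zero_left hk)
        rwa [norm_neg, norm_mul, norm_mul, norm_star, Complex.norm_real, Real.norm_eq_abs, abs_ε,
          abs_of_pos hk0] at this
      have h5 : β ≤ M.d ^ 2 * (k ^ M.m) ^ 2 * ‖ψ k‖ ^ 2 := by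
        have : M.d ^ 2 * (k ^ M.m) ^ 2 * ‖ψ k‖ ^ 2 = ‖M.V k‖ ^ 2 * ‖c‖ ^ 2 := by
          rw [← mul_pow, ← mul_pow, h4, mul_pow]
        rw [this]
        exact mul_le_mul_of_nonneg_right (pow_le_pow_left₀ (by positivity) h3.le 2) (by positivity)
      have h6 : (k ^ M.m) ^ 2 ≤ k := by
        rw [← pow_mul]
        exact pow_le_of_le_one hk0.le hk1 (by have := M.m_ne_zero; omega)
      have h7 : β ≤ M.d ^ 2 * k * ‖ψ k‖ ^ 2 := h5.trans (by gcongr)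
      rw [Real.rpow_neg_one, Real.norm_eq_abs, abs_of_pos (inv_pos.mpr hk0), inv_le_iff_one_le_mul₀ hk0,
        div_mul_eq_mul_div, div_mul_eq_mul_div, le_div_iff₀ hβ0]
      linarith
    rw [intervalIntegral.integrableOn_Ioo_rpow_iff ht0] at hint
    exact lt_irrefl _ hint
  refine ⟨hc0, Lp.ext ?_⟩
  filter_upwards [h, Lp.coeFn_zero ℂ 2 (volume : Measure ℝ),
    compl_mem_ae_iff.mpr (measure_singleton (0 : ℝ))] with k h1 h2 h3
  rw [h2, Pi.zero_apply]
  rw [hc0, mul_zero, add_zero] at h1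
  exact (mul_eq_zero.mp h1).resolve_left (by exact_mod_cast ε_ne_zero h3)

variable (M) in
/-- Emitter states that are decoupled from the photons and annihilated by the Hamiltonian. -/
def darkSpace : Submodule ℂ (Fin N → ℂ) where
  carrier := {e | M.KR *ᵥ e = 0 ∧ star M.u ⬝ᵥ e = 0}
  add_mem' := by
    rintro a b ⟨h1, h2⟩ ⟨h3, h4⟩
    exact ⟨by rw [Matrix.mulVec_add, h1, h3, add_zero], by rw [dotProduct_add, h2, h4, add_zero]⟩
  zero_mem' := ⟨Matrix.mulVec_zero _, dotProduct_zero _⟩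
  smul_mem' := by
    rintro c a ⟨h1, h2⟩
    exact ⟨by rw [Matrix.mulVec_smul, h1, smul_zero], by rw [dotProduct_smul, h2, smul_zero]⟩

theorem mem_hamiltonian_zero_iff (hc : ContinuousAt M.V 0) (h0 : M.V 0 ≠ 0) (Ψ : State N)
    (f : Fin N → ℂ) : (Ψ, ((0, f) : State N)) ∈ M.hamiltonian ↔
      Ψ.1 = 0 ∧ star M.u ⬝ᵥ Ψ.2 = 0 ∧ f = M.KR *ᵥ Ψ.2 := by
  have hz := Lp.coeFn_zero ℂ 2 (volume : Measure ℝ)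
  have hV : (fun k : ℝ => M.V k * (0 : Lp ℂ 2 (volume : Measure ℝ)) k) =ᵐ[volume]
      fun _ => 0 := by
    filter_upwards [hz] with k h5
    rw [h5, Pi.zero_apply, mul_zero]
  have hVi : ∫ k : ℝ, M.V k * (0 : Lp ℂ 2 (volume : Measure ℝ)) k = 0 := by
    rw [integral_congr_ae hV, integral_zero]
  obtain ⟨ψ, e⟩ := Ψ
  change ((∀ᵐ k : ℝ, (0 : Lp ℂ 2 (volume : Measure ℝ)) k = (M.ε k : ℂ) * ψ k +
      star (M.V k) * (star M.u ⬝ᵥ e)) ∧ Integrable (fun k : ℝ => M.V k * ψ k) ∧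
      f = (∫ k : ℝ, M.V k * ψ k) • M.u + M.KR *ᵥ e) ↔ ψ = 0 ∧ star M.u ⬝ᵥ e = 0 ∧ f = M.KR *ᵥ e
  constructor
  · rintro ⟨h1, -, h3⟩
    obtain ⟨h4, h5⟩ := eq_zero_of_zero_energy hc h0 (ψ := ψ) (c := star M.u ⬝ᵥ e) (by
      filter_upwards [h1, hz] with k h6 h7
      rw [← h6, h7, Pi.zero_apply])
    refine ⟨h5, h4, ?_⟩
    rw [h3, h5, hVi, zero_smul, zero_add]
  · rintro ⟨rfl, h4, h5⟩
    refine ⟨?_, (integrable_zero ℝ ℂ volume).congr hV.symm, ?_⟩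
    · filter_upwards [hz] with k h7
      rw [h4, h7]
      simp
    · rw [hVi, h5, zero_smul, zero_add]

open scoped ComplexOrder in
/-- There are no generalized dark states. -/
theorem eq_zero_of_dark_of_range (hKR : ∀ x : Fin N → ℂ, (star x ⬝ᵥ (M.KR *ᵥ x)).im ≤ 0)
    {f e : Fin N → ℂ} {c : ℂ} (hf : f ∈ M.darkSpace) (h : f = M.KR *ᵥ e - c • M.u) : f = 0 := by
  obtain ⟨h1, h2⟩ := hf
  have h3 : star f ⬝ᵥ M.u = 0 := by
    rw [Matrix.star_dotProduct, dotProduct_comm, dotProduct_comm, h2, star_zero]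
  -- By dissipativity `f` is orthogonal to the range of `M.KR`, and darkness makes it orthogonal to
  -- `u`. It is a combination of the two, hence orthogonal to itself.
  have h4 : star f ⬝ᵥ f = 0 := by
    conv_lhs => rw [h]
    rw [dotProduct_sub, dotProduct_smul, ← h,
      Matrix.dotProduct_mulVec_eq_zero_of_dissipative hKR h1, h3, smul_zero, sub_zero]
  exact dotProduct_star_self_eq_zero.mp h4

/-- If H maps a state to a dark state, this dark state lies in the range of `M.KR` and must vanish.
The kernel of H^n thus does not grow beyond n = 1. -/
theorem genEigenspace_zero_energy (hc : ContinuousAt M.V 0) (h0 : M.V 0 ≠ 0)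
    (hKR : ∀ x : Fin N → ℂ, (star x ⬝ᵥ (M.KR *ᵥ x)).im ≤ 0) (n : ℕ) (Ψ : State N) :
    Ψ ∈ M.genEigenspace 0 (n + 1) ↔ Ψ.1 = 0 ∧ Ψ.2 ∈ M.darkSpace := by
  have hadd : ∀ Φ : State N, (0 : ℂ) • Ψ + Φ = Φ := fun Φ => by rw [zero_smul, zero_add]
  have hback : Ψ.1 = 0 ∧ Ψ.2 ∈ M.darkSpace → (Ψ, ((0, 0) : State N)) ∈ M.hamiltonian := by
    rintro ⟨h1, h2⟩
    exact (mem_hamiltonian_zero_iff hc h0 Ψ 0).mpr ⟨h1, h2.2, h2.1.symm⟩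
  induction n generalizing Ψ with
  | zero =>
    change (∃ Φ ∈ (⊥ : Submodule ℂ (State N)), (Ψ, (0 : ℂ) • Ψ + Φ) ∈ M.hamiltonian) ↔ _
    constructor
    · rintro ⟨Φ, hΦ, h⟩
      rw [Submodule.mem_bot] at hΦ
      rw [hadd, hΦ] at h
      obtain ⟨h1, h2, h3⟩ := (mem_hamiltonian_zero_iff hc h0 Ψ 0).mp h
      exact ⟨h1, h3.symm, h2⟩
    · intro h
      exact ⟨0, Submodule.zero_mem _, by rw [hadd]; exact hback h⟩
  | succ n ih =>
    change (∃ Φ ∈ M.genEigenspace 0 (n + 1), (Ψ, (0 : ℂ) • Ψ + Φ) ∈ M.hamiltonian) ↔ _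
    constructor
    · rintro ⟨⟨φ, f⟩, hΦ, h⟩
      obtain ⟨rfl, hf⟩ := (ih _ (fun Φ => by rw [zero_smul, zero_add]) (fun h => by
        exact (mem_hamiltonian_zero_iff hc h0 _ 0).mpr ⟨h.1, h.2.2, h.2.1.symm⟩)).mp hΦ
      rw [hadd] at h
      obtain ⟨h1, h2, h3⟩ := (mem_hamiltonian_zero_iff hc h0 Ψ f).mp h
      have hf0 : f = 0 := eq_zero_of_dark_of_range hKR (c := 0) (e := Ψ.2) hf (by
        rw [zero_smul, sub_zero]; exact h3)
      exact ⟨h1, h3.symm.trans hf0, h2⟩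
    · intro h
      exact ⟨0, Submodule.zero_mem _, by rw [hadd]; exact hback h⟩

theorem finrank_boundSpace_zero (hc : ContinuousAt M.V 0) (h0 : M.V 0 ≠ 0)
    (hKR : ∀ x : Fin N → ℂ, (star x ⬝ᵥ (M.KR *ᵥ x)).im ≤ 0) :
    FiniteDimensional ℂ (M.boundSpace 0) ∧
      Module.finrank ℂ (M.boundSpace 0) = Module.finrank ℂ M.darkSpace := by
  have heq : M.boundSpace 0 = M.darkSpace.map (LinearMap.inr ℂ _ _) := by
    have h1 : ∀ n, M.genEigenspace 0 (n + 1) = M.darkSpace.map (LinearMap.inr ℂ _ _) := by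
      intro n
      ext ⟨ψ, e⟩
      rw [genEigenspace_zero_energy hc h0 hKR, Submodule.mem_map]
      constructor
      · rintro ⟨h1, h2⟩
        exact ⟨e, h2, Prod.ext h1.symm rfl⟩
      · rintro ⟨f, h2, h3⟩
        cases h3
        exact ⟨rfl, h2⟩
    refine le_antisymm (iSup_le fun n => ?_) ((h1 0).symm.trans_le (le_iSup (M.genEigenspace 0) 1))
    cases n with
    | zero => exact bot_le
    | succ n => exact (h1 n).le
  rw [heq]
  exact ⟨inferInstance, (Submodule.equivMapOfInjective _ LinearMap.inr_injective _).finrank_eq.symm⟩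

/-- The rank-one identity with c = 1, applied to the characteristic matrix. In this form the leading
terms visibly cancel, and since the two traces differ by ⟨u|u⟩ = 1 the difference is not zero. -/
theorem polyB_eq : M.polyB =
    (M.KR + Matrix.vecMulVec M.u (star M.u)).charpoly - M.KR.charpoly := by
  have h1 := det_sub_smul_vecMulVec M.KR.charmatrix (fun i => Polynomial.C (M.u i))
    (fun i => Polynomial.C (star (M.u i))) 1
  rw [eq_sub_iff_add_eq', polyB, Matrix.charpoly, Matrix.charpoly, ← one_mul (Matrix.det (borderedMatrix _ _ _)), ← h1]
  congr 1
  ext i j : 2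
  simp only [Matrix.charmatrix_apply, Matrix.sub_apply, Matrix.vecMulVec_apply,
    Matrix.add_apply, Pi.star_apply, one_smul, map_add, map_mul]
  rw [sub_sub]

theorem N_pos (M : EmitterModel N) : 0 < N := by
  rcases Nat.eq_zero_or_pos N with h | h
  · subst h
    have := M.u_unit
    simp at this
  · exact h

theorem degree_polyB_lt : M.polyB.degree < N := by
  rw [polyB_eq]
  have h1 := (M.KR + Matrix.vecMulVec M.u (star M.u)).charpoly_degree_eq_dim
  have h2 := M.KR.charpoly_degree_eq_dim
  rw [Fintype.card_fin] at h1 h2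
  rw [← h1]
  exact Polynomial.degree_sub_lt_left (h1.trans h2.symm) (Matrix.charpoly_monic _).ne_zero
    (by rw [(Matrix.charpoly_monic _).leadingCoeff, (Matrix.charpoly_monic _).leadingCoeff])

variable (M) in
theorem polyB_ne_zero : M.polyB ≠ 0 := by
  intro h
  have hN := M.N_pos
  have : Nonempty (Fin N) := ⟨⟨0, hN⟩⟩
  have h1 := (M.KR + Matrix.vecMulVec M.u (star M.u)).trace_eq_neg_charpoly_coeff
  have h2 := M.KR.trace_eq_neg_charpoly_coeff
  rw [polyB_eq, sub_eq_zero] at h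
  rw [h, ← h2, Matrix.trace_add, Matrix.trace_vecMulVec, dotProduct_comm, M.u_unit] at h1
  simp at h1

variable (M) in
theorem polyA_monic : M.polyA.Monic := Matrix.charpoly_monic _

variable (M) in
theorem natDegree_polyA : M.polyA.natDegree = N := by
  rw [polyA, Matrix.charpoly_natDegree_eq_dim, Fintype.card_fin]

open Polynomial in
theorem coeff_matrixAeval_charmatrix (x : Fin N → ℂ[X]) (i : Fin N) (k : ℕ) :
    (matrixAeval divXLinear M.KR.charmatrix x i).coeff k =
      (x i).coeff (k + 1) - (M.KR *ᵥ fun l => (x l).coeff k) i := by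
  have hterm : ∀ l, (aeval divXLinear (M.KR.charmatrix i l) (x l)).coeff k =
      (if i = l then (x l).coeff (k + 1) else 0) - M.KR i l * (x l).coeff k := by
    intro l
    rw [Matrix.charmatrix_apply, Matrix.diagonal_apply, map_sub, LinearMap.sub_apply, coeff_sub]
    congr 1
    · split_ifs
      · simp [divXLinear_apply]
      · simp
    · simp [Module.algebraMap_end_apply]
  rw [matrixAeval_apply, finsetSum_coeff, Finset.sum_congr rfl fun l _ => hterm l,
    Finset.sum_sub_distrib, Finset.sum_ite_eq, if_pos (Finset.mem_univ i)]
  rfl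

open Polynomial in
-- Dark states are chains of length one in the kernel of the characteristic matrix, whose dimension
-- is the multiplicity of the root 0.
theorem finrank_darkSpace_le : Module.finrank ℂ M.darkSpace ≤ M.polyA.rootMultiplicity 0 := by
  obtain ⟨hfin, hrank⟩ := finrank_ker_matrixAeval divXLinear_locallyNilpotent
    divXLinear_surjective finrank_ker_divXLinear M.KR.charmatrix M.polyA_monic.ne_zero
  rw [polyA, Matrix.charpoly, ← hrank]
  let f : M.darkSpace →ₗ[ℂ] LinearMap.ker (matrixAeval divXLinear M.KR.charmatrix) :=
    { toFun := fun e => ⟨fun l => C (e.1 l), by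
        rw [LinearMap.mem_ker]
        funext i
        ext k
        rw [coeff_matrixAeval_charmatrix, Pi.zero_apply, coeff_zero, coeff_C_succ, zero_sub,
          neg_eq_zero]
        cases k with
        | zero =>
          simp only [coeff_C_zero]
          exact congrFun e.2.1 i
        | succ k =>
          simp only [coeff_C_succ]
          exact congrFun (Matrix.mulVec_zero M.KR) i⟩
      map_add' := fun a b => by ext1; funext l; simp
      map_smul' := fun c a => by ext1; funext l; simp [smul_eq_C_mul] }
  refine LinearMap.finrank_le_finrank_of_injective (f := f) fun a b hab => ?_
  apply Subtype.ext
  funext l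
  have := congrFun (congrArg Subtype.val hab) l
  exact C_injective this

/-- An emitter chain whose photon amplitudes stay at threshold is a single dark state. -/
theorem dark_of_chain (h0 : M.V 0 ≠ 0)
    (hKR : ∀ x : Fin N → ℂ, (star x ⬝ᵥ (M.KR *ᵥ x)).im ≤ 0)
    (h_bright : ¬ M.HasBrightZeroEnergyEigenstate) (n : ℕ) {e : ℕ → Fin N → ℂ} {c : ℕ → ℂ}
    (he : ∀ k, n ≤ k → e k = 0) (hcn : ∀ k, n ≤ k → c k = 0)
    (hu : ∀ k, star M.u ⬝ᵥ e k = 0) (hrec : ∀ k, e (k + 1) = M.KR *ᵥ e k - c k • M.u) :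
    e 0 ∈ M.darkSpace ∧ (∀ k, e (k + 1) = 0) ∧ ∀ k, c k = 0 := by
  induction n generalizing e c with
  | zero =>
    refine ⟨?_, fun k => he _ (Nat.zero_le _), fun k => hcn _ (Nat.zero_le _)⟩
    rw [he 0 le_rfl]
    exact Submodule.zero_mem _
  | succ n ih =>
    obtain ⟨h1, h2, h3⟩ := ih (e := fun k => e (k + 1)) (c := fun k => c (k + 1))
      (fun k hk => he _ (by omega)) (fun k hk => hcn _ (by omega)) (fun k => hu _)
      (fun k => hrec _)
    -- By the induction hypothesis `e 1` is dark, and it equals `M.KR *ᵥ e 0 - c 0 • M.u`, so it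
    -- vanishes.
    have h4 : e 1 = 0 := eq_zero_of_dark_of_range hKR h1 (hrec 0)
    have h5 : M.KR *ᵥ e 0 = c 0 • M.u := by
      have := hrec 0
      rw [zero_add, h4] at this
      exact (sub_eq_zero.mp this.symm)
    have h6 : c 0 = 0 := by
      by_contra hne
      have hz := Lp.coeFn_zero ℂ 2 (volume : Measure ℝ)
      have hV : (fun k : ℝ => M.V k * (0 : Lp ℂ 2 (volume : Measure ℝ)) k) =ᵐ[volume]
          fun _ => 0 := by
        filter_upwards [hz] with k h7
        rw [h7, Pi.zero_apply, mul_zero]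
      -- A constant photon wave in position space with amplitude -c 0 / V(0) balances M.KR e 0 = c 0
      -- u. With `e 0` it forms a bright zero-energy eigenstate.
      refine h_bright ⟨-c 0 / M.V 0, 0, e 0, ⟨?_, (integrable_zero ℝ ℂ volume).congr hV.symm, ?_⟩,
        fun h => ?_, fun h => ?_⟩
      · filter_upwards [hz] with k h7
        rw [h7, hu 0]
        simp
      · rw [integral_congr_ae hV, integral_zero, add_zero, div_mul_cancel₀ _ h0, h5, neg_smul,
          neg_add_cancel]
      · exact div_ne_zero (neg_ne_zero.mpr hne) h0 h.1
      · rw [h, Matrix.mulVec_zero] at h5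
        rcases smul_eq_zero.mp h5.symm with h8 | h8
        · exact hne h8
        · have := M.u_unit
          rw [h8, dotProduct_zero] at this
          exact zero_ne_one this
    refine ⟨⟨by rw [h5, h6, zero_smul], hu 0⟩, fun k => ?_, fun k => ?_⟩
    · cases k with
      | zero => exact h4
      | succ k => exact h2 k
    · cases k with
      | zero => exact h6
      | succ k => exact h3 k

open Polynomial in
-- The order of vanishing is the dimension of the space of chains for the bordered matrix. The
-- border row forces ⟨u|e_k⟩ = 0 and the border column supplies free amplitudes c_k. By
-- `dark_of_chain` such a chain is a single dark state.
theorem rootMultiplicity_polyB (h0 : M.V 0 ≠ 0)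
    (hKR : ∀ x : Fin N → ℂ, (star x ⬝ᵥ (M.KR *ᵥ x)).im ≤ 0)
    (h_bright : ¬ M.HasBrightZeroEnergyEigenstate) :
    M.polyB.rootMultiplicity 0 = Module.finrank ℂ M.darkSpace := by
  set P := borderedMatrix M.KR.charmatrix (fun i => C (M.u i)) (fun i => C (star (M.u i))) with hP
  obtain ⟨hfin, hrank⟩ := finrank_ker_matrixAeval divXLinear_locallyNilpotent
    divXLinear_surjective finrank_ker_divXLinear P M.polyB_ne_zero
  rw [polyB, ← hP, ← hrank]
  have hl : ∀ (x : Fin N ⊕ Unit → ℂ[X]) (i : Fin N) (k : ℕ),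
      (matrixAeval divXLinear P x (Sum.inl i)).coeff k = (x (Sum.inl i)).coeff (k + 1) -
        (M.KR *ᵥ fun l => (x (Sum.inl l)).coeff k) i + (x (Sum.inr ())).coeff k * M.u i := by
    intro x i k
    rw [← coeff_matrixAeval_charmatrix (fun l => x (Sum.inl l)), matrixAeval_apply,
      Fintype.sum_sum_type, matrixAeval_apply]
    simp [hP, borderedMatrix, Module.algebraMap_end_apply, mul_comm]
  have hr : ∀ (x : Fin N ⊕ Unit → ℂ[X]) (k : ℕ),
      (matrixAeval divXLinear P x (Sum.inr ())).coeff k =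
        star M.u ⬝ᵥ fun l => (x (Sum.inl l)).coeff k := by
    intro x k
    rw [matrixAeval_apply, Fintype.sum_sum_type]
    simp [hP, borderedMatrix, Module.algebraMap_end_apply, dotProduct]
  have hiff : ∀ x : Fin N ⊕ Unit → ℂ[X], matrixAeval divXLinear P x = 0 ↔
      (∀ k, (fun l => (x (Sum.inl l)).coeff (k + 1)) =
        M.KR *ᵥ (fun l => (x (Sum.inl l)).coeff k) - (x (Sum.inr ())).coeff k • M.u) ∧
      ∀ k, (star M.u ⬝ᵥ fun l => (x (Sum.inl l)).coeff k) = 0 := by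
    intro x
    constructor
    · intro h
      refine ⟨fun k => funext fun i => ?_, fun k => ?_⟩
      · have := hl x i k
        rw [h, Pi.zero_apply, coeff_zero] at this
        rw [Pi.sub_apply, Pi.smul_apply, smul_eq_mul]
        linear_combination -this
      · rw [← hr, h, Pi.zero_apply, coeff_zero]
    · rintro ⟨h1, h2⟩
      funext i
      ext k
      rw [Pi.zero_apply, coeff_zero]
      rcases i with i | i
      · rw [hl]
        have := congrFun (h1 k) i
        rw [Pi.sub_apply, Pi.smul_apply, smul_eq_mul] at this
        rw [this]
        ring
      · rw [hr, h2]
  have hdark : ∀ x : Fin N ⊕ Unit → ℂ[X], matrixAeval divXLinear P x = 0 →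
      (fun l => (x (Sum.inl l)).coeff 0) ∈ M.darkSpace ∧
      (∀ k, (fun l => (x (Sum.inl l)).coeff (k + 1)) = 0) ∧ ∀ k, (x (Sum.inr ())).coeff k = 0 := by
    intro x hx
    obtain ⟨h1, h2⟩ := (hiff x).mp hx
    set n := Finset.univ.sup (fun i => (x i).natDegree) + 1 with hn
    have hlt : ∀ i k, n ≤ k → (x i).coeff k = 0 := by
      intro i k hk
      refine coeff_eq_zero_of_natDegree_lt (lt_of_le_of_lt ?_ (Nat.lt_of_succ_le hk))
      exact Finset.le_sup (f := fun i => (x i).natDegree) (Finset.mem_univ i)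
    exact dark_of_chain h0 hKR h_bright n (e := fun k l => (x (Sum.inl l)).coeff k)
      (c := fun k => (x (Sum.inr ())).coeff k) (fun k hk => funext fun l => hlt _ k hk)
      (fun k hk => hlt _ k hk) h2 h1
  let f : LinearMap.ker (matrixAeval divXLinear P) ≃ₗ[ℂ] M.darkSpace :=
    { toFun := fun x => ⟨fun l => (x.1 (Sum.inl l)).coeff 0, (hdark x.1 x.2).1⟩
      map_add' := fun a b => by ext1; funext l; simp
      map_smul' := fun c a => by ext1; funext l; simp
      invFun := fun e => ⟨Sum.elim (fun l => C (e.1 l)) 0, by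
        rw [LinearMap.mem_ker, hiff]
        constructor
        · intro k
          simp only [Sum.elim_inl, Sum.elim_inr, Pi.zero_apply, coeff_C_succ, coeff_zero, zero_smul,
            sub_zero]
          cases k with
          | zero => simp only [coeff_C_zero]; exact e.2.1.symm
          | succ k => simp only [coeff_C_succ]; exact (Matrix.mulVec_zero _).symm
        · intro k
          cases k with
          | zero => simp only [Sum.elim_inl, coeff_C_zero]; exact e.2.2
          | succ k => simp only [Sum.elim_inl, coeff_C_succ]; exact dotProduct_zero _⟩
      left_inv := by
        rintro ⟨x, hx⟩
        apply Subtype.ext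
        obtain ⟨-, h2, h3⟩ := hdark x hx
        funext i
        rcases i with i | i
        · ext k
          cases k with
          | zero => simp
          | succ k => simp only [Sum.elim_inl, coeff_C_succ]; exact (congrFun (h2 k) i).symm
        · ext k
          simp only [Sum.elim_inr, Pi.zero_apply, coeff_zero]
          exact (h3 k).symm
      right_inv := by
        rintro ⟨e, he⟩
        ext1
        funext l
        simp }
  exact f.finrank_eq

end EmitterModel

end

/-! ### Asymptotics at infinity and at threshold, uniform in the angle -/

noncomputable section

/-- The quotient is the reversed polynomial evaluated at 1/ω. -/
theorem Polynomial.tendsto_eval_div_pow_cobounded (p : Polynomial ℂ) {n : ℕ}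
    (hn : p.natDegree ≤ n) :
    Tendsto (fun ω : ℂ => p.eval ω / ω ^ n) (Bornology.cobounded ℂ) (𝓝 (p.coeff n)) := by
  have h1 : Tendsto (fun ω : ℂ => (p.reflect n).eval ω⁻¹) (Bornology.cobounded ℂ)
      (𝓝 ((p.reflect n).eval 0)) :=
    ((p.reflect n).continuous.tendsto 0).comp Filter.tendsto_inv₀_cobounded
  rw [← Polynomial.coeff_zero_eq_eval_zero, Polynomial.coeff_reflect,
    Polynomial.revAt_le (Nat.zero_le n), Nat.sub_zero] at h1
  refine h1.congr' ?_
  filter_upwards [Bornology.eventually_ne_cobounded (0 : ℂ)] with ω hω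
  have : Invertible ω := invertibleOfNonzero hω
  have h2 := Polynomial.eval₂_reflect_mul_pow (RingHom.id ℂ) ω n p hn
  rw [eq_div_iff (pow_ne_zero n hω), ← invOf_eq_inv]
  exact h2

namespace EmitterModel

variable {N : ℕ} {M : EmitterModel N}

theorem norm_ofReal_mul_exp {r : ℝ} (hr : 0 ≤ r) (t φ : ℝ) :
    ‖(r : ℂ) * Complex.exp (t * φ * Complex.I)‖ = r := by
  rw [norm_mul, Complex.norm_real, Real.norm_eq_abs, abs_of_nonneg hr,
    ← Complex.ofReal_mul, Complex.norm_exp_ofReal_mul_I, mul_one]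

theorem conj_polarEnergy (p : ℝ × ℝ) : (starRingEnd ℂ) (M.polarEnergy p) =
    (M.d * p.1 ^ M.m : ℝ) * Complex.exp ((-1 : ℝ) * p.2 * Complex.I) := by
  rw [polarEnergy, map_mul, Complex.conj_ofReal, ← Complex.exp_conj]
  simp

theorem polarEnergy_eq (p : ℝ × ℝ) : M.polarEnergy p =
    (M.d * p.1 ^ M.m : ℝ) * Complex.exp ((1 : ℝ) * p.2 * Complex.I) := by
  rw [polarEnergy, Complex.ofReal_one, one_mul]

theorem tendsto_radius_atTop : Tendsto (fun s : ℝ => M.d * s ^ M.m) atTop atTop :=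
  (tendsto_pow_atTop M.m_ne_zero).const_mul_atTop M.d_pos

/-- The sign τ = ±1 treats the closed upper half plane and its complex conjugate at once, here and
in the asymptotic laws below. -/
theorem tendsto_cobounded_of_polar {τ : ℝ} {w : ℝ × ℝ → ℂ}
    (hw : ∀ p, w p = (M.d * p.1 ^ M.m : ℝ) * Complex.exp (τ * p.2 * Complex.I)) (S : Set ℝ) :
    Tendsto w (atTop ×ˢ 𝓟 S) (Bornology.cobounded ℂ) := by
  rw [← tendsto_norm_atTop_iff_cobounded]
  refine ((M.tendsto_radius_atTop).comp tendsto_fst).congr' ?_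
  filter_upwards [tendsto_fst.eventually (eventually_ge_atTop (0 : ℝ))] with p hp
  have := M.d_pos
  rw [hw, norm_ofReal_mul_exp (by positivity)]
  rfl

theorem tendsto_zero_of_polar {τ : ℝ} {w : ℝ × ℝ → ℂ}
    (hw : ∀ p, w p = (M.d * p.1 ^ M.m : ℝ) * Complex.exp (τ * p.2 * Complex.I)) (S : Set ℝ) :
    Tendsto w (𝓝[>] 0 ×ˢ 𝓟 S) (𝓝 0) := by
  rw [tendsto_zero_iff_norm_tendsto_zero]
  have hc : Continuous fun s : ℝ => M.d * s ^ M.m := by fun_prop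
  have h := (hc.tendsto 0).mono_left (nhdsWithin_le_nhds (s := Set.Ioi 0))
  rw [zero_pow M.m_ne_zero, mul_zero] at h
  refine (h.comp tendsto_fst).congr' ?_
  filter_upwards [tendsto_fst.eventually (self_mem_nhdsWithin : Set.Ioi (0 : ℝ) ∈ 𝓝[>] 0)]
    with p hp
  have := M.d_pos
  have hp' : 0 < p.1 := hp
  rw [hw, norm_ofReal_mul_exp (by positivity)]
  rfl

theorem tendsto_charLike_atTop {τ : ℝ} {w k : ℝ × ℝ → ℂ} {S : Set ℝ}
    (hw : ∀ p, w p = (M.d * p.1 ^ M.m : ℝ) * Complex.exp (τ * p.2 * Complex.I))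
    (hk : Tendsto k (atTop ×ˢ 𝓟 S) (𝓝 0)) :
    Tendsto (fun p => (M.polyA.eval (w p) + k p * M.polyB.eval (w p)) / w p ^ N)
      (atTop ×ˢ 𝓟 S) (𝓝 1) := by
  have hwc := tendsto_cobounded_of_polar hw S
  have hA := (M.polyA.tendsto_eval_div_pow_cobounded M.natDegree_polyA.le).comp hwc
  have hB := (M.polyB.tendsto_eval_div_pow_cobounded
    (Polynomial.natDegree_le_of_degree_le degree_polyB_lt.le)).comp hwc
  have h1 : M.polyA.coeff N = 1 := by
    have := M.polyA_monic.coeff_natDegree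
    rwa [M.natDegree_polyA] at this
  rw [h1] at hA
  have h := hA.add (hk.mul hB)
  rw [zero_mul, add_zero] at h
  refine h.congr fun p => ?_
  simp only [Function.comp]
  ring

/-- The self-energy diverges like s^(1-m). Once the common power X^j is removed, the contribution of
`polyA` relative to that of κ `polyB` carries a factor d s^(m-1) and disappears. The phase exponent
adds j from the power and 1/m - 1 from κ. -/
theorem tendsto_charLike_threshold {τ : ℝ} {w Λ : ℝ × ℝ → ℂ} {S : Set ℝ}
    (hw : ∀ p, w p = (M.d * p.1 ^ M.m : ℝ) * Complex.exp (τ * p.2 * Complex.I)) {c : ℂ}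
    (hΛ : Tendsto (fun p : ℝ × ℝ => Λ p - c *
      Complex.exp ((τ * ((M.m : ℝ)⁻¹ - 1) : ℝ) * p.2 * Complex.I)) (𝓝[>] 0 ×ˢ 𝓟 S) (𝓝 0))
    {a b : Polynomial ℂ} {j : ℕ} (hA : M.polyA = Polynomial.X ^ j * a)
    (hB : M.polyB = Polynomial.X ^ j * b) :
    Tendsto (fun p : ℝ × ℝ => (M.polyA.eval (w p) +
        ((p.1 / (M.d * p.1 ^ M.m) : ℝ) * Λ p) * M.polyB.eval (w p)) /
        (((M.d * p.1 ^ M.m) ^ j * (p.1 / (M.d * p.1 ^ M.m)) : ℝ) *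
          Complex.exp ((τ * (j + (M.m : ℝ)⁻¹ - 1) : ℝ) * p.2 * Complex.I)))
      (𝓝[>] 0 ×ˢ 𝓟 S) (𝓝 (c * b.eval 0)) := by
  have hw0 := tendsto_zero_of_polar hw S
  have ha0 : Tendsto (fun p => a.eval (w p)) (𝓝[>] 0 ×ˢ 𝓟 S) (𝓝 (a.eval 0)) :=
    (a.continuous.tendsto 0).comp hw0
  have hb0 : Tendsto (fun p => b.eval (w p)) (𝓝[>] 0 ×ˢ 𝓟 S) (𝓝 (b.eval 0)) :=
    (b.continuous.tendsto 0).comp hw0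
  have hr : Tendsto (fun p : ℝ × ℝ => ((M.d * p.1 ^ (M.m - 1) : ℝ) : ℂ)) (𝓝[>] 0 ×ˢ 𝓟 S)
      (𝓝 0) := by
    have hc : Continuous fun s : ℝ => ((M.d * s ^ (M.m - 1) : ℝ) : ℂ) := by fun_prop
    have h := (hc.tendsto 0).mono_left (nhdsWithin_le_nhds (s := Set.Ioi 0))
    rw [zero_pow (by have := M.two_le_m; omega), mul_zero, Complex.ofReal_zero] at h
    exact h.comp tendsto_fst
  set e : ℝ × ℝ → ℂ := fun p => Complex.exp ((τ * ((M.m : ℝ)⁻¹ - 1) : ℝ) * p.2 * Complex.I)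
    with he
  have hX := (ha0.mul hr).add (hΛ.mul hb0)
  rw [mul_zero, zero_mul, add_zero] at hX
  have hY : Tendsto (fun p => (a.eval (w p) * ((M.d * p.1 ^ (M.m - 1) : ℝ) : ℂ) +
      (Λ p - c * e p) * b.eval (w p)) / e p) (𝓝[>] 0 ×ˢ 𝓟 S) (𝓝 0) := by
    rw [tendsto_zero_iff_norm_tendsto_zero] at hX ⊢
    refine hX.congr fun p => ?_
    have : ‖e p‖ = 1 := by
      have := norm_ofReal_mul_exp zero_le_one (τ * ((M.m : ℝ)⁻¹ - 1)) p.2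
      rwa [Complex.ofReal_one, one_mul] at this
    rw [norm_div, this, div_one]
  have hZ := hY.add (hb0.const_mul c)
  rw [zero_add] at hZ
  refine hZ.congr' ?_
  filter_upwards [tendsto_fst.eventually (self_mem_nhdsWithin : Set.Ioi (0 : ℝ) ∈ 𝓝[>] 0)]
    with p hp
  have hp' : 0 < p.1 := hp
  have hs : (p.1 : ℂ) ≠ 0 := by exact_mod_cast hp'.ne'
  have hd : (M.d : ℂ) ≠ 0 := by exact_mod_cast M.d_pos.ne'
  have he0 : e p ≠ 0 := Complex.exp_ne_zero _
  have hex : Complex.exp ((τ * (j + (M.m : ℝ)⁻¹ - 1) : ℝ) * p.2 * Complex.I) =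
      Complex.exp (τ * p.2 * Complex.I) ^ j * e p := by
    rw [he, ← Complex.exp_nat_mul, ← Complex.exp_add]
    congr 1
    push_cast
    ring
  have hEz : Complex.exp (τ * p.2 * Complex.I) ≠ 0 := Complex.exp_ne_zero _
  have hpw : (p.1 : ℂ) ^ M.m = p.1 ^ (M.m - 1) * p.1 := by
    rw [← pow_succ, Nat.sub_add_cancel (by have := M.two_le_m; omega)]
  have hwj : (w p) ^ j =
      ((M.d : ℂ) * p.1 ^ M.m) ^ j * Complex.exp (τ * p.2 * Complex.I) ^ j := by
    rw [hw, mul_pow]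
    push_cast
    rfl
  rw [hex, hA, hB, Polynomial.eval_mul, Polynomial.eval_mul, Polynomial.eval_pow,
    Polynomial.eval_X, hwj]
  have hsm : (p.1 : ℂ) ^ (M.m - 1) ≠ 0 := pow_ne_zero _ hs
  push_cast
  rw [hpw]
  field_simp
  ring

namespace RegularCoupling

variable (hM : M.RegularCoupling)
include hM

theorem tendsto_charPlus_atTop : Tendsto (fun p => M.charPlus p / M.polarEnergy p ^ N)
    (atTop ×ˢ 𝓟 (Set.Icc 0 Real.pi)) (𝓝 1) :=
  tendsto_charLike_atTop polarEnergy_eq hM.tendsto_kappaPlus_atTop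

theorem tendsto_conj_kappaPlus_atTop : Tendsto (fun p => (starRingEnd ℂ) (M.kappaPlus p))
    (atTop ×ˢ 𝓟 (Set.Icc 0 Real.pi)) (𝓝 0) := by
  have := (Complex.continuous_conj.tendsto 0).comp hM.tendsto_kappaPlus_atTop
  rwa [map_zero] at this

theorem tendsto_charMinus_atTop :
    Tendsto (fun p => M.charMinus p / (starRingEnd ℂ) (M.polarEnergy p) ^ N)
    (atTop ×ˢ 𝓟 (Set.Icc 0 Real.pi)) (𝓝 1) :=
  tendsto_charLike_atTop conj_polarEnergy hM.tendsto_conj_kappaPlus_atTop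

/-- The threshold behaviour of the scaled self energy. -/
theorem exists_scaledKappa_threshold : ∃ c : ℂ, c ≠ 0 ∧
    Tendsto (fun p : ℝ × ℝ => M.scaledKappa p - c *
      Complex.exp (((1 : ℝ) * ((M.m : ℝ)⁻¹ - 1) : ℝ) * p.2 * Complex.I))
      (𝓝[>] 0 ×ˢ 𝓟 (Set.Icc 0 Real.pi)) (𝓝 0) ∧
    Tendsto (fun p : ℝ × ℝ => (starRingEnd ℂ) (M.scaledKappa p) - (starRingEnd ℂ) c *
      Complex.exp (((-1 : ℝ) * ((M.m : ℝ)⁻¹ - 1) : ℝ) * p.2 * Complex.I))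
      (𝓝[>] 0 ×ˢ 𝓟 (Set.Icc 0 Real.pi)) (𝓝 0) := by
  obtain ⟨c, hc, h⟩ := hM.scaledKappa_edge
  have h1 : Tendsto (fun p : ℝ × ℝ => M.scaledKappa p - c *
      Complex.exp (((1 : ℝ) * ((M.m : ℝ)⁻¹ - 1) : ℝ) * p.2 * Complex.I))
      (𝓝[>] 0 ×ˢ 𝓟 (Set.Icc 0 Real.pi)) (𝓝 0) := by
    refine (tendsto_sub_edge hM.continuousOn_scaledKappa).congr' ?_
    filter_upwards [tendsto_snd.eventually (mem_principal_self (Set.Icc (0 : ℝ) Real.pi))]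
      with p hp
    rw [h p.2 hp, one_mul]
  refine ⟨c, hc, h1, ?_⟩
  have h2 := (Complex.continuous_conj.tendsto 0).comp h1
  rw [map_zero] at h2
  refine h2.congr fun p => ?_
  simp only [Function.comp, map_sub, map_mul, ← Complex.exp_conj, Complex.conj_ofReal,
    Complex.conj_I]
  congr 3
  push_cast
  ring

end RegularCoupling

end EmitterModel

end

/-! ### Zeros of the characteristic function -/

noncomputable section

open Polynomial in
/-- Division of a function of finite order of vanishing by the polynomial of its zeros. -/
theorem exists_eq_prod_mul_of_analyticAt {U : Set ℂ} (hU : IsOpen U) {f : ℂ → ℂ}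
    (hf : DifferentiableOn ℂ f U) (Z : Finset ℂ) (hZU : ∀ z ∈ Z, z ∈ U)
    (hZ : ∀ z ∈ U, f z = 0 → z ∈ Z) (hord : ∀ z ∈ Z, analyticOrderAt f z ≠ ⊤) :
    ∃ h : ℂ → ℂ, ContinuousOn h U ∧ (∀ z ∈ U, h z ≠ 0) ∧ ∀ z ∈ U,
      f z = (∏ y ∈ Z, (X - C y) ^ analyticOrderNatAt f y).eval z * h z := by
  have han : ∀ z ∈ U, AnalyticAt ℂ f z := fun z hz => hf.analyticAt (hU.mem_nhds hz)
  have hloc : ∀ z, ∃ g : ℂ → ℂ, z ∈ Z → AnalyticAt ℂ g z ∧ g z ≠ 0 ∧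
      ∀ᶠ w in 𝓝 z, f w = (w - z) ^ analyticOrderNatAt f z * g w := by
    intro z
    by_cases hz : z ∈ Z
    · have h1 : analyticOrderAt f z = analyticOrderNatAt f z :=
        (Nat.cast_analyticOrderNatAt (hord z hz)).symm
      obtain ⟨g, hg1, hg2, hg3⟩ := (han z (hZU z hz)).analyticOrderAt_eq_natCast.mp h1
      exact ⟨g, fun _ => ⟨hg1, hg2, hg3⟩⟩
    · exact ⟨0, fun h => absurd h hz⟩
  choose g hg using hloc
  set Q : ℂ[X] := ∏ y ∈ Z, (X - C y) ^ analyticOrderNatAt f y with hQ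
  set q : ℂ → ℂ[X] := fun z => ∏ y ∈ Z.erase z, (X - C y) ^ analyticOrderNatAt f y with hq
  have hQe : ∀ w, Q.eval w = ∏ y ∈ Z, (w - y) ^ analyticOrderNatAt f y := by
    intro w; simp [hQ, eval_prod]
  have hqe : ∀ z w, (q z).eval w = ∏ y ∈ Z.erase z, (w - y) ^ analyticOrderNatAt f y := by
    intro z w; simp [hq, eval_prod]
  have hQq : ∀ z ∈ Z, ∀ w, Q.eval w = (w - z) ^ analyticOrderNatAt f z * (q z).eval w := by
    intro z hz w
    rw [hQe, hqe, Finset.mul_prod_erase Z (fun y => (w - y) ^ analyticOrderNatAt f y) hz]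
  have hQ0 : ∀ w, w ∉ Z → Q.eval w ≠ 0 := by
    intro w hw
    rw [hQe, Finset.prod_ne_zero_iff]
    exact fun y hy => pow_ne_zero _ (sub_ne_zero.mpr fun h => hw (h ▸ hy))
  have hq0 : ∀ z, (q z).eval z ≠ 0 := by
    intro z
    rw [hqe, Finset.prod_ne_zero_iff]
    exact fun y hy => pow_ne_zero _ (sub_ne_zero.mpr (Finset.ne_of_mem_erase hy).symm)
  classical
  -- At a zero the quotient takes its removable value: `g z` is the local cofactor of `f`, and `q z`
  -- is `Q` without the factor of `z`.
  set h : ℂ → ℂ := fun z => if z ∈ Z then g z z / (q z).eval z else f z / Q.eval z with hh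
  have hnear : ∀ z ∈ Z, ∀ᶠ w in 𝓝 z, h w = g z w / (q z).eval w := by
    intro z hz
    have hne : ∀ᶠ w in 𝓝 z, (q z).eval w ≠ 0 := (q z).continuous.continuousAt.eventually_ne (hq0 z)
    have hZc : ∀ᶠ w in 𝓝 z, w ∉ Z.erase z :=
      (Z.erase z).finite_toSet.isClosed.isOpen_compl.mem_nhds (by simp)
    filter_upwards [(hg z hz).2.2, hne, hZc] with w h1 h2 h3
    by_cases hwz : w = z
    · rw [hwz, hh]
      simp only [if_pos hz]
    · have hwZ : w ∉ Z := fun hw => h3 (Finset.mem_erase.mpr ⟨hwz, hw⟩)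
      rw [hh]
      simp only [if_neg hwZ]
      rw [h1, hQq z hz]
      exact mul_div_mul_left _ _ (pow_ne_zero _ (sub_ne_zero.mpr hwz))
  refine ⟨h, fun z hz => ContinuousAt.continuousWithinAt ?_, fun z hz => ?_, fun z hz => ?_⟩
  · by_cases hzZ : z ∈ Z
    · refine ContinuousAt.congr ?_ (EventuallyEq.symm (hnear z hzZ))
      exact (hg z hzZ).1.continuousAt.div (q z).continuous.continuousAt (hq0 z)
    · have hZc : ∀ᶠ w in 𝓝 z, w ∉ Z :=
        Z.finite_toSet.isClosed.isOpen_compl.mem_nhds (by simpa using hzZ)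
      have h1 : ContinuousAt (fun w => f w / Q.eval w) z :=
        (han z hz).continuousAt.div Q.continuous.continuousAt (hQ0 z hzZ)
      refine h1.congr ?_
      filter_upwards [hZc] with w hw
      rw [hh]
      simp only [if_neg hw]
  · by_cases hzZ : z ∈ Z
    · rw [hh]
      simp only [if_pos hzZ]
      exact div_ne_zero (hg z hzZ).2.1 (hq0 z)
    · rw [hh]
      simp only [if_neg hzZ]
      exact div_ne_zero (fun h0 => hzZ (hZ z hz h0)) (hQ0 z hzZ)
  · by_cases hzZ : z ∈ Z
    · rw [(hnear z hzZ).self_of_nhds, hQq z hzZ, (hg z hzZ).2.2.self_of_nhds]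
      have := hq0 z
      field_simp
    · have := hQ0 z hzZ
      rw [hh]
      simp only [if_neg hzZ]
      field_simp

namespace EmitterModel

variable {N : ℕ} {M : EmitterModel N}

theorem polarOf_polarEnergy {p : ℝ × ℝ} (hp : p ∈ polarStrip) :
    M.polarOf (M.polarEnergy p) = p := by
  obtain ⟨h1, h2⟩ := hp
  have h1' : 0 < p.1 := h1
  have hd := M.d_pos
  refine Prod.ext ?_ ?_
  · have h3 : ‖M.polarEnergy p‖ = M.d * p.1 ^ M.m := by
      rw [polarEnergy_eq, norm_ofReal_mul_exp (by positivity)]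
    change (‖M.polarEnergy p‖ / M.d) ^ ((M.m : ℝ)⁻¹) = p.1
    rw [h3, mul_div_cancel_left₀ _ hd.ne', Real.pow_rpow_inv_natCast h1'.le M.m_ne_zero]
  · change (M.polarEnergy p).arg = p.2
    have h4 : 0 < M.d * p.1 ^ M.m := by positivity
    have := Real.pi_pos
    rw [polarEnergy, Complex.exp_mul_I]
    exact Complex.arg_mul_cos_add_sin_mul_I h4 ⟨by linarith [h2.1], h2.2⟩

/-- Points of the closed half strip off the gap are energies in the continuum. -/
theorem eq_polarOf_of_notMem_gap {p : ℝ × ℝ} (hp : p ∈ polarStrip) (h : M.polarEnergy p ∉ M.gap) :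
    ∃ E ∈ M.continuum, p = M.polarOf (E : ℂ) ∧ M.polarEnergy p = E := by
  have h1 : ∃ k, M.polarEnergy p = (M.ε k : ℂ) := by
    by_contra hcon
    push Not at hcon
    exact h hcon
  obtain ⟨k, hk⟩ := h1
  refine ⟨M.ε k, ⟨?_, k, rfl⟩, ?_, hk⟩
  · have := M.polarEnergy_ne_zero (p := p) hp.1
    rw [hk] at this
    exact_mod_cast this
  · rw [← hk, polarOf_polarEnergy hp]

namespace RegularCoupling

variable (hM : M.RegularCoupling)
include hM

/-- The characteristic function does not vanish identically near any point. -/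
theorem not_eventually_charFun_eq_zero (ω : ℂ) :
    ¬ ∀ᶠ z in 𝓝 ω, M.charFun z = 0 := by
  intro h
  -- The identity theorem is used in an open half plane, because the gap is disconnected when the
  -- continuum fills both half axes. Vanishing there contradicts the growth like ω^N.
  have key : ∀ U : Set ℂ, IsOpen U → Convex ℝ U → U ⊆ M.gap → ω ∈ closure U →
      ∀ z ∈ U, M.charFun z = 0 := by
    intro U hUo hUc hUg hcl
    obtain ⟨z₀, hz₀, hz₀U⟩ := mem_closure_iff_nhds.mp hcl _ (eventually_eventually_nhds.mpr h)
    have han : AnalyticOnNhd ℂ M.charFun U := fun z hz =>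
      hM.differentiableOn_charFun.analyticAt (M.isOpen_gap.mem_nhds (hUg hz))
    exact fun z hz => han.eqOn_zero_of_preconnected_of_eventuallyEq_zero hUc.isPreconnected hz₀U
      hz₀ hz
  have hev : ∀ {G w : ℝ × ℝ → ℂ}, Tendsto (fun p => G p / w p ^ N)
      (atTop ×ˢ 𝓟 (Set.Icc 0 Real.pi)) (𝓝 1) → ∃ s, 0 < s ∧ G (s, Real.pi / 2) ≠ 0 := by
    intro G w hG
    have hs : Tendsto (fun s : ℝ => (s, Real.pi / 2)) atTop (atTop ×ˢ 𝓟 (Set.Icc 0 Real.pi)) := by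
      refine tendsto_id.prodMk (tendsto_principal.mpr (Eventually.of_forall fun _ => ?_))
      have := Real.pi_pos
      constructor <;> linarith
    obtain ⟨s, h1, h2⟩ := (((hG.comp hs).eventually_ne one_ne_zero).and
      (eventually_gt_atTop 0)).exists
    refine ⟨s, h2, fun h0 => h1 ?_⟩
    simp only [Function.comp]
    rw [h0, zero_div]
  have him : ∀ s : ℝ, 0 < s → 0 < (M.polarEnergy (s, Real.pi / 2)).im := by
    intro s hs
    rw [polarEnergy, Complex.im_ofReal_mul, Complex.exp_ofReal_mul_I_im, Real.sin_pi_div_two,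
      mul_one]
    have := M.d_pos
    positivity
  have hstrip : ∀ s : ℝ, 0 < s → (s, Real.pi / 2) ∈ polarStrip := by
    intro s hs
    have := Real.pi_pos
    exact ⟨hs, by constructor <;> simp only <;> linarith⟩
  rcases le_total 0 ω.im with h0 | h0
  · obtain ⟨s, hs, hne⟩ := hev hM.tendsto_charPlus_atTop
    refine hne ?_
    have hg := M.mem_gap_of_im_ne_zero (him s hs).ne'
    rw [← hM.charFun_eq_charPlus (hstrip s hs) hg]
    refine key {z | 0 < z.im} (isOpen_lt continuous_const Complex.continuous_im)
      (convex_halfSpace_im_gt 0) (fun z hz => M.mem_gap_of_im_ne_zero (ne_of_gt hz)) ?_ _ (him s hs)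
    rw [Complex.closure_setOfPred_lt_im]
    exact h0
  · obtain ⟨s, hs, hne⟩ := hev hM.tendsto_charMinus_atTop
    refine hne ?_
    have hg := M.mem_gap_of_im_ne_zero (him s hs).ne'
    rw [← hM.charFun_eq_charMinus (hstrip s hs) hg]
    refine key {z | z.im < 0} (isOpen_lt Complex.continuous_im continuous_const)
      (convex_halfSpace_im_lt 0) (fun z hz => M.mem_gap_of_im_ne_zero (ne_of_lt hz)) ?_ _ ?_
    · rw [Complex.closure_setOfPred_im_lt]
      exact h0
    · change ((starRingEnd ℂ) _).im < 0
      rw [Complex.conj_im]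
      exact neg_lt_zero.mpr (him s hs)

theorem analyticOrderAt_charFun_ne_top (ω : ℂ) :
    analyticOrderAt M.charFun ω ≠ ⊤ := by
  rw [Ne, analyticOrderAt_eq_top]
  exact hM.not_eventually_charFun_eq_zero ω

/-- The zeros of the characteristic function are finite in number. -/
theorem finite_zeros {a b : Polynomial ℂ} {j : ℕ} (hA : M.polyA = Polynomial.X ^ j * a)
    (hB : M.polyB = Polynomial.X ^ j * b) (hb : b.eval 0 ≠ 0)
    (hplus : ∀ E ∈ M.continuum, M.charPlus (M.polarOf E) ≠ 0)
    (hminus : ∀ E ∈ M.continuum, M.charMinus (M.polarOf E) ≠ 0) :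
    {ω ∈ M.gap | M.charFun ω = 0}.Finite := by
  obtain ⟨c, hc, hc1, hc2⟩ := hM.exists_scaledKappa_threshold
  have hc' : (starRingEnd ℂ) c ≠ 0 := by simpa using hc
  have hne : ∀ {G D : ℝ × ℝ → ℂ} {l : Filter ℝ} {x : ℂ}, x ≠ 0 → Tendsto (fun p => G p / D p)
      (l ×ˢ 𝓟 (Set.Icc 0 Real.pi)) (𝓝 x) → ∀ᶠ s in l, ∀ φ ∈ Set.Icc 0 Real.pi, G (s, φ) ≠ 0 := by
    intro G D l x hx h
    have h1 := h.eventually_ne hx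
    rw [eventually_prod_principal_iff] at h1
    filter_upwards [h1] with s h2 φ hφ h3
    exact h2 φ hφ (by rw [h3, zero_div])
  have hkp : ∀ p, (starRingEnd ℂ) (M.kappaPlus p) =
      (p.1 / (M.d * p.1 ^ M.m) : ℝ) * (starRingEnd ℂ) (M.scaledKappa p) := by
    intro p; rw [kappaPlus, map_mul, Complex.conj_ofReal]
  have h1 := hne one_ne_zero hM.tendsto_charPlus_atTop
  have h2 := hne one_ne_zero hM.tendsto_charMinus_atTop
  have h3 := hne (G := M.charPlus) (mul_ne_zero hc hb)
    (tendsto_charLike_threshold polarEnergy_eq hc1 hA hB)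
  have h4 := hne (G := M.charMinus) (mul_ne_zero hc' hb) ((tendsto_charLike_threshold
    conj_polarEnergy hc2 hA hB).congr fun p => by rw [charMinus, hkp])
  obtain ⟨R, hR⟩ := eventually_atTop.mp (h1.and h2)
  obtain ⟨r, hr0, hr⟩ := mem_nhdsGT_iff_exists_Ioo_subset.mp (h3.and h4)
  have hr0' : 0 < r := hr0
  have hval : ∀ ω ∈ M.gap, ∃ φ ∈ Set.Icc 0 Real.pi, M.charFun ω = 0 →
      (M.charPlus ((M.polarOf ω).1, φ) = 0 ∨ M.charMinus ((M.polarOf ω).1, φ) = 0) := by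
    intro ω hω
    have hω0 := (M.mem_gap_iff.mp hω).1
    rcases le_total 0 ω.im with him | him
    · refine ⟨_, (M.polarOf_mem hω0 him).2, fun h0 => Or.inl ?_⟩
      rw [Prod.mk.eta, ← hM.charFun_eq_charPlus (M.polarOf_mem hω0 him)
        (by rwa [polarEnergy_polarOf]), polarEnergy_polarOf, h0]
    · have hconj : (starRingEnd ℂ) ω ≠ 0 := by simpa using hω0
      have hmem := M.polarOf_mem hconj (by rw [Complex.conj_im]; linarith)
      have hfst : (M.polarOf ((starRingEnd ℂ) ω)).1 = (M.polarOf ω).1 := by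
        rw [polarOf, polarOf, RCLike.norm_conj]
      refine ⟨_, hmem.2, fun h0 => Or.inr ?_⟩
      rw [← hfst, Prod.mk.eta, ← hM.charFun_eq_charMinus hmem
        (by rw [polarEnergy_polarOf]; exact M.conj_mem_gap.mpr hω), polarEnergy_polarOf,
        Complex.conj_conj, h0]
  -- The asymptotic laws exclude zeros of very large and of very small modulus, so all zeros lie in
  -- a compact annulus.
  have hsub : {ω ∈ M.gap | M.charFun ω = 0} ⊆
      Metric.closedBall 0 (M.d * (max R 0) ^ M.m) \ Metric.ball 0 (M.d * r ^ M.m) := by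
    rintro ω ⟨hω, h0⟩
    obtain ⟨φ, hφ, hz⟩ := hval ω hω
    have hz := hz h0
    have hω0 := (M.mem_gap_iff.mp hω).1
    have hs := M.polarOf_fst_pos hω0
    have hd := M.d_pos
    rw [Set.mem_sdiff, mem_closedBall_zero_iff, mem_ball_zero_iff, ← M.d_mul_polarOf_pow]
    constructor
    · have : (M.polarOf ω).1 ≤ R := by
        by_contra hlt
        have h5 := hR _ (not_le.mp hlt).le
        rcases hz with hz | hz
        · exact h5.1 φ hφ hz
        · exact h5.2 φ hφ hz
      have h6 := this.trans (le_max_left R 0)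
      gcongr
    · rw [not_lt]
      have : r ≤ (M.polarOf ω).1 := by
        by_contra hlt
        have h5 := hr ⟨hs, not_le.mp hlt⟩
        rcases hz with hz | hz
        · exact h5.1 φ hφ hz
        · exact h5.2 φ hφ hz
      gcongr
  have hcompact : IsCompact (Metric.closedBall (0 : ℂ) (M.d * (max R 0) ^ M.m) \
      Metric.ball 0 (M.d * r ^ M.m)) := (isCompact_closedBall _ _).diff Metric.isOpen_ball
  by_contra hinf
  obtain ⟨x, hxK, hacc⟩ := Set.Infinite.exists_accPt_of_subset_isCompact hinf hcompact hsub
  rw [accPt_iff_frequently_nhdsNE] at hacc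
  have hx0 : x ≠ 0 := by
    rintro rfl
    refine hxK.2 (Metric.mem_ball_self ?_)
    have hd := M.d_pos
    positivity
  -- An accumulation point in the gap contradicts the identity theorem. One on the continuum
  -- contradicts the nonvanishing boundary values from the upper or from the lower side.
  by_cases hx : x ∈ M.gap
  · have han : AnalyticAt ℂ M.charFun x :=
      hM.differentiableOn_charFun.analyticAt (M.isOpen_gap.mem_nhds hx)
    exact hM.not_eventually_charFun_eq_zero x
      (han.frequently_zero_iff_eventually_zero.mp (hacc.mono fun y hy => hy.2))
  · obtain ⟨k, hk⟩ : ∃ k, x = (M.ε k : ℂ) := by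
      by_contra hcon
      push Not at hcon
      exact hx hcon
    have hE : M.ε k ∈ M.continuum := ⟨by rw [hk] at hx0; exact_mod_cast hx0, k, rfl⟩
    have hcont : ∀ {G : ℝ × ℝ → ℂ}, ContinuousOn G polarStrip → G (M.polarOf x) ≠ 0 →
        ∀ᶠ y in 𝓝 x, 0 ≤ y.im → y ≠ 0 → G (M.polarOf y) ≠ 0 := by
      intro G hG hGx
      have hxim : 0 ≤ x.im := by rw [hk, Complex.ofReal_im]
      have h5 : ContinuousWithinAt (fun y => G (M.polarOf y)) ({z | 0 ≤ z.im} \ {0}) x :=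
        (hG _ (M.polarOf_mem hx0 hxim)).comp
          ((M.continuousWithinAt_polarOf hx0).mono Set.sdiff_subset)
          fun y hy => M.polarOf_mem hy.2 hy.1
      have h6 := h5.eventually_ne hGx
      rw [eventually_nhdsWithin_iff] at h6
      filter_upwards [h6] with y hy h7 h8
      exact hy ⟨h7, h8⟩
    have h5 := hcont hM.continuousOn_charPlus (by rw [hk]; exact hplus _ hE)
    have h6 := hcont hM.continuousOn_charMinus (by rw [hk]; exact hminus _ hE)
    have h6' : ∀ᶠ y in 𝓝 x, 0 ≤ ((starRingEnd ℂ) y).im → (starRingEnd ℂ) y ≠ 0 →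
        M.charMinus (M.polarOf ((starRingEnd ℂ) y)) ≠ 0 := by
      have h7 : Tendsto (starRingEnd ℂ) (𝓝 x) (𝓝 x) := by
        have := Complex.continuous_conj.tendsto x
        rwa [hk, Complex.conj_ofReal, ← hk] at this
      exact h7.eventually h6
    obtain ⟨y, hy, h7, h8⟩ := (hacc.and_eventually
      ((h5.and h6').filter_mono nhdsWithin_le_nhds)).exists
    have hy0 := (M.mem_gap_iff.mp hy.1).1
    rcases le_total 0 y.im with him | him
    · refine h7 him hy0 ?_
      rw [← hM.charFun_eq_charPlus (M.polarOf_mem hy0 him) (by rw [polarEnergy_polarOf]; exact hy.1),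
        polarEnergy_polarOf, hy.2]
    · have hconj : (starRingEnd ℂ) y ≠ 0 := by simpa using hy0
      have hcim : 0 ≤ ((starRingEnd ℂ) y).im := by rw [Complex.conj_im]; linarith
      refine h8 hcim hconj ?_
      rw [← hM.charFun_eq_charMinus (M.polarOf_mem hconj hcim)
        (by rw [polarEnergy_polarOf]; exact M.conj_mem_gap.mpr hy.1), polarEnergy_polarOf,
        Complex.conj_conj, hy.2]

end RegularCoupling

end EmitterModel

end

/-! ### Phases of the boundary values and their limits along the axes -/

noncomputable section

namespace EmitterModel

variable {N : ℕ} {M : EmitterModel N}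

/-- Boundary values on the closed half strip, divided by the polynomial of the zeros. -/
theorem exists_boundary_quotient {G w : ℝ × ℝ → ℂ} (hw : Continuous w)
    (hG : ContinuousOn G polarStrip)
    (hGw : ∀ p ∈ polarStrip, w p ∈ M.gap → M.charFun (w p) = G p)
    (hG0 : ∀ p ∈ polarStrip, w p ∉ M.gap → G p ≠ 0) {h : ℂ → ℂ} {Q : Polynomial ℂ}
    (hh : ContinuousOn h M.gap) (hh0 : ∀ z ∈ M.gap, h z ≠ 0)
    (hfac : ∀ z ∈ M.gap, M.charFun z = Q.eval z * h z) (hQ : ∀ z ∉ M.gap, Q.eval z ≠ 0) :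
    ∃ F : ℝ × ℝ → ℂ, ContinuousOn F polarStrip ∧ (∀ p ∈ polarStrip, F p ≠ 0) ∧
      (∀ p ∈ polarStrip, F p * Q.eval (w p) = G p) ∧
      ∀ p ∈ polarStrip, w p ∈ M.gap → F p = h (w p) := by
  classical
  -- Both branches agree wherever `Q` does not vanish, and `Q` has no zeros on the continuum. This
  -- gives continuity across the transition.
  set F : ℝ × ℝ → ℂ := fun p => if w p ∈ M.gap then h (w p) else G p / Q.eval (w p) with hF
  have hin : ∀ p, w p ∈ M.gap → F p = h (w p) := fun p hp => if_pos hp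
  have hout : ∀ p, w p ∉ M.gap → F p = G p / Q.eval (w p) := fun p hp => if_neg hp
  have hmul : ∀ p ∈ polarStrip, F p * Q.eval (w p) = G p := by
    intro p hp
    by_cases hg : w p ∈ M.gap
    · rw [hin p hg, ← hGw p hp hg, hfac _ hg, mul_comm]
    · rw [hout p hg, div_mul_cancel₀ _ (hQ _ hg)]
  refine ⟨F, fun p hp => ?_, fun p hp => ?_, hmul, fun p _ => hin p⟩
  · by_cases hg : w p ∈ M.gap
    · have h1 : ContinuousAt (fun p => h (w p)) p :=
        (hh.continuousAt (M.isOpen_gap.mem_nhds hg)).comp (f := w) hw.continuousAt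
      refine (h1.congr ?_).continuousWithinAt
      filter_upwards [(M.isOpen_gap.preimage hw).mem_nhds hg] with q hq
      exact (hin q hq).symm
    · have hQc : Continuous fun p => Q.eval (w p) := Q.continuous.comp hw
      have h1 : ContinuousWithinAt (fun p => G p / Q.eval (w p)) polarStrip p :=
        (hG p hp).div hQc.continuousWithinAt (hQ _ hg)
      refine h1.congr_of_eventuallyEq ?_ (hout p hg)
      filter_upwards [self_mem_nhdsWithin,
        (hQc.continuousAt.eventually_ne (hQ _ hg)).filter_mono nhdsWithin_le_nhds] with q h2 h3
      rw [← hmul q h2, mul_div_cancel_right₀ _ h3]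
  · by_cases hg : w p ∈ M.gap
    · rw [hin p hg]
      exact hh0 _ hg
    · rw [hout p hg]
      exact div_ne_zero (hG0 p hp hg) (hQ _ hg)

/-- Increments of the phase of the boundary values along the arcs at infinity and at threshold. -/
theorem exists_phase_limits {τ : ℝ} {w G F : ℝ × ℝ → ℂ} {Q : Polynomial ℂ}
    {R₀ : ℝ → ℝ} {t : ℝ} {c : ℂ} (hQm : Q.Monic) (hQ0 : Q.eval 0 ≠ 0)
    (hw : ∀ p, w p = (M.d * p.1 ^ M.m : ℝ) * Complex.exp (τ * p.2 * Complex.I))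
    (hF : ContinuousOn F polarStrip) (hF0 : ∀ p ∈ polarStrip, F p ≠ 0)
    (hFG : ∀ p ∈ polarStrip, F p * Q.eval (w p) = G p)
    (hG : Tendsto (fun p => G p / w p ^ N) (atTop ×ˢ 𝓟 (Set.Icc 0 Real.pi)) (𝓝 1))
    (hR₀ : ∀ s, 0 < s → 0 < R₀ s) (hc : c ≠ 0)
    (hG0 : Tendsto (fun p => G p / (R₀ p.1 * Complex.exp (t * p.2 * Complex.I)))
      (𝓝[>] 0 ×ˢ 𝓟 (Set.Icc 0 Real.pi)) (𝓝 c)) :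
    ∃ θ : ℝ × ℝ → ℝ, ContinuousOn θ polarStrip ∧
      (∀ p ∈ polarStrip, F p = ‖F p‖ * Complex.exp (θ p * Complex.I)) ∧
      (∃ a, Tendsto (fun s => θ (s, 0)) atTop (𝓝 a) ∧
        Tendsto (fun s => θ (s, Real.pi)) atTop
          (𝓝 (a + (τ * ((N : ℝ) - Q.natDegree)) * Real.pi))) ∧
      ∃ a, Tendsto (fun s => θ (s, 0)) (𝓝[>] 0) (𝓝 a) ∧
        Tendsto (fun s => θ (s, Real.pi)) (𝓝[>] 0) (𝓝 (a + t * Real.pi)) := by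
  have hd := M.d_pos
  obtain ⟨θ, hθ, hθF⟩ := exists_continuousOn_phase hF hF0
  refine ⟨θ, hθ, hθF, ?_, ?_⟩
  -- At infinity `F = G / Q` behaves like the power N - deg Q of `w`.
  · refine tendsto_phase hθ hθF atTop_tail_preconnected
      (R := fun s => (M.d * s ^ M.m) ^ N / (M.d * s ^ M.m) ^ Q.natDegree)
      (fun s hs => by positivity) one_ne_zero ?_
    have hQt : Tendsto (fun p => Q.eval (w p) / w p ^ Q.natDegree)
        (atTop ×ˢ 𝓟 (Set.Icc 0 Real.pi)) (𝓝 1) := by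
      have h1 := (Q.tendsto_eval_div_pow_cobounded le_rfl).comp
        (tendsto_cobounded_of_polar hw (Set.Icc 0 Real.pi))
      rwa [hQm.coeff_natDegree] at h1
    have h2 := hG.div hQt one_ne_zero
    rw [div_one] at h2
    refine h2.congr' ?_
    filter_upwards [hQt.eventually_ne one_ne_zero,
      tendsto_fst.eventually (eventually_gt_atTop (0 : ℝ)),
      tendsto_snd.eventually (mem_principal_self (Set.Icc (0 : ℝ) Real.pi))] with p h3 h4 h5
    rw [Pi.div_apply, ← hFG p ⟨h4, h5⟩]
    have hr : ((M.d * p.1 ^ M.m : ℝ) : ℂ) ≠ 0 := by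
      exact_mod_cast (by positivity : (0 : ℝ) < M.d * p.1 ^ M.m).ne'
    have hQw : Q.eval (w p) ≠ 0 := fun h0 => h3 (by rw [h0, zero_div])
    have hexp : Complex.exp ((τ * ((N : ℝ) - Q.natDegree) : ℝ) * p.2 * Complex.I) =
        Complex.exp (τ * p.2 * Complex.I) ^ N /
          Complex.exp (τ * p.2 * Complex.I) ^ Q.natDegree := by
      rw [← Complex.exp_nat_mul, ← Complex.exp_nat_mul, ← Complex.exp_sub]
      congr 1
      push_cast
      ring
    have he : Complex.exp (τ * p.2 * Complex.I) ≠ 0 := Complex.exp_ne_zero _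
    rw [hexp, hw]
    rw [hw] at hQw
    push_cast at hr hQw ⊢
    simp only [mul_pow] at hr ⊢
    field_simp
  · have hw0 := tendsto_zero_of_polar hw (Set.Icc 0 Real.pi)
    have hQt : Tendsto (fun p => Q.eval (w p)) (𝓝[>] 0 ×ˢ 𝓟 (Set.Icc 0 Real.pi))
        (𝓝 (Q.eval 0)) := (Q.continuous.tendsto 0).comp hw0
    refine tendsto_phase hθ hθF nhdsGT_tail_preconnected (R := R₀) hR₀
      (div_ne_zero hc hQ0) ((hG0.div hQt hQ0).congr' ?_)
    filter_upwards [hQt.eventually_ne hQ0,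
      tendsto_fst.eventually (self_mem_nhdsWithin : Set.Ioi (0 : ℝ) ∈ 𝓝[>] 0),
      tendsto_snd.eventually (mem_principal_self (Set.Icc (0 : ℝ) Real.pi))] with p h3 h4 h5
    rw [Pi.div_apply, ← hFG p ⟨h4, h5⟩]
    field_simp

/-- Rescaling k multiplies ε(k) by any positive factor, so each open half axis either belongs to the
continuum or is disjoint from it. -/
theorem mem_continuum_of_mul_pos {E E' : ℝ} (hE : E ∈ M.continuum) (h : 0 < E * E') :
    E' ∈ M.continuum := by
  obtain ⟨h0, k, hk⟩ := hE
  have h1 : 0 < E' / E := by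
    rcases mul_pos_iff.mp h with h | h
    · exact div_pos h.2 h.1
    · exact div_pos_of_neg_of_neg h.2 h.1
  refine ⟨fun h2 => by simp [h2] at h, (E' / E) ^ ((M.m : ℝ)⁻¹) * k, ?_⟩
  rw [ε, mul_pow, Real.rpow_inv_natCast_pow h1.le M.m_ne_zero]
  rw [ε] at hk
  calc _ = E' / E * (M.σ * M.d * k ^ M.m) := by ring
    _ = E' := by rw [hk]; field_simp

theorem mem_gap_of_notMem_continuum {E : ℝ} (h0 : E ≠ 0) (h : E ∉ M.continuum) :
    (E : ℂ) ∈ M.gap := by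
  intro k hk
  exact h ⟨h0, k, by exact_mod_cast hk.symm⟩

variable (M) in
/-- The radial polar coordinate of the energies of modulus `r`. -/
def radius (r : ℝ) : ℝ := (r / M.d) ^ ((M.m : ℝ)⁻¹)

theorem tendsto_radius_inv_atTop : Tendsto M.radius atTop atTop :=
  (tendsto_rpow_atTop (inv_pos.mpr M.m_pos)).comp (tendsto_id.atTop_div_const M.d_pos)

theorem tendsto_radius_nhdsGT : Tendsto M.radius (𝓝[>] 0) (𝓝[>] 0) := by
  refine tendsto_nhdsWithin_iff.mpr ⟨?_, ?_⟩
  · have hc : ContinuousAt M.radius 0 := by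
      refine ContinuousAt.rpow_const (by fun_prop) (Or.inr (inv_pos.mpr M.m_pos).le)
    have h := hc.tendsto
    rw [radius, zero_div, Real.zero_rpow (inv_pos.mpr M.m_pos).ne'] at h
    exact h.mono_left nhdsWithin_le_nhds
  · filter_upwards [self_mem_nhdsWithin] with r hr
    exact Real.rpow_pos_of_pos (div_pos hr M.d_pos) _

theorem polarOf_of_pos {E : ℝ} (h : 0 < E) : M.polarOf (E : ℂ) = (M.radius |E|, 0) := by
  rw [polarOf, Complex.norm_real, Complex.arg_ofReal_of_nonneg h.le, radius, Real.norm_eq_abs]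

theorem polarOf_of_neg {E : ℝ} (h : E < 0) : M.polarOf (E : ℂ) = (M.radius |E|, Real.pi) := by
  rw [polarOf, Complex.norm_real, Complex.arg_ofReal_of_neg h, radius, Real.norm_eq_abs]

theorem tendsto_abs_nhdsGT : Tendsto (fun E : ℝ => |E|) (𝓝[>] 0) (𝓝[>] 0) :=
  tendsto_id.congr' (by
    filter_upwards [self_mem_nhdsWithin] with E hE
    exact (abs_of_pos hE).symm)

theorem tendsto_abs_nhdsLT : Tendsto (fun E : ℝ => |E|) (𝓝[<] 0) (𝓝[>] 0) := by
  have h : Tendsto (fun E : ℝ => -E) (𝓝[<] 0) (𝓝[>] 0) := by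
    simpa using tendsto_neg_nhdsLT (a := (0 : ℝ))
  refine h.congr' ?_
  filter_upwards [self_mem_nhdsWithin] with E hE
  exact (abs_of_neg hE).symm

section Limits

variable {X : Type*} {f : ℝ × ℝ → X} {l : Filter X}

theorem tendsto_comp_polarOf_atTop (h : Tendsto (fun s => f (s, 0)) atTop l) :
    Tendsto (fun E : ℝ => f (M.polarOf E)) atTop l := by
  refine (h.comp ((tendsto_radius_inv_atTop (M := M)).comp tendsto_abs_atTop_atTop)).congr' ?_
  filter_upwards [eventually_gt_atTop 0] with E hE
  rw [polarOf_of_pos hE]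
  rfl

theorem tendsto_comp_polarOf_atBot (h : Tendsto (fun s => f (s, Real.pi)) atTop l) :
    Tendsto (fun E : ℝ => f (M.polarOf E)) atBot l := by
  refine (h.comp ((tendsto_radius_inv_atTop (M := M)).comp tendsto_abs_atBot_atTop)).congr' ?_
  filter_upwards [eventually_lt_atBot 0] with E hE
  rw [polarOf_of_neg hE]
  rfl

theorem tendsto_comp_polarOf_nhdsGT (h : Tendsto (fun s => f (s, 0)) (𝓝[>] 0) l) :
    Tendsto (fun E : ℝ => f (M.polarOf E)) (𝓝[>] 0) l := by
  refine (h.comp ((tendsto_radius_nhdsGT (M := M)).comp tendsto_abs_nhdsGT)).congr' ?_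
  filter_upwards [self_mem_nhdsWithin] with E hE
  rw [polarOf_of_pos hE]
  rfl

theorem tendsto_comp_polarOf_nhdsLT (h : Tendsto (fun s => f (s, Real.pi)) (𝓝[>] 0) l) :
    Tendsto (fun E : ℝ => f (M.polarOf E)) (𝓝[<] 0) l := by
  refine (h.comp ((tendsto_radius_nhdsGT (M := M)).comp tendsto_abs_nhdsLT)).congr' ?_
  filter_upwards [self_mem_nhdsWithin] with E hE
  rw [polarOf_of_neg hE]
  rfl

end Limits

theorem continuousAt_polarOf_ofReal {E : ℝ} (hE : E ≠ 0) :
    ContinuousAt (fun E : ℝ => M.polarOf E) E := by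
  have h1 : ContinuousWithinAt M.polarOf {z | 0 ≤ z.im} (E : ℂ) :=
    M.continuousWithinAt_polarOf (by exact_mod_cast hE)
  rw [← continuousWithinAt_univ]
  exact h1.comp (f := fun E : ℝ => (E : ℂ)) Complex.continuous_ofReal.continuousWithinAt
    fun x _ => by simp

/-- Two phases of the same nowhere vanishing function along an edge of the strip have the same
increments. -/
theorem sub_eq_of_common_values {F₁ F₂ : ℝ × ℝ → ℂ} {θ₁ θ₂ : ℝ × ℝ → ℝ} {φ : ℝ}
    (hφ : φ ∈ Set.Icc 0 Real.pi)
    (hθ₁ : ContinuousOn θ₁ polarStrip) (hθ₂ : ContinuousOn θ₂ polarStrip)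
    (h₁ : ∀ p ∈ polarStrip, F₁ p = ‖F₁ p‖ * Complex.exp (θ₁ p * Complex.I))
    (h₂ : ∀ p ∈ polarStrip, F₂ p = ‖F₂ p‖ * Complex.exp (θ₂ p * Complex.I))
    (h0 : ∀ p ∈ polarStrip, F₁ p ≠ 0) (heq : ∀ s, 0 < s → F₁ (s, φ) = F₂ (s, φ))
    {a₁ a₂ b₁ b₂ : ℝ} (ha₁ : Tendsto (fun s => θ₁ (s, φ)) atTop (𝓝 a₁))
    (ha₂ : Tendsto (fun s => θ₂ (s, φ)) atTop (𝓝 a₂))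
    (hb₁ : Tendsto (fun s => θ₁ (s, φ)) (𝓝[>] 0) (𝓝 b₁))
    (hb₂ : Tendsto (fun s => θ₂ (s, φ)) (𝓝[>] 0) (𝓝 b₂)) : a₁ - a₂ = b₁ - b₂ := by
  have hmem : ∀ s, 0 < s → (s, φ) ∈ polarStrip := fun s hs => ⟨hs, hφ⟩
  have hedge : Continuous fun s : ℝ => (s, φ) := by fun_prop
  have hconst : ∀ s, 0 < s → θ₁ (s, φ) - θ₂ (s, φ) = θ₁ (1, φ) - θ₂ (1, φ) := by
    intro s hs
    refine (convex_Ioi (0 : ℝ)).isPreconnected.sub_eq_of_exp_eq (f := fun s => θ₁ (s, φ))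
      (g := fun s => θ₂ (s, φ)) (hθ₁.comp hedge.continuousOn hmem)
      (hθ₂.comp hedge.continuousOn hmem) (fun x hx => ?_) hs (Set.mem_Ioi.mpr one_pos)
    have hn : ((‖F₁ (x, φ)‖ : ℝ) : ℂ) ≠ 0 := by
      exact_mod_cast norm_ne_zero_iff.mpr (h0 _ (hmem x hx))
    apply mul_left_cancel₀ hn
    rw [← h₁ _ (hmem x hx)]
    conv_rhs => rw [heq x hx]
    rw [← h₂ _ (hmem x hx), heq x hx]
  have h3 : Tendsto (fun s => θ₁ (s, φ) - θ₂ (s, φ)) atTop (𝓝 (θ₁ (1, φ) - θ₂ (1, φ))) :=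
    tendsto_const_nhds.congr' (by
      filter_upwards [eventually_gt_atTop 0] with s hs
      exact (hconst s hs).symm)
  have h4 : Tendsto (fun s => θ₁ (s, φ) - θ₂ (s, φ)) (𝓝[>] 0) (𝓝 (θ₁ (1, φ) - θ₂ (1, φ))) :=
    tendsto_const_nhds.congr' (by
      filter_upwards [self_mem_nhdsWithin] with s hs
      exact (hconst s hs).symm)
  rw [tendsto_nhds_unique (ha₁.sub ha₂) h3, tendsto_nhds_unique (hb₁.sub hb₂) h4]

end EmitterModel

end

/-! ### The winding phase -/

noncomputable section

namespace EmitterModel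

variable {N : ℕ} {M : EmitterModel N}

/-- Dark states are common zeros of both polynomials. That `polyB` has no further zero at 0 is where
the absence of bright zero-energy eigenstates enters. -/
theorem exists_dark_factorization (h0 : M.V 0 ≠ 0)
    (hKR : ∀ x : Fin N → ℂ, (star x ⬝ᵥ (M.KR *ᵥ x)).im ≤ 0)
    (h_bright : ¬ M.HasBrightZeroEnergyEigenstate) :
    ∃ a b : Polynomial ℂ, M.polyA = Polynomial.X ^ Module.finrank ℂ M.darkSpace * a ∧
      M.polyB = Polynomial.X ^ Module.finrank ℂ M.darkSpace * b ∧ b.eval 0 ≠ 0 := by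
  obtain ⟨a, ha⟩ := (pow_dvd_pow _ (finrank_darkSpace_le (M := M))).trans
    (Polynomial.pow_rootMultiplicity_dvd M.polyA 0)
  obtain ⟨b, hb, hb0⟩ :=
    Polynomial.exists_eq_pow_rootMultiplicity_mul_and_not_dvd M.polyB M.polyB_ne_zero 0
  rw [rootMultiplicity_polyB h0 hKR h_bright] at hb
  rw [Polynomial.C_0, sub_zero] at ha hb hb0
  refine ⟨a, b, ha, hb, ?_⟩
  rwa [Ne, ← Polynomial.IsRoot.def, ← Polynomial.dvd_iff_isRoot, Polynomial.C_0, sub_zero]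

theorem tendsto_charPlus_threshold {c : ℂ} (hc1 : Tendsto (fun p : ℝ × ℝ => M.scaledKappa p - c *
      Complex.exp (((1 : ℝ) * ((M.m : ℝ)⁻¹ - 1) : ℝ) * p.2 * Complex.I))
      (𝓝[>] 0 ×ˢ 𝓟 (Set.Icc 0 Real.pi)) (𝓝 0)) {a b : Polynomial ℂ} {j : ℕ}
    (hA : M.polyA = Polynomial.X ^ j * a) (hB : M.polyB = Polynomial.X ^ j * b) :
    Tendsto (fun p : ℝ × ℝ => M.charPlus p /
        (((M.d * p.1 ^ M.m) ^ j * (p.1 / (M.d * p.1 ^ M.m)) : ℝ) *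
          Complex.exp (((1 : ℝ) * (j + (M.m : ℝ)⁻¹ - 1) : ℝ) * p.2 * Complex.I)))
      (𝓝[>] 0 ×ˢ 𝓟 (Set.Icc 0 Real.pi)) (𝓝 (c * b.eval 0)) :=
  tendsto_charLike_threshold polarEnergy_eq hc1 hA hB

theorem tendsto_charMinus_threshold {c : ℂ}
    (hc2 : Tendsto (fun p : ℝ × ℝ => (starRingEnd ℂ) (M.scaledKappa p) - (starRingEnd ℂ) c *
      Complex.exp (((-1 : ℝ) * ((M.m : ℝ)⁻¹ - 1) : ℝ) * p.2 * Complex.I))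
      (𝓝[>] 0 ×ˢ 𝓟 (Set.Icc 0 Real.pi)) (𝓝 0)) {a b : Polynomial ℂ} {j : ℕ}
    (hA : M.polyA = Polynomial.X ^ j * a) (hB : M.polyB = Polynomial.X ^ j * b) :
    Tendsto (fun p : ℝ × ℝ => M.charMinus p /
        (((M.d * p.1 ^ M.m) ^ j * (p.1 / (M.d * p.1 ^ M.m)) : ℝ) *
          Complex.exp (((-1 : ℝ) * (j + (M.m : ℝ)⁻¹ - 1) : ℝ) * p.2 * Complex.I)))
      (𝓝[>] 0 ×ˢ 𝓟 (Set.Icc 0 Real.pi)) (𝓝 ((starRingEnd ℂ) c * b.eval 0)) :=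
  (tendsto_charLike_threshold conj_polarEnergy hc2 hA hB).congr fun p => by
    rw [charMinus, kappaPlus, map_mul, Complex.conj_ofReal]

theorem threshold_modulus_pos (j : ℕ) {s : ℝ} (hs : 0 < s) :
    0 < (M.d * s ^ M.m) ^ j * (s / (M.d * s ^ M.m)) := by
  have := M.d_pos
  positivity

namespace RegularCoupling

variable (hM : M.RegularCoupling)
include hM

/-- The argument principle on the cut plane. The phases of the zero-free quotients on the two half
planes turn by opposite amounts, known at infinity and at threshold, and det S is the ratio of these
quotients on the cut. -/
theorem hasWindingPhase {a b : Polynomial ℂ} {j : ℕ} (hA : M.polyA = Polynomial.X ^ j * a)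
    (hB : M.polyB = Polynomial.X ^ j * b) (hb : b.eval 0 ≠ 0)
    (hplus : ∀ E ∈ M.continuum, M.charPlus (M.polarOf E) ≠ 0)
    (hminus : ∀ E ∈ M.continuum, M.charMinus (M.polarOf E) ≠ 0) {Z : Finset ℂ}
    (hZ : ∀ z, z ∈ Z ↔ z ∈ M.gap ∧ M.charFun z = 0) :
    M.HasWindingPhase (Real.pi * ((N : ℝ) - ((j + ∑ z ∈ Z, analyticOrderNatAt M.charFun z : ℕ) : ℝ))
      + Real.pi * (((M.m : ℝ) - 1) / M.m)) := by
  obtain ⟨h, hh, hh0, hfac⟩ := exists_eq_prod_mul_of_analyticAt M.isOpen_gap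
    hM.differentiableOn_charFun Z (fun z hz => ((hZ z).mp hz).1) (fun z hz h0 => (hZ z).mpr ⟨hz, h0⟩)
    (fun z _ => hM.analyticOrderAt_charFun_ne_top z)
  set n := ∑ z ∈ Z, analyticOrderNatAt M.charFun z with hn
  set Q : Polynomial ℂ := ∏ y ∈ Z, (Polynomial.X - Polynomial.C y) ^ analyticOrderNatAt M.charFun y
    with hQdef
  have hQm : Q.Monic := Polynomial.monic_prod_of_monic _ _ fun y _ =>
    (Polynomial.monic_X_sub_C y).pow _
  have hQdeg : Q.natDegree = n := by
    rw [hQdef, Polynomial.natDegree_prod_of_monic _ _ fun y _ => (Polynomial.monic_X_sub_C y).pow _]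
    simp [hn]
  have hQ : ∀ z ∉ M.gap, Q.eval z ≠ 0 := by
    intro z hz
    rw [hQdef, Polynomial.eval_prod, Finset.prod_ne_zero_iff]
    intro y hy h0
    rw [Polynomial.eval_pow, Polynomial.eval_sub, Polynomial.eval_X, Polynomial.eval_C] at h0
    rw [sub_eq_zero.mp (by_contra fun hne => pow_ne_zero _ hne h0)] at hz
    exact hz ((hZ y).mp hy).1
  have h0gap : (0 : ℂ) ∉ M.gap := fun h0 => (M.mem_gap_iff.mp h0).1 rfl
  have hconj : Continuous fun p => (starRingEnd ℂ) (M.polarEnergy p) :=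
    Complex.continuous_conj.comp M.continuous_polarEnergy
  obtain ⟨F₁, hF₁, hF₁0, hF₁G, hF₁h⟩ := exists_boundary_quotient M.continuous_polarEnergy
    hM.continuousOn_charPlus (fun p hp hg => hM.charFun_eq_charPlus hp hg)
    (fun p hp hg => by
      obtain ⟨E, hE, rfl, -⟩ := eq_polarOf_of_notMem_gap hp hg
      exact hplus E hE) hh hh0 hfac hQ
  obtain ⟨F₂, hF₂, hF₂0, hF₂G, hF₂h⟩ := exists_boundary_quotient hconj
    hM.continuousOn_charMinus (fun p hp hg => hM.charFun_eq_charMinus hp (M.conj_mem_gap.mp hg))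
    (fun p hp hg => by
      obtain ⟨E, hE, rfl, -⟩ := eq_polarOf_of_notMem_gap hp fun h => hg (M.conj_mem_gap.mpr h)
      exact hminus E hE) hh hh0 hfac hQ
  obtain ⟨c, hc, hc1, hc2⟩ := hM.exists_scaledKappa_threshold
  have hc' : (starRingEnd ℂ) c ≠ 0 := by simpa using hc
  obtain ⟨θ₁, hθ₁, hθF₁, ⟨a₁, ha₁, ha₁'⟩, ⟨b₁, hb₁, hb₁'⟩⟩ := exists_phase_limits hQm (hQ 0 h0gap)
    polarEnergy_eq hF₁ hF₁0 hF₁G hM.tendsto_charPlus_atTop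
    (fun _ => threshold_modulus_pos j) (mul_ne_zero hc hb)
    (tendsto_charPlus_threshold hc1 hA hB)
  obtain ⟨θ₂, hθ₂, hθF₂, ⟨a₂, ha₂, ha₂'⟩, ⟨b₂, hb₂, hb₂'⟩⟩ := exists_phase_limits hQm (hQ 0 h0gap)
    conj_polarEnergy hF₂ hF₂0 hF₂G hM.tendsto_charMinus_atTop
    (fun _ => threshold_modulus_pos j) (mul_ne_zero hc' hb)
    (tendsto_charMinus_threshold hc2 hA hB)
  rw [hQdeg] at ha₁' ha₂'
  -- the two boundary values agree on an edge that lies in the gap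
  have hcommon : ∀ φ ∈ Set.Icc 0 Real.pi, (∀ s, 0 < s → ∃ E : ℝ, M.polarEnergy (s, φ) = E ∧
      (E : ℂ) ∈ M.gap) → ∀ s, 0 < s → F₁ (s, φ) = F₂ (s, φ) := by
    intro φ hφ hE s hs
    obtain ⟨E, h1, h2⟩ := hE s hs
    have hp : (s, φ) ∈ polarStrip := ⟨hs, hφ⟩
    rw [hF₁h _ hp (by rw [h1]; exact h2), hF₂h _ hp (by rw [h1, Complex.conj_ofReal]; exact h2),
      h1, Complex.conj_ofReal]
  have hmem : ∀ E : ℝ, E ≠ 0 → M.polarOf E ∈ polarStrip := fun E hE =>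
    M.polarOf_mem (by exact_mod_cast hE) (by simp)
  -- On the continuum the factor `Q` cancels in charMinus / charPlus, so det S = F₂ / F₁. The
  -- convention det S = |det S| e^{2iδ} accounts for the division by 2.
  refine ⟨fun E => (θ₂ (M.polarOf E) - θ₁ (M.polarOf E)) / 2, ?_, ?_, ?_⟩
  · intro E hE
    have h1 : ContinuousWithinAt (fun E : ℝ => M.polarOf E) M.continuum E :=
      (continuousAt_polarOf_ofReal hE.1).continuousWithinAt
    exact (((hθ₂ _ (hmem E hE.1)).comp (f := fun E : ℝ => M.polarOf E) h1 fun x hx => hmem x hx.1).sub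
      ((hθ₁ _ (hmem E hE.1)).comp (f := fun E : ℝ => M.polarOf E) h1 fun x hx => hmem x hx.1)).div_const 2
  · intro E hE
    have hp := hmem E hE.1
    have hEg : (E : ℂ) ∉ M.gap := fun hg => (M.mem_gap_iff.mp hg).2 E hE rfl
    have hQE := hQ _ hEg
    have h1 := hF₁G _ hp
    have h2 := hF₂G _ hp
    rw [polarEnergy_polarOf] at h1 h2
    rw [Complex.conj_ofReal] at h2
    have h3 : M.detS E = F₂ (M.polarOf E) / F₁ (M.polarOf E) := by
      rw [hM.detS_eq hE.1 (hplus E hE), ← h1, ← h2, mul_div_mul_right _ _ hQE]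
    rw [h3, norm_div]
    conv_lhs => rw [hθF₁ _ hp, hθF₂ _ hp]
    rw [mul_div_mul_comm, ← Complex.exp_sub]
    push_cast
    congr 2
    ring
  have hpi : Real.pi ∈ Set.Icc 0 Real.pi := ⟨Real.pi_pos.le, le_rfl⟩
  have h0mem : (0 : ℝ) ∈ Set.Icc 0 Real.pi := ⟨le_rfl, Real.pi_pos.le⟩
  have hm0 := M.m_pos
  -- The limits on the negative axis are those on the positive axis plus the turning along the half
  -- circles. In the sum of the two increments the unknown limits `a` and `b` cancel.
  refine ⟨(b₂ + -1 * (j + (M.m : ℝ)⁻¹ - 1) * Real.pi - (b₁ + 1 * (j + (M.m : ℝ)⁻¹ - 1) * Real.pi)) / 2 -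
    (a₂ + -1 * (N - n) * Real.pi - (a₁ + 1 * (N - n) * Real.pi)) / 2,
    (a₂ - a₁) / 2 - (b₂ - b₁) / 2, ?_, fun _ => ⟨_, _, ?_, ?_, rfl⟩, fun hneg => ?_,
    fun _ => ⟨_, _, ?_, ?_, rfl⟩, fun hpos => ?_⟩
  · push_cast
    field_simp
    ring
  · exact (tendsto_comp_polarOf_atBot (f := fun p => θ₂ p - θ₁ p) (ha₂'.sub ha₁')).div_const 2
  · exact (tendsto_comp_polarOf_nhdsLT (f := fun p => θ₂ p - θ₁ p) (hb₂'.sub hb₁')).div_const 2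
  -- If the negative axis lies in the gap, the two quotients coincide on it, so its phases have
  -- equal increments and the contribution is 0.
  · have hE : ∀ s, 0 < s → ∃ E : ℝ, M.polarEnergy (s, Real.pi) = E ∧ (E : ℂ) ∈ M.gap := by
      intro s hs
      have hd := M.d_pos
      have hpos : 0 < M.d * s ^ M.m := by positivity
      refine ⟨-(M.d * s ^ M.m), ?_, mem_gap_of_notMem_continuum (neg_ne_zero.mpr hpos.ne') ?_⟩
      · rw [polarEnergy, Complex.exp_pi_mul_I]
        push_cast
        ring
      · intro hmem
        exact hneg fun x hx => mem_continuum_of_mul_pos hmem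
          (mul_pos_of_neg_of_neg (neg_lt_zero.mpr hpos) hx)
    have := sub_eq_of_common_values hpi hθ₂ hθ₁ hθF₂ hθF₁ hF₂0
      (fun s hs => (hcommon _ hpi hE s hs).symm) ha₂' ha₁' hb₂' hb₁'
    linarith
  · exact (tendsto_comp_polarOf_nhdsGT (f := fun p => θ₂ p - θ₁ p) (hb₂.sub hb₁)).div_const 2
  · exact (tendsto_comp_polarOf_atTop (f := fun p => θ₂ p - θ₁ p) (ha₂.sub ha₁)).div_const 2
  · have hE : ∀ s, 0 < s → ∃ E : ℝ, M.polarEnergy (s, 0) = E ∧ (E : ℂ) ∈ M.gap := by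
      intro s hs
      have hd := M.d_pos
      have hps : 0 < M.d * s ^ M.m := by positivity
      refine ⟨M.d * s ^ M.m, ?_, mem_gap_of_notMem_continuum hps.ne' ?_⟩
      · simp [polarEnergy]
      · intro hmem
        exact hpos fun x hx => mem_continuum_of_mul_pos hmem (mul_pos hps hx)
    have := sub_eq_of_common_values h0mem hθ₂ hθ₁ hθF₂ hθF₁ hF₂0
      (fun s hs => (hcommon _ h0mem hE s hs).symm) ha₂ ha₁ hb₂ hb₁
    linarith

/-- The scattering matrix is asymptotically unimodular at the ends of the continuum. -/
theorem tendsto_norm_charMinus_div {a b : Polynomial ℂ} {j : ℕ}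
    (hA : M.polyA = Polynomial.X ^ j * a) (hB : M.polyB = Polynomial.X ^ j * b)
    (hb : b.eval 0 ≠ 0) :
    Tendsto (fun p => ‖M.charMinus p / M.charPlus p‖) (atTop ×ˢ 𝓟 (Set.Icc 0 Real.pi)) (𝓝 1) ∧
    Tendsto (fun p => ‖M.charMinus p / M.charPlus p‖) (𝓝[>] 0 ×ˢ 𝓟 (Set.Icc 0 Real.pi)) (𝓝 1) := by
  have key : ∀ {l : Filter (ℝ × ℝ)} {G₁ G₂ D₁ D₂ : ℝ × ℝ → ℂ} {x y : ℂ}, ‖x‖ = ‖y‖ → x ≠ 0 →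
      Tendsto (fun p => G₁ p / D₁ p) l (𝓝 x) → Tendsto (fun p => G₂ p / D₂ p) l (𝓝 y) →
      (∀ᶠ p in l, ‖D₁ p‖ = ‖D₂ p‖ ∧ D₁ p ≠ 0) → Tendsto (fun p => ‖G₁ p / G₂ p‖) l (𝓝 1) := by
    intro l G₁ G₂ D₁ D₂ x y hxy hx h1 h2 h3
    have hy : y ≠ 0 := by rwa [← norm_ne_zero_iff, ← hxy, norm_ne_zero_iff]
    have h4 := h1.norm.div h2.norm (norm_ne_zero_iff.mpr hy)
    rw [hxy, div_self (norm_ne_zero_iff.mpr hy)] at h4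
    refine h4.congr' ?_
    filter_upwards [h3] with p hp
    have h5 : ‖D₂ p‖ ≠ 0 := by rw [← hp.1]; exact norm_ne_zero_iff.mpr hp.2
    rw [Pi.div_apply, norm_div, norm_div, norm_div, hp.1, div_div_div_cancel_right₀ h5]
  obtain ⟨c, hc, hc1, hc2⟩ := hM.exists_scaledKappa_threshold
  have hc' : (starRingEnd ℂ) c ≠ 0 := by simpa using hc
  refine ⟨key rfl one_ne_zero hM.tendsto_charMinus_atTop hM.tendsto_charPlus_atTop ?_,
    key ?_ (mul_ne_zero hc' hb) (tendsto_charMinus_threshold hc2 hA hB)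
      (tendsto_charPlus_threshold hc1 hA hB) ?_⟩
  · filter_upwards [tendsto_fst.eventually (eventually_gt_atTop (0 : ℝ))] with p hp
    refine ⟨by rw [norm_pow, norm_pow, RCLike.norm_conj], pow_ne_zero _ ?_⟩
    rw [Ne, map_eq_zero]
    exact M.polarEnergy_ne_zero hp
  · rw [norm_mul, norm_mul, RCLike.norm_conj]
  · filter_upwards [tendsto_fst.eventually (self_mem_nhdsWithin : Set.Ioi (0 : ℝ) ∈ 𝓝[>] 0)]
      with p hp
    have hpos := threshold_modulus_pos (M := M) j (s := p.1) hp
    rw [norm_ofReal_mul_exp hpos.le, norm_ofReal_mul_exp hpos.le]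
    exact ⟨rfl, mul_ne_zero (by exact_mod_cast hpos.ne') (Complex.exp_ne_zero _)⟩

end RegularCoupling

end EmitterModel

end

/-! ### The logarithmic derivative, the count of bound states, and the theorem -/

noncomputable section

/-- A continuous phase provides a logarithmic primitive. -/
theorem hasDerivAt_log_norm_add_phase {f : ℝ → ℂ} {δ : ℝ → ℝ} {x : ℝ} (hd : DifferentiableAt ℝ f x)
    (h0 : f x ≠ 0) (hδ : ContinuousAt δ x)
    (hph : ∀ᶠ y in 𝓝 x, f y = (‖f y‖ : ℂ) * Complex.exp (2 * Complex.I * δ y)) :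
    HasDerivAt (fun y => (Real.log ‖f y‖ : ℂ) + 2 * Complex.I * δ y) (deriv f x / f x) x := by
  set g : ℝ → ℂ := fun y => (Real.log ‖f y‖ : ℂ) + 2 * Complex.I * δ y with hg
  have hexp : ∀ᶠ y in 𝓝 x, f y = Complex.exp (g y) := by
    filter_upwards [hph, hd.continuousAt.eventually_ne h0] with y h1 h2
    rw [hg, Complex.exp_add, ← Complex.ofReal_exp, Real.exp_log (norm_pos_iff.mpr h2), ← h1]
  have him : ∀ y, (g y - g x).im = 2 * (δ y - δ x) := by
    intro y
    simp [hg]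
    ring
  -- A variation of 2δ by less than 2 < π keeps the principal logarithm of f y / f x equal to the
  -- difference of the two values of `g`.
  have hδ' : ∀ᶠ y in 𝓝 x, |δ y - δ x| < 1 := by
    have := hδ.eventually (Metric.ball_mem_nhds (δ x) one_pos)
    filter_upwards [this] with y hy
    rwa [Real.dist_eq] at hy
  have hlog : (fun y => g x + Complex.log (f y / f x)) =ᶠ[𝓝 x] g := by
    filter_upwards [hexp, hδ'] with y h1 h2
    have h3 := abs_lt.mp h2
    have h4 := Real.pi_gt_three
    rw [h1, hexp.self_of_nhds, ← Complex.exp_sub, Complex.log_exp (by rw [him]; linarith)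
      (by rw [him]; linarith)]
    ring
  refine HasDerivAt.congr_of_eventuallyEq ?_ hlog.symm
  have h1 : HasDerivAt (fun y => f y / f x) (deriv f x / f x) x := hd.hasDerivAt.div_const _
  have h2 := h1.clog_real (by rw [div_self h0]; exact Complex.one_mem_slitPlane)
  rw [div_self h0, div_one] at h2
  exact h2.const_add _

theorem integral_logDeriv_eq_of_phase {f : ℝ → ℂ} {δ : ℝ → ℝ} {J : Set ℝ} (hJ : IsOpen J)
    (hJc : J.OrdConnected) (hd : DifferentiableOn ℝ f J) (hi : LocallyIntegrableOn (deriv f) J)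
    (h0 : ∀ x ∈ J, f x ≠ 0) (hδ : ContinuousOn δ J)
    (hph : ∀ x ∈ J, f x = (‖f x‖ : ℂ) * Complex.exp (2 * Complex.I * δ x)) {x y : ℝ}
    (hx : x ∈ J) (hy : y ∈ J) : ∫ E in x..y, deriv f E / f E =
      ((Real.log ‖f y‖ : ℂ) + 2 * Complex.I * δ y) -
        ((Real.log ‖f x‖ : ℂ) + 2 * Complex.I * δ x) := by
  have hsub : Set.uIcc x y ⊆ J := hJc.uIcc_subset hx hy
  refine intervalIntegral.integral_eq_sub_of_hasDerivAt
    (f := fun y => (Real.log ‖f y‖ : ℂ) + 2 * Complex.I * δ y) (fun E hE => ?_) ?_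
  · have hJE := hJ.mem_nhds (hsub hE)
    exact hasDerivAt_log_norm_add_phase (hd.differentiableAt hJE) (h0 E (hsub hE))
      (hδ.continuousAt hJE) (by filter_upwards [hJE] with z hz using hph z hz)
  · have h1 : IntervalIntegrable (deriv f) volume x y :=
      (hi.integrableOn_compact_subset hsub isCompact_uIcc).intervalIntegrable
    simp only [div_eq_mul_inv]
    exact h1.mul_continuousOn ((hd.continuousOn.mono hsub).inv₀ fun E hE => h0 E (hsub hE))

namespace EmitterModel

/-- Since |f| tends to 1 at both ends, the term log|f| of the primitive drops out and only the
increment of the phase is left. -/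
theorem hasImproperIntegral_of_phase {f : ℝ → ℂ} {δ : ℝ → ℝ} {J : Set ℝ} (hJ : IsOpen J)
    (hJc : J.OrdConnected) (hd : DifferentiableOn ℝ f J) (hi : LocallyIntegrableOn (deriv f) J)
    (h0 : ∀ x ∈ J, f x ≠ 0) (hδ : ContinuousOn δ J)
    (hph : ∀ x ∈ J, f x = (‖f x‖ : ℂ) * Complex.exp (2 * Complex.I * δ x)) {lower upper : Filter ℝ}
    (hl : J ∈ lower) (hu : J ∈ upper) (hl1 : Tendsto (fun x => ‖f x‖) lower (𝓝 1))
    (hu1 : Tendsto (fun x => ‖f x‖) upper (𝓝 1)) {a b : ℝ} (ha : Tendsto δ lower (𝓝 a))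
    (hb : Tendsto δ upper (𝓝 b)) :
    HasImproperIntegral (fun E => deriv f E / f E) lower upper
      (2 * Complex.I * ((b - a : ℝ) : ℂ)) := by
  have hlim : ∀ {l : Filter ℝ} {t : ℝ}, Tendsto (fun x => ‖f x‖) l (𝓝 1) → Tendsto δ l (𝓝 t) →
      Tendsto (fun y => (Real.log ‖f y‖ : ℂ) + 2 * Complex.I * δ y) l
        (𝓝 (2 * Complex.I * (t : ℂ))) := by
    intro l t h1 h2
    have h3 := (Complex.continuous_ofReal.tendsto _).comp (h1.log one_ne_zero)
    have h4 := ((Complex.continuous_ofReal.tendsto _).comp h2).const_mul (2 * Complex.I)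
    have h5 := h3.add h4
    rwa [Real.log_one, Complex.ofReal_zero, zero_add] at h5
  have h1 := ((hlim hu1 hb).comp tendsto_snd).sub ((hlim hl1 ha).comp (tendsto_fst (g := upper)))
  rw [HasImproperIntegral, Complex.ofReal_sub, mul_sub]
  refine h1.congr' ?_
  filter_upwards [prod_mem_prod hl hu] with p hp
  exact (integral_logDeriv_eq_of_phase hJ hJc hd hi h0 hδ hph hp.1 hp.2).symm

variable {N : ℕ} {M : EmitterModel N}

theorem HasWindingPhase.hasWindingIntegral {w : ℝ} (hw : M.HasWindingPhase w)
    (h0 : ∀ E ∈ M.continuum, M.detS E ≠ 0) (hd : DifferentiableOn ℝ M.detS M.continuum)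
    (hi : LocallyIntegrableOn (deriv M.detS) M.continuum)
    (hneg : Set.Iio 0 ⊆ M.continuum → Tendsto (fun E => ‖M.detS E‖) atBot (𝓝 1) ∧
      Tendsto (fun E => ‖M.detS E‖) (𝓝[<] 0) (𝓝 1))
    (hpos : Set.Ioi 0 ⊆ M.continuum → Tendsto (fun E => ‖M.detS E‖) (𝓝[>] 0) (𝓝 1) ∧
      Tendsto (fun E => ‖M.detS E‖) atTop (𝓝 1)) : M.HasWindingIntegral w := by
  obtain ⟨δ, hδ, hph, wneg, wpos, hsum, h1, h2, h3, h4⟩ := hw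
  refine ⟨2 * Complex.I * (wneg : ℂ), 2 * Complex.I * (wpos : ℂ), ?_, fun h => ?_, fun h => ?_,
    fun h => ?_, fun h => ?_⟩
  · rw [hsum]
    push_cast
    linear_combination (2 * (wneg : ℂ) + 2 * wpos) * Complex.I_sq
  · obtain ⟨a, b, ha, hb, rfl⟩ := h1 h
    exact hasImproperIntegral_of_phase isOpen_Iio Set.ordConnected_Iio (hd.mono h) (hi.mono_set h)
      (fun x hx => h0 x (h hx)) (hδ.mono h) (fun x hx => hph x (h hx)) (Iio_mem_atBot 0)
      self_mem_nhdsWithin (hneg h).1 (hneg h).2 ha hb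
  · rw [h2 h, Complex.ofReal_zero, mul_zero]
  · obtain ⟨a, b, ha, hb, rfl⟩ := h3 h
    exact hasImproperIntegral_of_phase isOpen_Ioi Set.ordConnected_Ioi (hd.mono h) (hi.mono_set h)
      (fun x hx => h0 x (h hx)) (hδ.mono h) (fun x hx => hph x (h hx)) self_mem_nhdsWithin
      (Ioi_mem_atTop 0) (hpos h).1 (hpos h).2 ha hb
  · rw [h4 h, Complex.ofReal_zero, mul_zero]

theorem mem_offContinuum_iff_eq_zero_or_mem_gap {E : ℂ} :
    E ∈ M.offContinuum ↔ E = 0 ∨ E ∈ M.gap := by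
  rw [mem_gap_iff]
  by_cases h : E = 0
  · subst h
    simp only [true_or, iff_true]
    intro x hx h0
    exact hx.1 (by exact_mod_cast h0.symm)
  · simp [h]

theorem RegularCoupling.finrank_boundSpace_gap (hM : M.RegularCoupling) {E : ℂ} (hE : E ∈ M.gap) :
    FiniteDimensional ℂ (M.boundSpace E) ∧
      Module.finrank ℂ (M.boundSpace E) = analyticOrderNatAt M.charFun E :=
  hM.finrank_boundSpace hE
    (Nat.cast_analyticOrderNatAt (hM.analyticOrderAt_charFun_ne_top E)).symm

theorem RegularCoupling.charFun_eq_zero_of_boundSpace_ne_bot (hM : M.RegularCoupling) {E : ℂ}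
    (hE : E ∈ M.gap) (h : M.boundSpace E ≠ ⊥) : M.charFun E = 0 := by
  by_contra h0
  obtain ⟨h1, h2⟩ := hM.finrank_boundSpace_gap hE
  have h3 : analyticOrderAt M.charFun E = 0 :=
    (hM.differentiableOn_charFun.analyticAt (M.isOpen_gap.mem_nhds hE)).analyticOrderAt_eq_zero.mpr h0
  rw [analyticOrderNatAt, h3, ENat.toNat_zero, Submodule.finrank_eq_zero] at h2
  exact h h2

theorem RegularCoupling.numBoundStates_eq (hM : M.RegularCoupling) {Z : Finset ℂ}
    (hZ : ∀ z, z ∈ Z ↔ z ∈ M.gap ∧ M.charFun z = 0) :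
    M.numBoundStates = Module.finrank ℂ (M.boundSpace 0) +
      ∑ z ∈ Z, analyticOrderNatAt M.charFun z := by
  classical
  have h0 : (0 : ℂ) ∉ Z := fun h => (M.mem_gap_iff.mp ((hZ 0).mp h).1).1 rfl
  -- The threshold energy 0 lies off the continuum but not in the gap, so it is counted apart from
  -- the zeros.
  rw [numBoundStates, finsum_mem_eq_sum_of_inter_support_eq (t := insert 0 Z), Finset.sum_insert h0]
  · congr 1
    exact Finset.sum_congr rfl fun z hz => (hM.finrank_boundSpace_gap ((hZ z).mp hz).1).2
  · ext E
    simp only [Set.mem_inter_iff, Function.mem_support, Finset.coe_insert, Set.mem_insert_iff,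
      Finset.mem_coe]
    refine and_congr_left fun hE => ?_
    rw [mem_offContinuum_iff_eq_zero_or_mem_gap, hZ]
    refine or_congr_right ⟨fun hg => ⟨hg, hM.charFun_eq_zero_of_boundSpace_ne_bot hg fun h => hE ?_⟩,
      fun hg => hg.1⟩
    rw [h, finrank_bot]

end EmitterModel

end

theorem theorem2 {N : ℕ} (M : EmitterModel N)
    (hV_meas : AEStronglyMeasurable M.V volume)
    (hV_loc : LocallyIntegrable (fun k : ℝ => ‖M.V k‖ ^ 2) volume)
    (hV_cont : ContinuousAt M.V 0)
    (hV_zero : M.V 0 ≠ 0)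
    (hV_decay : ∃ γ : ℝ, 1 < γ ∧
      (fun k : ℝ => ‖M.V k‖ ^ 2) =o[cocompact ℝ] fun k : ℝ => |k| ^ ((M.m : ℝ) - γ))
    (hV_holder : ∃ (C α : ℝ) (p : ℕ), 0 < α ∧ ∀ k k' : ℝ,
      |‖M.V k‖ ^ 2 - ‖M.V k'‖ ^ 2| ≤ C * (1 + |k| + |k'|) ^ p * |k - k'| ^ α)
    (hKR : ∀ x : Fin N → ℂ, (star x ⬝ᵥ (M.KR *ᵥ x)).im ≤ 0)
    (h_bic : ∀ E : ℝ, ¬ M.IsBoundStateInContinuum E)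
    (h_bright : ¬ M.HasBrightZeroEnergyEigenstate)
    (h_det : ∀ E ∈ M.continuum, M.detS E ≠ 0) :
    -- the boundary values that define the scattering matrix exist
    (∀ E ∈ M.continuum, ∀ k k' : ℝ,
      Tendsto (fun η : ℝ => M.T (E + η * Complex.I) k k') (𝓝[>] 0) (𝓝 (M.TPlus E k k'))) ∧
    -- the number of bound states is finite
    {E ∈ M.offContinuum | M.boundSpace E ≠ ⊥}.Finite ∧
    (∀ E ∈ M.offContinuum, FiniteDimensional ℂ (M.boundSpace E)) ∧
    -- the winding phase, as the increment of the continuous scattering phase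
    M.HasWindingPhase (Real.pi * ((N : ℝ) - M.numBoundStates) +
      Real.pi * (((M.m : ℝ) - 1) / M.m)) ∧
    -- the winding phase, as the integral of the logarithmic derivative where there is one
    (DifferentiableOn ℝ M.detS M.continuum → LocallyIntegrableOn (deriv M.detS) M.continuum →
      M.HasWindingIntegral (Real.pi * ((N : ℝ) - M.numBoundStates) +
        Real.pi * (((M.m : ℝ) - 1) / M.m))) := by
  have hM := M.regularCoupling hV_meas hV_zero hV_decay hV_holder
  have hplus : ∀ E ∈ M.continuum, M.charPlus (M.polarOf E) ≠ 0 := fun E hE =>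
    hM.charPlus_ne_zero_of_no_bic hE (h_bic E)
  -- det S is the ratio of the two boundary values, so its nonvanishing excludes zeros approached
  -- from the lower half plane.
  have hminus : ∀ E ∈ M.continuum, M.charMinus (M.polarOf E) ≠ 0 := by
    intro E hE h0
    refine h_det E hE ?_
    rw [hM.detS_eq hE.1 (hplus E hE), h0, zero_div]
  obtain ⟨a, b, hA, hB, hb⟩ := EmitterModel.exists_dark_factorization hV_zero hKR h_bright
  have hfin := hM.finite_zeros hA hB hb hplus hminus
  have hZ : ∀ z, z ∈ hfin.toFinset ↔ z ∈ M.gap ∧ M.charFun z = 0 := fun z => hfin.mem_toFinset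
  obtain ⟨hfd0, hrank0⟩ := EmitterModel.finrank_boundSpace_zero hV_cont hV_zero hKR
  have hphase := hM.hasWindingPhase hA hB hb hplus hminus hZ
  -- The exponent `j` is the dimension of the zero-energy bound space; with the zeros of the
  -- characteristic function it makes up N_B.
  rw [← hrank0, ← hM.numBoundStates_eq hZ] at hphase
  refine ⟨fun E hE k k' => ?_, ?_, fun E hE => ?_, hphase, fun hd hi => ?_⟩
  · rw [hM.TPlus_eq hE.1 (hplus E hE)]
    exact hM.tendsto_T hE.1 (hplus E hE) k k'
  · refine (hfin.insert 0).subset ?_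
    rintro E ⟨hE, hne⟩
    rcases EmitterModel.mem_offContinuum_iff_eq_zero_or_mem_gap.mp hE with h | h
    · exact Or.inl h
    · exact Or.inr ⟨h, hM.charFun_eq_zero_of_boundSpace_ne_bot h hne⟩
  · rcases EmitterModel.mem_offContinuum_iff_eq_zero_or_mem_gap.mp hE with rfl | h
    · exact hfd0
    · exact (hM.finrank_boundSpace_gap h).1
  · obtain ⟨h1, h2⟩ := hM.tendsto_norm_charMinus_div hA hB hb
    have hpi : Real.pi ∈ Set.Icc 0 Real.pi := ⟨Real.pi_pos.le, le_rfl⟩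
    have h0pi : (0 : ℝ) ∈ Set.Icc 0 Real.pi := ⟨le_rfl, Real.pi_pos.le⟩
    have hedge : ∀ (l : Filter ℝ), ∀ φ ∈ Set.Icc 0 Real.pi,
        Tendsto (fun s : ℝ => (s, φ)) l (l ×ˢ 𝓟 (Set.Icc 0 Real.pi)) := fun l φ hφ =>
      tendsto_id.prodMk (tendsto_principal.mpr (Eventually.of_forall fun _ => hφ))
    have hdet : ∀ E ∈ M.continuum, ‖M.charMinus (M.polarOf E) / M.charPlus (M.polarOf E)‖ =
        ‖M.detS E‖ := fun E hE => by rw [hM.detS_eq hE.1 (hplus E hE)]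
    refine hphase.hasWindingIntegral h_det hd hi (fun h => ⟨?_, ?_⟩) fun h => ⟨?_, ?_⟩
    · refine (EmitterModel.tendsto_comp_polarOf_atBot
        (M := M) (f := fun p => ‖M.charMinus p / M.charPlus p‖) (h1.comp (hedge _ _ hpi))).congr' ?_
      filter_upwards [Iio_mem_atBot 0] with E hE using hdet E (h hE)
    · refine (EmitterModel.tendsto_comp_polarOf_nhdsLT
        (M := M) (f := fun p => ‖M.charMinus p / M.charPlus p‖) (h2.comp (hedge _ _ hpi))).congr' ?_
      filter_upwards [self_mem_nhdsWithin] with E hE using hdet E (h hE)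
    · refine (EmitterModel.tendsto_comp_polarOf_nhdsGT
        (M := M) (f := fun p => ‖M.charMinus p / M.charPlus p‖) (h2.comp (hedge _ _ h0pi))).congr' ?_
      filter_upwards [self_mem_nhdsWithin] with E hE using hdet E (h hE)
    · refine (EmitterModel.tendsto_comp_polarOf_atTop
        (M := M) (f := fun p => ‖M.charMinus p / M.charPlus p‖) (h1.comp (hedge _ _ h0pi))).congr' ?_
      filter_upwards [Ioi_mem_atTop 0] with E hE using hdet E (h hE)
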